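/- All functions are real-valued and smooth in $(x,t)\in\mathbb R^2$ unless said otherwise. For potentials $m_1,m_2,n_1,n_2$ let $$\Phi_x=U\Phi,\qquad U=\begin{pmatrix}0&\lambda m_1&1\\ \lambda n_1&0&\lambda m_2\\ 1&\lambda n_2&0\end{pmatrix}.$$ A flow of the hierarchy is an evolution of $(m_1,m_2,n_1,n_2)$ for which there is a $3\times3$ matrix $V$, whose entries are Laurent polynomials in $\lambda$ with smooth coefficients depending on $(x,t)$, such that $U_t-V_x+[U,V]=0$ identically in $\lambda$. The following holds for every flow of the hierarchy. **(A) Conserved densities.** Let $\lambda\in\mathbb C\setminus\{0\}$ and let $\Phi=(\varphi_1,\varphi_2,\varphi_3)^T$ be a complex $C^2$ solution of $\Phi_x=U\Phi$, $\Phi_t=V\Phi$. Where the denominators do not vanish: * Case 1: $a=\varphi_1/\varphi_2$, $b=\varphi_3/\varphi_2$ satisfy $a_x=\lambda m_1+b-a\rho$, $b_x=a+\lambda n_2-b\rho$ with $\rho=(\ln\varphi_2)_x=\lambda n_1a+\lambda m_2b$, and $(\ln\varphi_2)_t=V_{21}a+V_{22}+V_{23}b$. * Case 2: $\sigma=\varphi_2/\varphi_1$,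 $\tau=\varphi_3/\varphi_1$ satisfy $\sigma_x=\lambda n_1+\lambda m_2\tau-\sigma\bar\rho$, $\tau_x=1+\lambda n_2\sigma-\tau\bar\rho$ with $\bar\rho=(\ln\varphi_1)_x=\lambda m_1\sigma+\tau$, and $(\ln\varphi_1)_t=V_{11}+V_{12}\sigma+V_{13}\tau$. * Case 3: $\alpha=\varphi_1/\varphi_3$, $\beta=\varphi_2/\varphi_3$ satisfy $\alpha_x=\lambda m_1\beta+1-\alpha\hat\rho$, $\beta_x=\lambda n_1\alpha+\lambda m_2-\beta\hat\rho$ with $\hat\rho=(\ln\varphi_3)_x=\alpha+\lambda n_2\beta$, and $(\ln\varphi_3)_t=V_{31}\alpha+V_{32}\beta+V_{33}$. In each case $(\ln\varphi_i)_x$ is a conserved density: $\partial_t(\ln\varphi_i)_x=\partial_x(\ln\varphi_i)_t$, and $\frac{d}{dt}\int_{x_0}^{x_1}(\ln\varphi_i)_x\,dx=(\ln\varphi_i)_t\big|_{x_0}^{x_1}$ if $\varphi_i\neq0$ on $[x_0,x_1]$. **Terminology for (B) and (C).** That $\int\varrho\,dx$ is conserved, with flux $J$, means: $\varrho_t=J_x$;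 $\int_0^L\varrho\,dx$ does not depend on $t$ whenever the potentials and $V$ are $L$-periodic in $x$; and $\int_{\mathbb R}\varrho\,dx$ does not depend on $t$ whenever it converges absolutely and $J(R,t)-J(-R,t)\to0$ locally uniformly in $t$ as $R\to\infty$. In (B), "bounded" means that the function and all its partial derivatives are bounded in $x$, locally uniformly in $t$. **(B) Expansion in powers $\lambda^j$, $j\ge0$.** Let the potentials and the coefficients of $V$ be bounded. In each case the Riccati-type system has exactly one solution that is a formal power series in $\lambda$ with bounded coefficients and with $\rho=O(\lambda)$ in Case 1, $\bar\rho=1+O(\lambda)$ in Case 2, $\hat\rho=1+O(\lambda)$ in Case 3. The integral of every coefficient of $\rho,\bar\rho,\hat\rho$ is conserved, the flux being the corresponding coefficient of the series for $(\ln\varphi_i)_t$ in (A). If the potentials are rapidly decreasing in $x$ with all derivatives, and the coefficients of $V$ are so up to functions of $t$ alone, then for $j\ge1$ the integral over $\mathbb R$ of the coefficient of $\lambda^j$ converges and is constant in $t$. Let moreover $m_i=u_i-u_{i,xx}$, $n_i=v_i-v_{i,xx}$ with bounded $u_i,v_i$, and let $f_1=u_2-v_{1x}$, $f_2=u_1+v_{2x}$,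 $g_1=v_2+u_{1x}$, $g_2=v_1-u_{2x}$. In Case 1, $a=\sum a_j\lambda^j$, $b=\sum b_j\lambda^j$ with $a_0=b_0=a_2=b_2=0$, $a_1=-g_1$, $b_1=-f_2$. The coefficients of $\lambda^2$ and $\lambda^4$ in $\rho$ and of $\lambda^2$ in $\bar\rho$ give the conserved quantities $$\rho_1=-\int(n_1g_1+m_2f_2)\,dx,$$ $$\rho_3=\int(n_1a_3+m_2b_3)\,dx=\int(n_1g_1+m_2f_2)(f_1g_1+f_2g_2)\,dx,$$ $$\bar\rho_2=\frac12\int(m_1+n_2)(f_1+g_2)\,dx,$$ where for $\rho_3$ and $\bar\rho_2$ the coefficient and the displayed density differ by an $x$-derivative, and their integrals agree over a period (periodic potentials) and over $\mathbb R$ (rapidly decreasing potentials). **(C) Expansion in powers $\lambda^{-j}$, $j\ge0$.** Let $m_1n_1+m_2n_2>0$ everywhere, and in addition $m_1\ne0$ everywhere in Case 2 and $n_2\neq0$ everywhere in Case 3. In each case the Riccati-type system has exactly one solution that is a formal power series in $\lambda^{-1}$ with smooth coefficients and for which the coefficient of $\lambda^1$ in $\rho$ (respectively $\bar\rho$, $\hat\rho$)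 is $\sqrt{m_1n_1+m_2n_2}$. The integral of every coefficient of $\rho,\bar\rho,\hat\rho$ is conserved, with the corresponding coefficient of $(\ln\varphi_i)_t$ as flux. The coefficient of $\lambda^1$ gives $\rho_0=\int\sqrt{m_1n_1+m_2n_2}\,dx$, and the coefficients of $\lambda^0$ in $\rho,\bar\rho,\hat\rho$ give $$\rho_{-1}=\int\frac{2m_1m_2+2n_1n_2+m_1n_{1x}-m_{1x}n_1+m_{2x}n_2-m_2n_{2x}}{4(m_1n_1+m_2n_2)}\,dx,$$ $$\bar\rho_{-1}=\int\frac{2m_1^2m_2+2m_1n_1n_2-m_{2x}m_1n_2+4m_{1x}m_2n_2-3n_{2x}m_1m_2+m_{1x}m_1n_1-n_{1x}m_1^2}{4m_1(m_1n_1+m_2n_2)}\,dx,$$ $$\hat\rho_{-1}=\int\frac{2n_1n_2^2+2m_1m_2n_2-m_{2x}n_2^2+4n_{2x}m_1n_1-3m_{1x}n_1n_2+n_{2x}m_2n_2-n_{1x}m_1n_2}{4n_2(m_1n_1+m_2n_2)}\,dx.$$ **(D) Infinitely many.** Each of the six sequences of coefficients in (B) and (C) contains infinitely many conserved quantities that are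 linearly independent as functionals of smooth $1$-periodic potentials. **(E)** With $u_i,v_i,f_i,g_i$ as in (B) (smooth) and an arbitrary smooth function $\Gamma$, the system $$\begin{aligned} &m_{1t}+(\Gamma m_1)_x+n_2(g_1g_2-\Gamma)+m_1(f_2g_2+2f_1g_1)=0,\\ &m_{2t}+(\Gamma m_2)_x-n_1(g_1g_2-\Gamma)-m_2(f_1g_1+2f_2g_2)=0,\\ &n_{1t}+(\Gamma n_1)_x-m_2(f_1f_2-\Gamma)-n_1(f_2g_2+2f_1g_1)=0,\\ &n_{2t}+(\Gamma n_2)_x+m_1(f_1f_2-\Gamma)+n_2(f_1g_1+2f_2g_2)=0 \end{aligned}$$ ($\Gamma=0$ is the first negative flow) is equivalent to $U_t-V_x+[U,V]=0$ with $$V=\begin{pmatrix}-f_1g_1&g_1/\lambda&-g_1g_2\\ f_1/\lambda&-\lambda^{-2}+f_1g_1+f_2g_2&g_2/\lambda\\ -f_1f_2&f_2/\lambda&-f_2g_2\end{pmatrix}-\lambda\Gamma\begin{pmatrix}0&m_1&0\\ n_1&0&m_2\\ 0&n_2&0\end{pmatrix},$$ so it is a flow of the hierarchy. -/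

import Mathlib

open Filter Topology MeasureTheory
open scoped LaurentPolynomial LaurentSeries ContDiff

namespace FourCH

noncomputable section

/-! ### Functions of `(x, t)` and their partial derivatives -/

/-- Real functions of `(x, t)`; sums and products are pointwise. -/
abbrev Fn : Type := ℝ → ℝ → ℝ

/-- `∂/∂x`, as a map that sends `0` to `0` so that it can be applied to coefficients of series. -/
def dX : ZeroHom Fn Fn where
  toFun f := fun x t => deriv (fun y => f y t) x
  map_zero' := by
    funext x t
    simp

/-- `∂/∂t`. -/
def dT : ZeroHom Fn Fn where
  toFun f := fun x t => deriv (fun s => f x s) t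
  map_zero' := by
    funext x t
    simp

/-- Jointly smooth functions of `(x, t) ∈ ℝ²`. -/
def Smooth (f : Fn) : Prop := ContDiff ℝ ∞ (fun z : ℝ × ℝ => f z.1 z.2)

/-- Smooth, and every partial derivative is `O((1 + |x|)^(-N))`, locally uniformly in `t`. -/
def Weighted (N : ℕ) (f : Fn) : Prop :=
  Smooth f ∧ ∀ i j : ℕ, ∀ T : ℝ, ∃ C : ℝ, ∀ x t : ℝ, |t| ≤ T →
    (1 + |x|) ^ N * |(dX^[i] (dT^[j] f)) x t| ≤ C

/-- Smooth with all partial derivatives bounded in `x`, locally uniformly in `t`. -/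
def Bdd (f : Fn) : Prop := Weighted 0 f

/-- Smooth with all partial derivatives rapidly decreasing in `x`, locally uniformly in `t`. -/
def Decaying (f : Fn) : Prop := ∀ N, Weighted N f

/-- `f` is `L`-periodic in `x`. -/
def PeriodicX (L : ℝ) (f : Fn) : Prop := ∀ x t, f (x + L) t = f x t

/-! ### The spectral problem and its flows -/

/-- The four potentials `m₁, m₂, n₁, n₂`. -/
@[ext]
structure Potential (A : Type*) where
  m1 : A
  m2 : A
  n1 : A
  n2 : A

/-- Apply a map to the four potentials. -/
def Potential.map {A B : Type*} (f : A → B) (q : Potential A) : Potential B :=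
  ⟨f q.m1, f q.m2, f q.n1, f q.n2⟩

/-- All four potentials have the property `P`. -/
def Potential.All {A : Type*} (P : A → Prop) (q : Potential A) : Prop :=
  P q.m1 ∧ P q.m2 ∧ P q.n1 ∧ P q.n2

/-- The matrix `U` of the spectral problem `Φ_x = U Φ`, with spectral parameter `l`. -/
def spectralU {A : Type*} [CommRing A] (l : A) (q : Potential A) : Matrix (Fin 3) (Fin 3) A :=
  !![0, l * q.m1, 1;
     l * q.n1, 0, l * q.m2;
     1, l * q.n2, 0]

/-- 3 × 3 matrices depending on `(x, t)`, whose entries are Laurent polynomials in `λ`. -/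
abbrev LaxMatrix : Type := Matrix (Fin 3) (Fin 3) Fn[T;T⁻¹]

/-- Every coefficient of every entry has the property `P`. -/
def LaxMatrix.All (P : Fn → Prop) (V : LaxMatrix) : Prop :=
  ∀ (i j : Fin 3) (k : ℤ), P ((V i j).coeff k)

/-- `U` as a Laurent polynomial in `λ = T`. -/
def laxU (q : Potential Fn) : LaxMatrix :=
  spectralU (LaurentPolynomial.T 1) (q.map LaurentPolynomial.C)

/-- Apply `D` to every coefficient of a Laurent polynomial. -/
def mapCoeff (D : ZeroHom Fn Fn) (p : Fn[T;T⁻¹]) : Fn[T;T⁻¹] :=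
  AddMonoidAlgebra.ofCoeff (p.coeff.mapRange D (map_zero D))

/-- `q` evolves by the flow of the hierarchy with time part `Φ_t = V Φ`: the zero-curvature
equation `U_t - V_x + [U, V] = 0` holds identically in `λ`. -/
def IsFlow (q : Potential Fn) (V : LaxMatrix) : Prop :=
  (laxU q).map (mapCoeff dT) - V.map (mapCoeff dX) + (laxU q * V - V * laxU q) = 0

/-- The value at `(x, t)` of a Laurent polynomial in the complex number `λ = l`. -/
def evalAt (l : ℂ) (x t : ℝ) (p : Fn[T;T⁻¹]) : ℂ :=
  p.coeff.sum fun j c => (c x t : ℂ) * l ^ j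

/-! ### Projective coordinates -/

/-- The three choices of projective coordinates:
`I`: `(a, b) = (φ₁/φ₂, φ₃/φ₂)`; `II`: `(σ, τ) = (φ₂/φ₁, φ₃/φ₁)`; `III`: `(α, β) = (φ₁/φ₃, φ₂/φ₃)`. -/
inductive Chart
  | I
  | II
  | III

/-- The index of the component of `Φ` by which one divides (components are numbered from `0`). -/
def Chart.den : Chart → Fin 3
  | .I => 1
  | .II => 0
  | .III => 2

/-- The index of the numerator of the first projective coordinate. -/
def Chart.fst : Chart → Fin 3
  | .I => 0
  | .II => 1
  | .III => 0

/-- The index of the numerator of the second projective coordinate. -/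
def Chart.snd : Chart → Fin 3
  | .I => 2
  | .II => 2
  | .III => 1

section Algebra

variable {A : Type*} [CommRing A]

/-- `(ln φᵢ)_x` in terms of the projective coordinates `(y, z)`. -/
def density (c : Chart) (l : A) (q : Potential A) (y z : A) : A :=
  match c with
  | .I => l * q.n1 * y + l * q.m2 * z
  | .II => l * q.m1 * y + z
  | .III => y + l * q.n2 * z

/-- The right-hand side of the Riccati-type equation for `y_x`. -/
def riccatiFst (c : Chart) (l : A) (q : Potential A) (y z : A) : A :=
  match c with
  | .I => l * q.m1 + z - y * density .I l q y z
  | .II => l * q.n1 + l * q.m2 * z - y * density .II l q y z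
  | .III => l * q.m1 * z + 1 - y * density .III l q y z

/-- The right-hand side of the Riccati-type equation for `z_x`. -/
def riccatiSnd (c : Chart) (l : A) (q : Potential A) (y z : A) : A :=
  match c with
  | .I => y + l * q.n2 - z * density .I l q y z
  | .II => 1 + l * q.n2 * y - z * density .II l q y z
  | .III => l * q.n1 * y + l * q.m2 - z * density .III l q y z

/-- `(ln φᵢ)_t` in terms of the projective coordinates `(y, z)`, where `Φ_t = V Φ`. -/
def flux (c : Chart) (V : Matrix (Fin 3) (Fin 3) A) (y z : A) : A :=
  match c with
  | .I => V 1 0 * y + V 1 1 + V 1 2 * z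
  | .II => V 0 0 + V 0 1 * y + V 0 2 * z
  | .III => V 2 0 * y + V 2 1 * z + V 2 2

end Algebra

/-! ### Formal expansions

A formal Laurent series in `λ` (`s = 1`) or in `λ⁻¹` (`s = -1`) is an element of `Fn⸨X⸩` with
`X = λ ^ s`. -/

/-- The spectral parameter `λ`, as a formal Laurent series in `λ ^ s`, `s = ±1`. -/
def lam (s : ℤ) : Fn⸨X⸩ := HahnSeries.single s 1

/-- The coefficient of `λ ^ j` in a formal Laurent series in `λ ^ s`, `s = ±1`. -/
def lamCoeff (s : ℤ) (f : Fn⸨X⸩) (j : ℤ) : Fn := f.coeff (s * j)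

/-- The potentials as (constant) series. -/
def series (q : Potential Fn) : Potential Fn⸨X⸩ := q.map HahnSeries.C

/-- A Laurent polynomial in `λ` as a formal Laurent series in `λ ^ s`, `s = ±1`. -/
def expand (s : ℤ) (p : Fn[T;T⁻¹]) : Fn⸨X⸩ :=
  p.coeff.sum fun j c => HahnSeries.single (s * j) c

/-- The series of the density `ρ`. -/
def rho (c : Chart) (s : ℤ) (q : Potential Fn) (y z : Fn⸨X⸩) : Fn⸨X⸩ :=
  density c (lam s) (series q) y z

/-- The series of the flux of `ρ`. -/
def current (c : Chart) (s : ℤ) (V : LaxMatrix) (y z : Fn⸨X⸩) : Fn⸨X⸩ :=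
  flux c (V.map (expand s)) y z

/-- `y, z` are formal power series in `λ ^ s`, with coefficients having the property `P`, that
solve the Riccati-type system of the chart `c`. -/
structure IsFormalSolution (c : Chart) (s : ℤ) (P : Fn → Prop) (q : Potential Fn)
    (y z : Fn⸨X⸩) : Prop where
  coeff_fst : ∀ j, P (y.coeff j)
  coeff_snd : ∀ j, P (z.coeff j)
  neg_fst : ∀ j < 0, y.coeff j = 0
  neg_snd : ∀ j < 0, z.coeff j = 0
  eq_fst : y.map dX = riccatiFst c (lam s) (series q) y z
  eq_snd : z.map dX = riccatiSnd c (lam s) (series q) y z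

/-- `√(m₁ n₁ + m₂ n₂)`. -/
def rho0 (q : Potential Fn) : Fn := fun x t =>
  √(q.m1 x t * q.n1 x t + q.m2 x t * q.n2 x t)

/-- The value of `ρ` at `λ = 0`. -/
def Chart.zeroth : Chart → Fn
  | .I => 0
  | .II => 1
  | .III => 1

/-- The expansion in non-negative powers of `λ`, with bounded coefficients. It starts from
`ρ = 0` in Case I and from the solution `ρ = 1` (that is, `φᵢ = eˣ`) in Cases II and III. -/
def IsExpansionZero (c : Chart) (q : Potential Fn) (y z : Fn⸨X⸩) : Prop :=
  IsFormalSolution c 1 Bdd q y z ∧ lamCoeff 1 (rho c 1 q y z) 0 = c.zeroth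

/-- The expansion in non-positive powers of `λ`, with `ρ = λ √(m₁ n₁ + m₂ n₂) + O(1)`. -/
def IsExpansionInfty (c : Chart) (q : Potential Fn) (y z : Fn⸨X⸩) : Prop :=
  IsFormalSolution c (-1) Smooth q y z ∧ lamCoeff (-1) (rho c (-1) q y z) 1 = rho0 q

/-- The denominators that occur in the expansion in non-positive powers do not vanish. -/
def Nondegenerate (c : Chart) (q : Potential Fn) : Prop :=
  (∀ x t, 0 < q.m1 x t * q.n1 x t + q.m2 x t * q.n2 x t) ∧
    match c with
    | .I => True
    | .II => ∀ x t, q.m1 x t ≠ 0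
    | .III => ∀ x t, q.n2 x t ≠ 0

/-! ### Conserved densities and conserved quantities -/

/-- `∫ ρ dx` over a period or over the line is a conserved quantity, with flux `J`. Over the line
the usual proviso is made that the integral converges and that the boundary terms cancel. -/
structure IsConserved (q : Potential Fn) (V : LaxMatrix) (ρ J : Fn) : Prop where
  smooth_density : Smooth ρ
  smooth_flux : Smooth J
  local_law : dT ρ = dX J
  periodic : ∀ L > 0, q.All (PeriodicX L) → V.All (PeriodicX L) →
    ∀ t t', ∫ x in (0 : ℝ)..L, ρ x t = ∫ x in (0 : ℝ)..L, ρ x t'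
  line : TendstoLocallyUniformly (fun R t => J R t - J (-R) t) (fun _ => 0) atTop →
    (∀ t, Integrable (fun x => ρ x t)) → ∀ t t', ∫ x, ρ x t = ∫ x, ρ x t'

/-- `f` differs from a function of `t` alone by a rapidly decreasing function. -/
def DecayingModConst (f : Fn) : Prop :=
  ∃ k : ℝ → ℝ, Decaying (fun x t => f x t - k t)

/-- For rapidly decreasing potentials, `∫ ρ dx` over the line converges and is conserved. -/
def IsConservedDecaying (q : Potential Fn) (V : LaxMatrix) (ρ : Fn) : Prop :=
  q.All Decaying → V.All DecayingModConst →
    (∀ t, Integrable (fun x => ρ x t)) ∧ ∀ t t', ∫ x, ρ x t = ∫ x, ρ x t'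

/-- `ρ` and `ρ'` differ by the total derivative `h_x`, and have the same integral over a period
(periodic potentials) and over the line (rapidly decreasing potentials). -/
structure IsEquivalent (q : Potential Fn) (ρ ρ' h : Fn) : Prop where
  eq : ρ = ρ' + dX h
  periodic : ∀ L > 0, q.All (PeriodicX L) →
    ∀ t, ∫ x in (0 : ℝ)..L, ρ x t = ∫ x in (0 : ℝ)..L, ρ' x t
  line : q.All Decaying → ∀ t, ∫ x, ρ x t = ∫ x, ρ' x t

/-- Among the conserved quantities `ρ_j`, the integral over the period `1` of the coefficient of
`λ ^ j` in `ρ`, infinitely many are linearly independent as functionals of the smooth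
`1`-periodic potentials. Here `E q y z` says that `y, z` is the expansion that belongs to `q`. -/
def InfinitelyManyIndependent (c : Chart) (s : ℤ)
    (E : Potential Fn → Fn⸨X⸩ → Fn⸨X⸩ → Prop) : Prop :=
  ∃ K : Set ℤ, K.Infinite ∧ ∀ w : ℤ →₀ ℝ, (↑w.support : Set ℤ) ⊆ K →
    (∀ q y z, q.All Smooth → q.All (PeriodicX 1) → E q y z →
      ∑ j ∈ w.support, w j * ∫ x in (0 : ℝ)..1, lamCoeff s (rho c s q y z) j x 0 = 0) →
    w = 0

/-! ### Explicit densities -/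

/-- `u₁, u₂, v₁, v₂`, from which the potentials are obtained as `m = u - u_xx`, `n = v - v_xx`. -/
structure Primitives where
  u1 : Fn
  u2 : Fn
  v1 : Fn
  v2 : Fn

namespace Primitives

variable (p : Primitives)

/-- All four functions have the property `P`. -/
def All (P : Fn → Prop) : Prop := P p.u1 ∧ P p.u2 ∧ P p.v1 ∧ P p.v2

/-- `mᵢ = uᵢ - uᵢ_xx`, `nᵢ = vᵢ - vᵢ_xx`. -/
def potential : Potential Fn :=
  ⟨p.u1 - dX (dX p.u1), p.u2 - dX (dX p.u2), p.v1 - dX (dX p.v1), p.v2 - dX (dX p.v2)⟩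

def f1 : Fn := p.u2 - dX p.v1
def f2 : Fn := p.u1 + dX p.v2
def g1 : Fn := p.v2 + dX p.u1
def g2 : Fn := p.v1 - dX p.u2

/-- `n₁ g₁ + m₂ f₂`. -/
def P : Fn := p.potential.n1 * p.g1 + p.potential.m2 * p.f2

/-- The density of `ρ₁`. -/
def rho1 : Fn := -p.P

/-- The density of `ρ₃`. -/
def rho3 : Fn := p.P * (p.f1 * p.g1 + p.f2 * p.g2)

/-- The density of `ρ̄₂`. -/
def rhoBar2 : Fn := fun x t =>
  1 / 2 * ((p.potential.m1 x t + p.potential.n2 x t) * (p.f1 x t + p.g2 x t))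

/-- The function whose `x`-derivative is `(n₁ a₃ + m₂ b₃) - ρ₃`. -/
def exact3 (a3 b3 : Fn) : Fn :=
  p.v1 * dX a3 - dX p.v1 * a3 + p.u2 * dX b3 - dX p.u2 * b3
    + p.v1 * p.g1 * p.P + p.u2 * p.f2 * p.P

end Primitives

/-- The density of `ρ₋₁`. -/
def rhoM1 (q : Potential Fn) : Fn :=
  (2 * q.m1 * q.m2 + 2 * q.n1 * q.n2 + q.m1 * dX q.n1 - dX q.m1 * q.n1
      + dX q.m2 * q.n2 - q.m2 * dX q.n2)
    / (4 * (q.m1 * q.n1 + q.m2 * q.n2))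

/-- The density of `ρ̄₋₁`. -/
def rhoBarM1 (q : Potential Fn) : Fn :=
  (2 * q.m1 ^ 2 * q.m2 + 2 * q.m1 * q.n1 * q.n2 - dX q.m2 * q.m1 * q.n2
      + 4 * dX q.m1 * q.m2 * q.n2 - 3 * dX q.n2 * q.m1 * q.m2
      + dX q.m1 * q.m1 * q.n1 - dX q.n1 * q.m1 ^ 2)
    / (4 * q.m1 * (q.m1 * q.n1 + q.m2 * q.n2))

/-- The density of `ρ̂₋₁`. -/
def rhoHatM1 (q : Potential Fn) : Fn :=
  (2 * q.n1 * q.n2 ^ 2 + 2 * q.m1 * q.m2 * q.n2 - dX q.m2 * q.n2 ^ 2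
      + 4 * dX q.n2 * q.m1 * q.n1 - 3 * dX q.m1 * q.n1 * q.n2
      + dX q.n2 * q.m2 * q.n2 - dX q.n1 * q.m1 * q.n2)
    / (4 * q.n2 * (q.m1 * q.n1 + q.m2 * q.n2))

/-- The density of `ρ₋₁`, `ρ̄₋₁`, `ρ̂₋₁`, according to the case. -/
def Chart.rhoM1 : Chart → Potential Fn → Fn
  | .I => FourCH.rhoM1
  | .II => FourCH.rhoBarM1
  | .III => FourCH.rhoHatM1

/-! ### The four-component Camassa–Holm type system with an arbitrary function `Γ` -/

/-- The system with the arbitrary function `Γ`; `Γ = 0` is the first negative flow. -/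
def CHSystem (p : Primitives) (Γ : Fn) : Prop :=
  let q := p.potential
  dT q.m1 + dX (Γ * q.m1) + q.n2 * (p.g1 * p.g2 - Γ)
      + q.m1 * (p.f2 * p.g2 + 2 * p.f1 * p.g1) = 0 ∧
  dT q.m2 + dX (Γ * q.m2) - q.n1 * (p.g1 * p.g2 - Γ)
      - q.m2 * (p.f1 * p.g1 + 2 * p.f2 * p.g2) = 0 ∧
  dT q.n1 + dX (Γ * q.n1) - q.m2 * (p.f1 * p.f2 - Γ)
      - q.n1 * (p.f2 * p.g2 + 2 * p.f1 * p.g1) = 0 ∧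
  dT q.n2 + dX (Γ * q.n2) + q.m1 * (p.f1 * p.f2 - Γ)
      + q.n2 * (p.f1 * p.g1 + 2 * p.f2 * p.g2) = 0

open LaurentPolynomial in
/-- The matrix `V` of the first negative flow plus the matrix `Ṽ` of the flow generated by `Γ`. -/
def laxV (p : Primitives) (Γ : Fn) : LaxMatrix :=
  let q := p.potential
  !![C (-(p.f1 * p.g1)), C p.g1 * T (-1), C (-(p.g1 * p.g2));
     C p.f1 * T (-1), C (p.f1 * p.g1 + p.f2 * p.g2) - T (-2), C p.g2 * T (-1);
     C (-(p.f1 * p.f2)), C p.f2 * T (-1), C (-(p.f2 * p.g2))]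
  - !![0, C (q.m1 * Γ) * T 1, 0;
       C (q.n1 * Γ) * T 1, 0, C (q.m2 * Γ) * T 1;
       0, C (q.n2 * Γ) * T 1, 0]

end

end FourCH

namespace FourCH

noncomputable section

/-! ### Calculus of smooth functions of `(x, t)` -/

/-! For an actual solution `Φ`, the statements at fixed `λ` are the quotient rule together with the
symmetry of the second derivatives of `ln φᵢ`. The work lies in the formal expansions.

Normalize `Φ` so that its entry `c.den` is `1`. The spectral problem becomes `Φ_x = UΦ - ρΦ`, whose
other two rows are the Riccati-type system. Removing the leading coefficients and dividing by the
series variable gives equations `L(Sₙ, Tₙ) = (n-th coefficient of R(S, T))`, where the right side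
involves only coefficients of index below `n`. The expansion exists when `L` is surjective on the
class of admissible coefficients and is unique when `L` is injective there (`exists_recursive`,
`unique_recursive`).

At `λ = 0` the operator `L` is a first-order system in `x` with constant coefficients and real
nonzero rates. On bounded functions it is inverted by an exponential kernel (`resolvent`), which
preserves periodicity, rapid decay and constancy as well. At `λ = ∞` every `∂_x` carries a factor
`λ⁻¹`, so `L` is a matrix of functions with eigenvalues `√(m₁n₁ + m₂n₂)` and twice this, up to sign,
and is inverted by division. Constructing the solution inside a smaller class and comparing by
uniqueness in the large class shows that the coefficients inherit periodicity or decay from the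
potentials.

It is not given that the expansions evolve by `Φ_t = VΦ`; this has to be proved. Let `J` be the flux
and `w = Φ_t - VΦ + JΦ` the `defect`. The zero-curvature equation yields `w_x = Uw - ρw - (Uw)_den
Φ` and `ρ_t - J_x = (Uw)_den` (`mapVec_dX_defect`). As `V` is a Laurent polynomial, `w` has a lowest
coefficient, and the injective operator `L` annihilates it. Hence `w = 0` and `ρ_t = J_x`.
Conservation of the integrals follows by differentiation under the integral sign
(`isConserved_of_local_law`).

The explicit densities come from the first few coefficients; `ρ₃` and `ρ̄₂` need one integration by
parts each. For independence, constant potentials suffice: there `ρ` is an eigenvalue of `U`, hence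
a root of a cubic (`hDensity_cubic`), and multiplying the potentials by `ε` multiplies the
coefficient of `λ^j` by `ε^j`. Distinct powers of `ε` are independent, and infinitely many
coefficients are nonzero because the root in question is not a polynomial. Finally, the Camassa–Holm
type system is what remains of the zero-curvature equation once the `x`-derivatives of `fᵢ, gᵢ` are
eliminated (`zeroCurvature_eq`). -/

theorem dX_apply (f : Fn) (x t : ℝ) : dX f x t = deriv (fun y => f y t) x := rfl

theorem dT_apply (f : Fn) (x t : ℝ) : dT f x t = deriv (fun s => f x s) t := rfl

theorem Smooth.fderiv_prod {f : Fn} (hf : Smooth f) (z : ℝ × ℝ) :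
    HasFDerivAt (fun z : ℝ × ℝ => f z.1 z.2) (fderiv ℝ (fun z : ℝ × ℝ => f z.1 z.2) z) z :=
  (hf.differentiable (by simp)).differentiableAt.hasFDerivAt

theorem Smooth.hasDerivAt_fst {f : Fn} (hf : Smooth f) (x t : ℝ) :
    HasDerivAt (fun y => f y t) (fderiv ℝ (fun z : ℝ × ℝ => f z.1 z.2) (x, t) (1, 0)) x :=
  (hf.fderiv_prod (x, t)).comp_hasDerivAt (f := fun y => (y, t)) x
    ((hasDerivAt_id x).prodMk (hasDerivAt_const x t))

theorem Smooth.hasDerivAt_snd {f : Fn} (hf : Smooth f) (x t : ℝ) :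
    HasDerivAt (fun s => f x s) (fderiv ℝ (fun z : ℝ × ℝ => f z.1 z.2) (x, t) (0, 1)) t :=
  (hf.fderiv_prod (x, t)).comp_hasDerivAt (f := fun s => (x, s)) t
    ((hasDerivAt_const t x).prodMk (hasDerivAt_id t))

theorem Smooth.dX_eq {f : Fn} (hf : Smooth f) :
    dX f = fun x t => fderiv ℝ (fun z : ℝ × ℝ => f z.1 z.2) (x, t) (1, 0) := by
  funext x t
  exact (hf.hasDerivAt_fst x t).deriv

theorem Smooth.dT_eq {f : Fn} (hf : Smooth f) :
    dT f = fun x t => fderiv ℝ (fun z : ℝ × ℝ => f z.1 z.2) (x, t) (0, 1) := by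
  funext x t
  exact (hf.hasDerivAt_snd x t).deriv

theorem Smooth.hasDerivAt_dX {f : Fn} (hf : Smooth f) (x t : ℝ) :
    HasDerivAt (fun y => f y t) (dX f x t) x := by
  rw [hf.dX_eq]
  exact hf.hasDerivAt_fst x t

theorem Smooth.hasDerivAt_dT {f : Fn} (hf : Smooth f) (x t : ℝ) :
    HasDerivAt (fun s => f x s) (dT f x t) t := by
  rw [hf.dT_eq]
  exact hf.hasDerivAt_snd x t

theorem dX_eq_of_hasDerivAt {f g : Fn} (h : ∀ x t, HasDerivAt (fun y => f y t) (g x t) x) :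
    dX f = g := by
  funext x t
  exact (h x t).deriv

theorem dT_eq_of_hasDerivAt {f g : Fn} (h : ∀ x t, HasDerivAt (fun s => f x s) (g x t) t) :
    dT f = g := by
  funext x t
  exact (h x t).deriv

theorem Smooth.dX {f : Fn} (hf : Smooth f) : Smooth (dX f) := by
  rw [hf.dX_eq]
  exact (hf.fderiv_right (m := ∞) le_rfl).clm_apply contDiff_const

theorem Smooth.dT {f : Fn} (hf : Smooth f) : Smooth (dT f) := by
  rw [hf.dT_eq]
  exact (hf.fderiv_right (m := ∞) le_rfl).clm_apply contDiff_const

theorem Smooth.continuous {f : Fn} (hf : Smooth f) : Continuous (fun z : ℝ × ℝ => f z.1 z.2) :=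
  ContDiff.continuous hf

theorem Smooth.continuous_fst {f : Fn} (hf : Smooth f) (t : ℝ) : Continuous (fun x => f x t) :=
  hf.continuous.comp (Continuous.prodMk_left t)

theorem Smooth.continuous_snd {f : Fn} (hf : Smooth f) (x : ℝ) : Continuous (fun t => f x t) :=
  hf.continuous.comp (Continuous.prodMk_right x)

theorem smooth_const (c : ℝ) : Smooth (fun _ _ => c) := contDiff_const

theorem smooth_zero : Smooth 0 := smooth_const 0

theorem smooth_one : Smooth 1 := smooth_const 1

theorem Smooth.add {f g : Fn} (hf : Smooth f) (hg : Smooth g) : Smooth (f + g) :=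
  ContDiff.add hf hg

theorem Smooth.sub {f g : Fn} (hf : Smooth f) (hg : Smooth g) : Smooth (f - g) :=
  ContDiff.sub hf hg

theorem Smooth.neg {f : Fn} (hf : Smooth f) : Smooth (-f) := ContDiff.neg hf

theorem Smooth.mul {f g : Fn} (hf : Smooth f) (hg : Smooth g) : Smooth (f * g) :=
  ContDiff.mul hf hg

theorem Smooth.inv {f : Fn} (hf : Smooth f) (h : ∀ x t, f x t ≠ 0) : Smooth f⁻¹ :=
  ContDiff.inv hf fun z => h z.1 z.2

theorem Smooth.sqrt {f : Fn} (hf : Smooth f) (h : ∀ x t, f x t ≠ 0) :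
    Smooth (fun x t => √(f x t)) :=
  ContDiff.sqrt hf fun z => h z.1 z.2

theorem Smooth.sum {ι : Type*} {s : Finset ι} {f : ι → Fn} (h : ∀ i ∈ s, Smooth (f i)) :
    Smooth (∑ i ∈ s, f i) :=
  Finset.sum_induction _ _ (fun _ _ => Smooth.add) smooth_zero h

theorem dX_const (c : ℝ) : dX (fun _ _ => c) = 0 := by
  funext x t
  simp [dX_apply]

theorem dT_const (c : ℝ) : dT (fun _ _ => c) = 0 := by
  funext x t
  simp [dT_apply]

@[simp] theorem dX_one : dX 1 = 0 := dX_const 1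

@[simp] theorem dT_one : dT 1 = 0 := dT_const 1

theorem dX_add {f g : Fn} (hf : Smooth f) (hg : Smooth g) : dX (f + g) = dX f + dX g :=
  dX_eq_of_hasDerivAt fun x t => (hf.hasDerivAt_dX x t).add (hg.hasDerivAt_dX x t)

theorem dT_add {f g : Fn} (hf : Smooth f) (hg : Smooth g) : dT (f + g) = dT f + dT g :=
  dT_eq_of_hasDerivAt fun x t => (hf.hasDerivAt_dT x t).add (hg.hasDerivAt_dT x t)

theorem dX_neg (f : Fn) : dX (-f) = -dX f := by
  funext x t
  exact deriv.fun_neg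

theorem dT_neg (f : Fn) : dT (-f) = -dT f := by
  funext x t
  exact deriv.fun_neg

theorem dX_sub {f g : Fn} (hf : Smooth f) (hg : Smooth g) : dX (f - g) = dX f - dX g :=
  dX_eq_of_hasDerivAt fun x t => (hf.hasDerivAt_dX x t).sub (hg.hasDerivAt_dX x t)

theorem dX_mul {f g : Fn} (hf : Smooth f) (hg : Smooth g) :
    dX (f * g) = dX f * g + f * dX g :=
  dX_eq_of_hasDerivAt fun x t => (hf.hasDerivAt_dX x t).mul (hg.hasDerivAt_dX x t)

theorem dT_mul {f g : Fn} (hf : Smooth f) (hg : Smooth g) :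
    dT (f * g) = dT f * g + f * dT g :=
  dT_eq_of_hasDerivAt fun x t => (hf.hasDerivAt_dT x t).mul (hg.hasDerivAt_dT x t)

theorem dX_dT {f : Fn} (hf : Smooth f) : dX (dT f) = dT (dX f) := by
  rw [hf.dT.dX_eq, hf.dX.dT_eq, hf.dT_eq, hf.dX_eq]
  funext x t
  have hd : DifferentiableAt ℝ (fderiv ℝ (fun z : ℝ × ℝ => f z.1 z.2)) (x, t) :=
    ((hf.fderiv_right (m := ∞) le_rfl).differentiable (by simp)).differentiableAt
  have key : ∀ v w : ℝ × ℝ,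
      fderiv ℝ (fun z : ℝ × ℝ => fderiv ℝ (fun z : ℝ × ℝ => f z.1 z.2) (z.1, z.2) v) (x, t) w =
        fderiv ℝ (fderiv ℝ (fun z : ℝ × ℝ => f z.1 z.2)) (x, t) w v := by
    intro v w
    have := (hd.hasFDerivAt.clm_apply (hasFDerivAt_const v (x, t))).fderiv
    simp only [Prod.mk.eta]
    rw [this]
    simp
  rw [key, key]
  exact ((ContDiff.contDiffAt hf).isSymmSndFDerivAt (by simpa using WithTop.coe_le_coe.2 (le_top : (2 : ℕ∞) ≤ ⊤))) _ _

/-- A class of continuous functions that is closed under partial derivatives consists of smooth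
functions. -/
theorem smooth_of_partials (S : Set Fn) (hc : ∀ f ∈ S, Continuous (fun z : ℝ × ℝ => f z.1 z.2))
    (hX : ∀ f ∈ S, ∃ g ∈ S, ∀ x t, HasDerivAt (fun y => f y t) (g x t) x)
    (hT : ∀ f ∈ S, ∃ g ∈ S, ∀ x t, HasDerivAt (fun s => f x s) (g x t) t) :
    ∀ f ∈ S, Smooth f := by
  -- The induction runs over the whole class at once: the partial derivatives of a member are
  -- members, so they are already `C^n`. Continuous partials give the total derivative.
  have key : ∀ n : ℕ, ∀ f ∈ S, ContDiff ℝ n (fun z : ℝ × ℝ => f z.1 z.2) := by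
    intro n
    induction n with
    | zero => exact fun f hf => contDiff_zero.2 (hc f hf)
    | succ n ih =>
      intro f hf
      obtain ⟨g, hg, hfg⟩ := hX f hf
      obtain ⟨h, hh, hfh⟩ := hT f hf
      have hd : ∀ z : ℝ × ℝ, HasFDerivAt (fun z : ℝ × ℝ => f z.1 z.2)
          ((g z.1 z.2) • ContinuousLinearMap.fst ℝ ℝ ℝ
            + (h z.1 z.2) • ContinuousLinearMap.snd ℝ ℝ ℝ) z := by
        intro z
        have := (hasStrictFDerivAt_uncurry_coprod (u := z) (f := f)
          (f₁ := fun x t => (ContinuousLinearMap.toSpanSingleton ℝ (g x t)))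
          (f₂ := fun x t => (ContinuousLinearMap.toSpanSingleton ℝ (h x t)))
          (Eventually.of_forall fun v => (hfg v.1 v.2).hasFDerivAt)
          (Eventually.of_forall fun v => (hfh v.1 v.2).hasFDerivAt)
          (((ContinuousLinearMap.toSpanSingletonCLE (𝕜 := ℝ) (E := ℝ)).continuous.comp
            (hc g hg)).continuousAt)
          (((ContinuousLinearMap.toSpanSingletonCLE (𝕜 := ℝ) (E := ℝ)).continuous.comp
            (hc h hh)).continuousAt)).hasFDerivAt
        refine this.congr_fderiv ?_
        ext <;> simp [Function.HasUncurry.uncurry]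
      rw [Nat.cast_succ, contDiff_succ_iff_hasFDerivAt]
      · refine ⟨_, ?_, hd⟩
        exact ((ih g hg).smul contDiff_const).add ((ih h hh).smul contDiff_const)
  intro f hf
  exact contDiff_infty.2 fun n => key n f hf

/-! ### Weighted, bounded and rapidly decreasing functions -/

theorem Smooth.iterate_dT {f : Fn} (hf : Smooth f) (i : ℕ) : Smooth (FourCH.dT^[i] f) := by
  induction i generalizing f with
  | zero => exact hf
  | succ i ih => exact ih hf.dT

theorem iterate_dX_add {f g : Fn} (hf : Smooth f) (hg : Smooth g) (i : ℕ) :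
    dX^[i] (f + g) = dX^[i] f + dX^[i] g := by
  induction i generalizing f g with
  | zero => rfl
  | succ i ih => simp only [Function.iterate_succ_apply, dX_add hf hg, ih hf.dX hg.dX]

theorem iterate_dT_add {f g : Fn} (hf : Smooth f) (hg : Smooth g) (i : ℕ) :
    dT^[i] (f + g) = dT^[i] f + dT^[i] g := by
  induction i generalizing f g with
  | zero => rfl
  | succ i ih => simp only [Function.iterate_succ_apply, dT_add hf hg, ih hf.dT hg.dT]

theorem iterate_dX_neg (f : Fn) (i : ℕ) : dX^[i] (-f) = -dX^[i] f := by
  induction i generalizing f with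
  | zero => rfl
  | succ i ih => simp only [Function.iterate_succ_apply, dX_neg, ih]

theorem iterate_dT_neg (f : Fn) (i : ℕ) : dT^[i] (-f) = -dT^[i] f := by
  induction i generalizing f with
  | zero => rfl
  | succ i ih => simp only [Function.iterate_succ_apply, dT_neg, ih]

theorem iterate_dT_dX {f : Fn} (hf : Smooth f) (j : ℕ) : dT^[j] (dX f) = dX (dT^[j] f) := by
  induction j generalizing f with
  | zero => rfl
  | succ j ih => simp only [Function.iterate_succ_apply, ← dX_dT hf, ih hf.dT]

/-- `f = O((1 + |x|)^(-N))`, locally uniformly in `t`. -/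
def WeightedBound (N : ℕ) (f : Fn) : Prop :=
  ∀ T : ℝ, ∃ C : ℝ, ∀ x t : ℝ, |t| ≤ T → (1 + |x|) ^ N * |f x t| ≤ C

theorem WeightedBound.add {N : ℕ} {f g : Fn} (hf : WeightedBound N f) (hg : WeightedBound N g) :
    WeightedBound N (f + g) := by
  intro T
  obtain ⟨C, hC⟩ := hf T
  obtain ⟨D, hD⟩ := hg T
  refine ⟨C + D, fun x t ht => ?_⟩
  calc (1 + |x|) ^ N * |(f + g) x t|
      ≤ (1 + |x|) ^ N * (|f x t| + |g x t|) := by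
        gcongr
        exact abs_add_le _ _
    _ ≤ C + D := by
        rw [mul_add]
        exact add_le_add (hC x t ht) (hD x t ht)

theorem WeightedBound.mul {N : ℕ} {f g : Fn} (hf : WeightedBound N f) (hg : WeightedBound 0 g) :
    WeightedBound N (f * g) := by
  intro T
  obtain ⟨C, hC⟩ := hf T
  obtain ⟨D, hD⟩ := hg T
  refine ⟨C * D, fun x t ht => ?_⟩
  have h1 := hC x t ht
  have h2 := hD x t ht
  rw [pow_zero, one_mul] at h2
  calc (1 + |x|) ^ N * |(f * g) x t| = ((1 + |x|) ^ N * |f x t|) * |g x t| := by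
        rw [Pi.mul_apply, Pi.mul_apply, abs_mul, mul_assoc]
    _ ≤ C * D := mul_le_mul h1 h2 (abs_nonneg _) (le_trans (by positivity) h1)

theorem WeightedBound.neg {N : ℕ} {f : Fn} (hf : WeightedBound N f) : WeightedBound N (-f) := by
  simpa [WeightedBound] using hf

theorem WeightedBound.mono {M N : ℕ} (h : M ≤ N) {f : Fn} (hf : WeightedBound N f) :
    WeightedBound M f := by
  intro T
  obtain ⟨C, hC⟩ := hf T
  refine ⟨C, fun x t ht => le_trans ?_ (hC x t ht)⟩
  gcongr
  linarith [abs_nonneg x]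

theorem Weighted.bound {N : ℕ} {f : Fn} (hf : Weighted N f) : WeightedBound N f := hf.2 0 0

theorem Weighted.mono {M N : ℕ} (h : M ≤ N) {f : Fn} (hf : Weighted N f) : Weighted M f :=
  ⟨hf.1, fun i j => WeightedBound.mono h (hf.2 i j)⟩

theorem Weighted.dX {N : ℕ} {f : Fn} (hf : Weighted N f) : Weighted N (dX f) :=
  ⟨hf.1.dX, fun i j => by
    rw [iterate_dT_dX hf.1]
    exact hf.2 (i + 1) j⟩

theorem Weighted.dT {N : ℕ} {f : Fn} (hf : Weighted N f) : Weighted N (dT f) :=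
  ⟨hf.1.dT, fun i j => hf.2 i (j + 1)⟩

theorem Weighted.add {N : ℕ} {f g : Fn} (hf : Weighted N f) (hg : Weighted N g) :
    Weighted N (f + g) :=
  ⟨hf.1.add hg.1, fun i j => by
    rw [iterate_dT_add hf.1 hg.1, iterate_dX_add (hf.1.iterate_dT j) (hg.1.iterate_dT j)]
    exact WeightedBound.add (hf.2 i j) (hg.2 i j)⟩

theorem Weighted.neg {N : ℕ} {f : Fn} (hf : Weighted N f) : Weighted N (-f) :=
  ⟨hf.1.neg, fun i j => by
    rw [iterate_dT_neg, iterate_dX_neg]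
    exact WeightedBound.neg (hf.2 i j)⟩

/-- By the Leibniz rule it is enough that one factor carries the weight. Derivatives are peeled off
one at a time, with `f` and `g` generalized, so that the binomial sum is never written out. -/
theorem Weighted.mul {N : ℕ} {f g : Fn} (hf : Weighted N f) (hg : Bdd g) :
    Weighted N (f * g) := by
  refine ⟨hf.1.mul hg.1, fun i j => ?_⟩
  change WeightedBound N _
  induction j generalizing f g with
  | zero =>
    induction i generalizing f g with
    | zero => exact hf.bound.mul hg.bound
    | succ i ih =>
      simp only [Function.iterate_succ_apply, Function.iterate_zero, id] at ih ⊢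
      rw [dX_mul hf.1 hg.1, iterate_dX_add (hf.1.dX.mul hg.1) (hf.1.mul hg.1.dX)]
      exact (ih hf.dX hg).add (ih hf (Weighted.dX hg))
  | succ j ih =>
    rw [Function.iterate_succ_apply, dT_mul hf.1 hg.1,
      iterate_dT_add (hf.1.dT.mul hg.1) (hf.1.mul hg.1.dT),
      iterate_dX_add ((hf.1.dT.mul hg.1).iterate_dT j) ((hf.1.mul hg.1.dT).iterate_dT j)]
    exact (ih hf.dT hg).add (ih hf (Weighted.dT hg))

theorem weighted_zero (N : ℕ) : Weighted N 0 :=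
  ⟨smooth_zero, fun i j => by
    have h1 : dT^[j] 0 = 0 := Function.iterate_fixed (map_zero dT) j
    have h2 : dX^[i] 0 = 0 := Function.iterate_fixed (map_zero dX) i
    exact fun T => ⟨0, fun x t _ => by simp [h1, h2]⟩⟩

theorem bdd_zero : Bdd 0 := weighted_zero 0

theorem Bdd.smooth {f : Fn} (hf : Bdd f) : Smooth f := hf.1

theorem Bdd.add {f g : Fn} (hf : Bdd f) (hg : Bdd g) : Bdd (f + g) := Weighted.add hf hg

theorem Bdd.neg {f : Fn} (hf : Bdd f) : Bdd (-f) := Weighted.neg hf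

theorem Bdd.sub {f g : Fn} (hf : Bdd f) (hg : Bdd g) : Bdd (f - g) := by
  rw [sub_eq_add_neg]
  exact hf.add hg.neg

theorem Bdd.mul {f g : Fn} (hf : Bdd f) (hg : Bdd g) : Bdd (f * g) := Weighted.mul hf hg

theorem Bdd.dX {f : Fn} (hf : Bdd f) : Bdd (dX f) := Weighted.dX hf

theorem Bdd.dT {f : Fn} (hf : Bdd f) : Bdd (dT f) := Weighted.dT hf

theorem Decaying.bdd {f : Fn} (hf : Decaying f) : Bdd f := hf 0

theorem Decaying.smooth {f : Fn} (hf : Decaying f) : Smooth f := hf.bdd.smooth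

theorem decaying_zero : Decaying 0 := weighted_zero

theorem Decaying.add {f g : Fn} (hf : Decaying f) (hg : Decaying g) : Decaying (f + g) :=
  fun N => (hf N).add (hg N)

theorem Decaying.neg {f : Fn} (hf : Decaying f) : Decaying (-f) := fun N => (hf N).neg

theorem Decaying.mul_bdd {f g : Fn} (hf : Decaying f) (hg : Bdd g) : Decaying (f * g) :=
  fun N => (hf N).mul hg

theorem Decaying.bdd_mul {f g : Fn} (hf : Bdd f) (hg : Decaying g) : Decaying (f * g) := by
  rw [mul_comm]
  exact hg.mul_bdd hf

theorem Decaying.mul {f g : Fn} (hf : Decaying f) (hg : Decaying g) : Decaying (f * g) :=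
  hf.mul_bdd hg.bdd

theorem Decaying.dX {f : Fn} (hf : Decaying f) : Decaying (dX f) := fun N => (hf N).dX

theorem Decaying.dT {f : Fn} (hf : Decaying f) : Decaying (dT f) := fun N => (hf N).dT

/-- A smooth function of `t` alone is bounded in `x`, with all its derivatives. -/
theorem bdd_of_time {k : ℝ → ℝ} (hk : Smooth (fun _ t => k t)) : Bdd (fun _ t => k t) := by
  refine ⟨hk, fun i j => ?_⟩
  change WeightedBound 0 _
  obtain ⟨l, hl⟩ : ∃ l : ℝ → ℝ, dT^[j] (fun _ t => k t) = fun _ t => l t := by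
    clear hk
    induction j generalizing k with
    | zero => exact ⟨k, rfl⟩
    | succ j ih => exact ih (k := deriv k)
  have hls : Smooth (fun _ t => l t) := hl ▸ hk.iterate_dT j
  rw [hl]
  have h0 : WeightedBound 0 (fun _ t => l t) := by
    intro T
    obtain ⟨C, hC⟩ := (isCompact_Icc (a := -T) (b := T)).exists_bound_of_continuousOn
      (hls.continuous_snd 0).continuousOn
    exact ⟨C, fun x t ht => by simpa using hC t (abs_le.1 ht)⟩
  cases i with
  | zero => exact h0
  | succ i =>
    have h1 : dX (fun _ t => l t) = 0 := by
      funext x t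
      simp [dX_apply]
    rw [Function.iterate_succ_apply, h1, Function.iterate_fixed (map_zero dX) i]
    exact (weighted_zero 0).bound

theorem bdd_const (c : ℝ) : Bdd (fun _ _ => c) := bdd_of_time (k := fun _ => c) (smooth_const c)

theorem bdd_one : Bdd 1 := bdd_const 1

theorem Decaying.integrable {f : Fn} (hf : Decaying f) (t : ℝ) : Integrable (fun x => f x t) := by
  -- Weight `2` suffices, since `1 + x² ≤ (1 + |x|)²` and `(1 + x²)⁻¹` is integrable.
  obtain ⟨C, hC⟩ := (hf 2).bound |t|
  refine Integrable.mono' (g := fun x => C * (1 + x ^ 2)⁻¹)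
    (integrable_inv_one_add_sq.const_mul C)
    (hf.smooth.continuous_fst t).aestronglyMeasurable (Eventually.of_forall fun x => ?_)
  have h := hC x t le_rfl
  rw [Real.norm_eq_abs, ← div_eq_mul_inv, le_div_iff₀ (by positivity), mul_comm]
  refine le_trans ?_ h
  gcongr
  nlinarith [abs_nonneg x, sq_abs x]

/-- Sum of a smooth function of `t` alone and a rapidly decreasing function. -/
def TimeAddDecaying (f : Fn) : Prop :=
  ∃ k : ℝ → ℝ, Smooth (fun _ t => k t) ∧ Decaying (f - fun _ t => k t)

/-- The function of `t` is a difference of two smooth functions. Its smoothness is what makes the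
class closed under products, where it multiplies rapidly decreasing functions. -/
theorem DecayingModConst.timeAddDecaying {f : Fn} (hs : Smooth f) (hf : DecayingModConst f) :
    TimeAddDecaying f := by
  obtain ⟨k, hk⟩ := hf
  refine ⟨k, ?_, hk⟩
  have := hs.sub hk.smooth
  have h2 : (f - fun x t => f x t - k t) = fun _ t => k t := by
    funext x t
    simp
  rwa [h2] at this

theorem Decaying.timeAddDecaying {f : Fn} (hf : Decaying f) : TimeAddDecaying f :=
  ⟨fun _ => 0, smooth_const 0, by
    have : (f - fun _ _ => (0 : ℝ)) = f := by
      funext x t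
      simp
    rwa [this]⟩

theorem timeAddDecaying_const (c : ℝ) : TimeAddDecaying (fun _ _ => c) :=
  ⟨fun _ => c, smooth_const c, by
    rw [sub_self]
    exact decaying_zero⟩

theorem TimeAddDecaying.add {f g : Fn} (hf : TimeAddDecaying f) (hg : TimeAddDecaying g) :
    TimeAddDecaying (f + g) := by
  obtain ⟨k, hk, hfk⟩ := hf
  obtain ⟨l, hl, hgl⟩ := hg
  refine ⟨fun t => k t + l t, hk.add hl, ?_⟩
  have : (f + g - fun _ t => k t + l t) = (f - fun _ t => k t) + (g - fun _ t => l t) := by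
    funext x t
    simp only [Pi.sub_apply, Pi.add_apply]
    ring
  rw [this]
  exact hfk.add hgl

theorem TimeAddDecaying.mul {f g : Fn} (hf : TimeAddDecaying f) (hg : TimeAddDecaying g) :
    TimeAddDecaying (f * g) := by
  obtain ⟨k, hk, hfk⟩ := hf
  obtain ⟨l, hl, hgl⟩ := hg
  refine ⟨fun t => k t * l t, hk.mul hl, ?_⟩
  have : (f * g - fun _ t => k t * l t) = (f - fun _ t => k t) * (g - fun _ t => l t)
      + (f - fun _ t => k t) * (fun _ t => l t) + (fun _ t => k t) * (g - fun _ t => l t) := by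
    funext x t
    simp only [Pi.sub_apply, Pi.add_apply, Pi.mul_apply]
    ring
  rw [this]
  exact ((hfk.mul hgl).add (hfk.mul_bdd (bdd_of_time hl))).add (hgl.bdd_mul (bdd_of_time hk))

/-! ### Bounded solutions of `u_x = κ u + h` -/

/-- For `ε = ±1` and `k > 0`, the bounded solution `u` of `ε u_x = -k u + h`. -/
def resolvent (k ε : ℝ) (h : Fn) : Fn := fun x t =>
  ∫ r in Set.Ioi (0 : ℝ), Real.exp (-k * r) * h (x - ε * r) t

/-- Half of the exponential absorbs the polynomial weight: `sᴺ / N! ≤ eˢ` at `s = (k/2)(1 + r)`. -/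
theorem exists_weight_mul_exp_le (N : ℕ) {k : ℝ} (hk : 0 < k) :
    ∃ M : ℝ, 0 ≤ M ∧ ∀ r : ℝ, 0 < r →
      (1 + r) ^ N * Real.exp (-k * r) ≤ M * Real.exp (-(k / 2) * r) := by
  refine ⟨N.factorial / (k / 2) ^ N * Real.exp (k / 2), by positivity, fun r hr => ?_⟩
  have h := Real.pow_div_factorial_le_exp (k / 2 * (1 + r)) (by positivity) N
  rw [mul_pow, div_le_iff₀ (by positivity)] at h
  have h1 : (1 + r) ^ N ≤ N.factorial / (k / 2) ^ N * Real.exp (k / 2 * (1 + r)) := by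
    rw [div_mul_eq_mul_div, le_div_iff₀ (by positivity)]
    linarith
  calc (1 + r) ^ N * Real.exp (-k * r)
      ≤ N.factorial / (k / 2) ^ N * Real.exp (k / 2 * (1 + r)) * Real.exp (-k * r) := by gcongr
    _ = N.factorial / (k / 2) ^ N * Real.exp (k / 2) * Real.exp (-(k / 2) * r) := by
      rw [mul_assoc, mul_assoc, ← Real.exp_add, ← Real.exp_add]
      ring_nf

/-- The inequality `1 + |x| ≤ (1 + r)(1 + |x - εr|)` moves the weight from `x` to the point where
`h` is evaluated; the remaining factor `(1 + r)ᴺ` is beaten by the kernel. -/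
theorem WeightedBound.resolvent {N : ℕ} {k ε : ℝ} (hk : 0 < k) (hε : |ε| = 1) {h : Fn}
    (hh : WeightedBound N h) : WeightedBound N (resolvent k ε h) := by
  intro T
  obtain ⟨C, hC⟩ := hh T
  obtain ⟨M, hM0, hM⟩ := exists_weight_mul_exp_le N hk
  refine ⟨∫ r in Set.Ioi (0 : ℝ), C * M * Real.exp (-(k / 2) * r), fun x t ht => ?_⟩
  rw [← abs_of_nonneg (show 0 ≤ (1 + |x|) ^ N by positivity), ← abs_mul,
    FourCH.resolvent, ← integral_const_mul, ← Real.norm_eq_abs]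
  refine norm_integral_le_of_norm_le
    ((exp_neg_integrableOn_Ioi 0 (by positivity)).const_mul _) ?_
  rw [ae_restrict_iff' measurableSet_Ioi]
  refine Eventually.of_forall fun r hr => ?_
  have hr : 0 < r := hr
  have h1 := hC (x - ε * r) t ht
  have h2 : 1 + |x| ≤ (1 + r) * (1 + |x - ε * r|) := by
    have : |x| ≤ |x - ε * r| + |ε * r| := by simpa using abs_add_le (x - ε * r) (ε * r)
    rw [abs_mul, hε, one_mul, abs_of_pos hr] at this
    nlinarith [abs_nonneg (x - ε * r)]
  rw [Real.norm_eq_abs, abs_mul, abs_mul, Real.abs_exp,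
    abs_of_nonneg (show 0 ≤ (1 + |x|) ^ N by positivity)]
  have hC0 : 0 ≤ C := le_trans (by positivity) h1
  calc (1 + |x|) ^ N * (Real.exp (-k * r) * |h (x - ε * r) t|)
      ≤ ((1 + r) * (1 + |x - ε * r|)) ^ N * (Real.exp (-k * r) * |h (x - ε * r) t|) := by
        gcongr
    _ = ((1 + r) ^ N * Real.exp (-k * r)) * ((1 + |x - ε * r|) ^ N * |h (x - ε * r) t|) := by
        rw [mul_pow]
        ring
    _ ≤ (M * Real.exp (-(k / 2) * r)) * C :=
        mul_le_mul (hM r hr) h1 (by positivity) (by positivity)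
    _ = C * M * Real.exp (-(k / 2) * r) := by ring

theorem Bdd.exists_bound {h : Fn} (hh : Bdd h) (T : ℝ) : ∃ C, ∀ x t, |t| ≤ T → |h x t| ≤ C := by
  obtain ⟨C, hC⟩ := Weighted.bound hh T
  exact ⟨C, fun x t ht => by simpa using hC x t ht⟩

theorem Bdd.aestronglyMeasurable_kernel {h : Fn} (hh : Bdd h) (k ε x t : ℝ) :
    AEStronglyMeasurable (fun r => Real.exp (-k * r) * h (x - ε * r) t)
      (volume.restrict (Set.Ioi 0)) := by
  have := hh.smooth.continuous_fst t
  exact (by fun_prop : Continuous _).aestronglyMeasurable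

theorem integrable_exp_mul_const {k : ℝ} (hk : 0 < k) (C : ℝ) :
    Integrable (fun r => Real.exp (-k * r) * C) (volume.restrict (Set.Ioi 0)) :=
  (exp_neg_integrableOn_Ioi 0 hk).mul_const C

theorem norm_kernel_le {h : Fn} {C k ε x t r : ℝ} (hC : ∀ x, |h x t| ≤ C) :
    ‖Real.exp (-k * r) * h (x - ε * r) t‖ ≤ Real.exp (-k * r) * C := by
  rw [Real.norm_eq_abs, abs_mul, Real.abs_exp]
  gcongr
  exact hC _

theorem Bdd.integrable_kernel {h : Fn} (hh : Bdd h) {k : ℝ} (hk : 0 < k) (ε x t : ℝ) :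
    Integrable (fun r => Real.exp (-k * r) * h (x - ε * r) t) (volume.restrict (Set.Ioi 0)) := by
  obtain ⟨C, hC⟩ := hh.exists_bound |t|
  exact (integrable_exp_mul_const hk C).mono' (hh.aestronglyMeasurable_kernel k ε x t)
    (Eventually.of_forall fun r => norm_kernel_le fun x => hC x t le_rfl)

theorem Bdd.continuous_resolvent {h : Fn} (hh : Bdd h) {k : ℝ} (hk : 0 < k) (ε : ℝ) :
    Continuous (fun z : ℝ × ℝ => resolvent k ε h z.1 z.2) := by
  rw [continuous_iff_continuousAt]
  rintro ⟨x, t⟩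
  obtain ⟨C, hC⟩ := hh.exists_bound (|t| + 1)
  refine continuousAt_of_dominated (bound := fun r => Real.exp (-k * r) * C)
    (Eventually.of_forall fun z => hh.aestronglyMeasurable_kernel k ε z.1 z.2) ?_
    (integrable_exp_mul_const hk C) (Eventually.of_forall fun r => ?_)
  · have : ∀ᶠ z : ℝ × ℝ in 𝓝 (x, t), |z.2| < |t| + 1 :=
      (continuous_snd.abs.continuousAt).eventually_lt continuousAt_const (by simp)
    filter_upwards [this] with z hz
    exact Eventually.of_forall fun r => norm_kernel_le fun x => hC x z.2 hz.le
  · have := hh.smooth.continuous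
    have h2 : Continuous fun z : ℝ × ℝ => h (z.1 - ε * r) z.2 :=
      this.comp (f := fun z : ℝ × ℝ => (z.1 - ε * r, z.2)) (by fun_prop)
    exact (continuous_const.mul h2).continuousAt

/-- The operator is a convolution in `x`, so derivatives fall on `h`, which has bounded derivatives;
the kernel times a constant dominates. -/
theorem Bdd.hasDerivAt_resolvent_fst {h : Fn} (hh : Bdd h) {k : ℝ} (hk : 0 < k) (ε x t : ℝ) :
    HasDerivAt (fun y => resolvent k ε h y t) (resolvent k ε (FourCH.dX h) x t) x := by
  obtain ⟨C, hC⟩ := hh.dX.exists_bound |t|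
  refine (hasDerivAt_integral_of_dominated_loc_of_deriv_le (s := Set.univ)
    (F' := fun y r => Real.exp (-k * r) * FourCH.dX h (y - ε * r) t)
    (bound := fun r => Real.exp (-k * r) * C) univ_mem
    (Eventually.of_forall fun y => hh.aestronglyMeasurable_kernel k ε y t)
    (hh.integrable_kernel hk ε x t) (hh.dX.aestronglyMeasurable_kernel k ε x t)
    (Eventually.of_forall fun r y _ => norm_kernel_le fun x => hC x t le_rfl)
    (integrable_exp_mul_const hk C) (Eventually.of_forall fun r y _ => ?_)).2
  exact HasDerivAt.const_mul (Real.exp (-k * r))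
    ((hh.smooth.hasDerivAt_dX (y - ε * r) t).comp_sub_const y (ε * r))

theorem Bdd.hasDerivAt_resolvent_snd {h : Fn} (hh : Bdd h) {k : ℝ} (hk : 0 < k) (ε x t : ℝ) :
    HasDerivAt (fun s => resolvent k ε h x s) (resolvent k ε (FourCH.dT h) x t) t := by
  obtain ⟨C, hC⟩ := hh.dT.exists_bound (|t| + 1)
  have hs : {s : ℝ | |s| < |t| + 1} ∈ 𝓝 t :=
    (continuous_abs.continuousAt).eventually_lt continuousAt_const (by simp)
  refine (hasDerivAt_integral_of_dominated_loc_of_deriv_le (s := {s : ℝ | |s| < |t| + 1})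
    (F' := fun s r => Real.exp (-k * r) * FourCH.dT h (x - ε * r) s)
    (bound := fun r => Real.exp (-k * r) * C) hs
    (Eventually.of_forall fun s => hh.aestronglyMeasurable_kernel k ε x s)
    (hh.integrable_kernel hk ε x t) (hh.dT.aestronglyMeasurable_kernel k ε x t)
    (Eventually.of_forall fun r s hs => norm_kernel_le fun x => hC x s (le_of_lt hs))
    (integrable_exp_mul_const hk C) (Eventually.of_forall fun r s _ => ?_)).2
  exact (hh.smooth.hasDerivAt_dT (x - ε * r) s).const_mul _

/-- Both partial derivatives of a resolvent are resolvents of bounded functions, so the set of all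
resolvents satisfies the criterion `smooth_of_partials`. -/
theorem Bdd.smooth_resolvent {h : Fn} (hh : Bdd h) {k : ℝ} (hk : 0 < k) (ε : ℝ) :
    Smooth (resolvent k ε h) := by
  refine smooth_of_partials {f | ∃ h, Bdd h ∧ f = resolvent k ε h} ?_ ?_ ?_ _ ⟨h, hh, rfl⟩
  · rintro _ ⟨h, hh, rfl⟩
    exact hh.continuous_resolvent hk ε
  · rintro _ ⟨h, hh, rfl⟩
    exact ⟨_, ⟨_, hh.dX, rfl⟩, hh.hasDerivAt_resolvent_fst hk ε⟩
  · rintro _ ⟨h, hh, rfl⟩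
    exact ⟨_, ⟨_, hh.dT, rfl⟩, hh.hasDerivAt_resolvent_snd hk ε⟩

theorem Weighted.resolvent {N : ℕ} {h : Fn} (hh : Weighted N h) {k ε : ℝ} (hk : 0 < k)
    (hε : |ε| = 1) : Weighted N (resolvent k ε h) := by
  have hb : Bdd h := hh.mono (Nat.zero_le N)
  refine ⟨hb.smooth_resolvent hk ε, fun i j => ?_⟩
  have h1 : FourCH.dT^[j] (FourCH.resolvent k ε h) = FourCH.resolvent k ε (FourCH.dT^[j] h) ∧
      Weighted N (FourCH.dT^[j] h) := by
    induction j generalizing h with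
    | zero => exact ⟨rfl, hh⟩
    | succ j ih =>
      rw [Function.iterate_succ_apply, Function.iterate_succ_apply,
        dT_eq_of_hasDerivAt (hb.hasDerivAt_resolvent_snd hk ε)]
      exact ih hh.dT hb.dT
  have h2 : ∀ h, Weighted N h → FourCH.dX^[i] (FourCH.resolvent k ε h) = FourCH.resolvent k ε (FourCH.dX^[i] h) ∧
      Weighted N (FourCH.dX^[i] h) := by
    intro h hh
    have hb : Bdd h := hh.mono (Nat.zero_le N)
    induction i generalizing h with
    | zero => exact ⟨rfl, hh⟩
    | succ i ih =>
      rw [Function.iterate_succ_apply, Function.iterate_succ_apply,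
        dX_eq_of_hasDerivAt (hb.hasDerivAt_resolvent_fst hk ε)]
      exact ih _ hh.dX hb.dX
  rw [h1.1, (h2 _ h1.2).1]
  exact (h2 _ h1.2).2.bound.resolvent hk hε

theorem Decaying.resolvent {h : Fn} (hh : Decaying h) {k ε : ℝ} (hk : 0 < k) (hε : |ε| = 1) :
    Decaying (resolvent k ε h) := fun N => (hh N).resolvent hk hε

/-- Integrate the `r`-derivative of `e^(-kr) h(x - εr)` over the half-line: the boundary term at `0`
is `-h(x)`, the one at infinity vanishes, and the two terms of the derivative are the resolvents of
`h` and of `h_x`. -/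
theorem Bdd.dX_resolvent {h : Fn} (hh : Bdd h) {k ε : ℝ} (hk : 0 < k) (hε : ε * ε = 1) :
    FourCH.dX (resolvent k ε h) = (-(ε * k)) • resolvent k ε h + ε • h := by
  refine dX_eq_of_hasDerivAt fun x t => ?_
  have h1 := hh.hasDerivAt_resolvent_fst hk ε x t
  have h2 : ∀ r, HasDerivAt (fun r => Real.exp (-k * r) * h (x - ε * r) t)
      ((-k) * (Real.exp (-k * r) * h (x - ε * r) t)
        + (-ε) * (Real.exp (-k * r) * FourCH.dX h (x - ε * r) t)) r := by
    intro r
    have e1 : HasDerivAt (fun r => Real.exp (-k * r)) (Real.exp (-k * r) * (-k * 1)) r :=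
      ((hasDerivAt_id r).const_mul (-k)).exp
    have e2 : HasDerivAt (fun r => x - ε * r) (-(ε * 1)) r :=
      ((hasDerivAt_id r).const_mul ε).const_sub x
    have e3 := (hh.smooth.hasDerivAt_dX (x - ε * r) t).comp r e2
    refine (e1.mul e3).congr_deriv ?_
    simp only [Function.comp]
    ring
  obtain ⟨C, hC⟩ := hh.exists_bound |t|
  have h3 : Tendsto (fun r => Real.exp (-k * r) * h (x - ε * r) t) atTop (𝓝 0) := by
    refine squeeze_zero_norm (fun r => norm_kernel_le fun x => hC x t le_rfl) ?_
    have : Tendsto (fun r => Real.exp (-k * r)) atTop (𝓝 0) :=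
      Real.tendsto_exp_atBot.comp (tendsto_id.const_mul_atTop_of_neg (by linarith))
    simpa using this.mul_const C
  have i1 := (hh.integrable_kernel hk ε x t).const_mul (-k)
  have i2 := (hh.dX.integrable_kernel hk ε x t).const_mul (-ε)
  have h4 := integral_Ioi_of_hasDerivAt_of_tendsto (a := 0)
    (h2 0).continuousAt.continuousWithinAt (fun r _ => h2 r) (i1.add i2) h3
  rw [integral_add i1 i2, integral_const_mul, integral_const_mul] at h4
  refine h1.congr_deriv ?_
  simp only [Pi.add_apply, Pi.smul_apply, smul_eq_mul]
  simp only [mul_zero, Real.exp_zero, one_mul, sub_zero, zero_sub] at h4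
  change -k * resolvent k ε h x t + -ε * resolvent k ε (FourCH.dX h) x t = -h x t at h4
  linear_combination (-ε) * h4 - resolvent k ε (FourCH.dX h) x t * hε

/-- The function `u e^(-κx)` is constant in `x`, yet it tends to `0` in the direction in which the
exponential decays, because `u` is bounded. -/
theorem eq_zero_of_dX_eq_smul {u : Fn} (hu : Bdd u) {κ : ℝ} (hκ : κ ≠ 0) (h : dX u = κ • u) :
    u = 0 := by
  funext x t
  obtain ⟨C, hC⟩ := hu.exists_bound |t|
  have hd : ∀ y, HasDerivAt (fun y => u y t * Real.exp (-κ * y)) 0 y := by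
    intro y
    have e1 : HasDerivAt (fun r => Real.exp (-κ * r)) (Real.exp (-κ * y) * (-κ * 1)) y :=
      ((hasDerivAt_id y).const_mul (-κ)).exp
    refine ((hu.smooth.hasDerivAt_dX y t).mul e1).congr_deriv ?_
    rw [h]
    simp only [Pi.smul_apply, smul_eq_mul]
    ring
  have hconst : ∀ y, u y t * Real.exp (-κ * y) = u x t * Real.exp (-κ * x) := fun y =>
    is_const_of_deriv_eq_zero (fun y => (hd y).differentiableAt) (fun y => (hd y).deriv) y x
  have hle : ∀ r : ℝ, |u x t * Real.exp (-κ * x)| ≤ C * Real.exp (-r) := by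
    intro r
    -- Evaluating at `r / κ` treats both signs of `κ` together: the exponential there is `e^(-r)`.
    rw [← hconst (r / κ), abs_mul, Real.abs_exp, neg_mul, mul_div_cancel₀ _ hκ]
    gcongr
    exact hC _ _ le_rfl
  have hlim : Tendsto (fun r => C * Real.exp (-r)) atTop (𝓝 0) := by
    simpa using Real.tendsto_exp_neg_atTop_nhds_zero.const_mul C
  have h0 := abs_nonpos_iff.1 (ge_of_tendsto' hlim hle)
  simpa [Real.exp_ne_zero] using h0

theorem Bdd.smul (c : ℝ) {f : Fn} (hf : Bdd f) : Bdd (c • f) := (bdd_const c).mul hf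

theorem Decaying.smul (c : ℝ) {f : Fn} (hf : Decaying f) : Decaying (c • f) :=
  hf.bdd_mul (bdd_const c)

/-- A class of bounded functions in which the equation `u_x = κ u + h` can be solved. -/
structure ResolventClass (P : Fn → Prop) : Prop where
  bdd : ∀ {f}, P f → Bdd f
  zero : P 0
  add : ∀ {f g}, P f → P g → P (f + g)
  neg : ∀ {f}, P f → P (-f)
  mul : ∀ {f g}, P f → P g → P (f * g)
  smul : ∀ (c : ℝ) {f}, P f → P (c • f)
  resolvent : ∀ {k ε h}, 0 < k → |ε| = 1 → P h → P (resolvent k ε h)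

/-- The sign of `κ` decides from which end one integrates: from the left (`ε = 1`) for `κ < 0`, from
the right (`ε = -1`, with the source negated) for `κ > 0`. -/
theorem ResolventClass.exists_solution {P : Fn → Prop} (hP : ResolventClass P) {κ : ℝ}
    (hκ : κ ≠ 0) {h : Fn} (hh : P h) : ∃ u, P u ∧ dX u = κ • u + h := by
  rcases lt_or_gt_of_ne hκ with hκ | hκ
  · refine ⟨_, hP.resolvent (k := -κ) (ε := 1) (by linarith) (by simp) hh, ?_⟩
    rw [(hP.bdd hh).dX_resolvent (by linarith) (by simp)]
    simp
  · refine ⟨_, hP.resolvent (k := κ) (ε := -1) hκ (by simp) (hP.neg hh), ?_⟩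
    rw [(hP.bdd (hP.neg hh)).dX_resolvent hκ (by simp)]
    simp

theorem resolventClass_bdd : ResolventClass Bdd where
  bdd := id
  zero := bdd_zero
  add := Bdd.add
  neg := Bdd.neg
  mul := Bdd.mul
  smul := Bdd.smul
  resolvent hk hε hh := Weighted.resolvent hh hk hε

theorem resolventClass_decaying : ResolventClass Decaying where
  bdd := Decaying.bdd
  zero := decaying_zero
  add := Decaying.add
  neg := Decaying.neg
  mul := Decaying.mul
  smul := Decaying.smul
  resolvent hk hε hh := hh.resolvent hk hε

theorem resolventClass_periodic (L : ℝ) : ResolventClass fun f => Bdd f ∧ PeriodicX L f where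
  bdd h := h.1
  zero := ⟨bdd_zero, fun _ _ => rfl⟩
  add hf hg := ⟨hf.1.add hg.1, fun x t => by simp [hf.2 x t, hg.2 x t]⟩
  neg hf := ⟨hf.1.neg, fun x t => by simp [hf.2 x t]⟩
  mul hf hg := ⟨hf.1.mul hg.1, fun x t => by simp [hf.2 x t, hg.2 x t]⟩
  smul c _ hf := ⟨hf.1.smul c, fun x t => by simp [hf.2 x t]⟩
  resolvent := by
    intro k ε h hk hε hh
    refine ⟨Weighted.resolvent hh.1 hk hε, fun x t => ?_⟩
    simp only [FourCH.resolvent]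
    congr 1
    funext r
    rw [← hh.2 (x - ε * r) t]
    ring_nf

/-- Constant functions. -/
def IsConst (f : Fn) : Prop := ∃ c : ℝ, f = fun _ _ => c

/-- This class serves the independence statement, where the expansions of constant potentials must
have constant coefficients. -/
theorem resolventClass_isConst : ResolventClass IsConst where
  bdd := by
    rintro _ ⟨c, rfl⟩
    exact bdd_const c
  zero := ⟨0, rfl⟩
  add := by
    rintro _ _ ⟨c, rfl⟩ ⟨d, rfl⟩
    exact ⟨c + d, rfl⟩
  neg := by
    rintro _ ⟨c, rfl⟩
    exact ⟨-c, rfl⟩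
  mul := by
    rintro _ _ ⟨c, rfl⟩ ⟨d, rfl⟩
    exact ⟨c * d, rfl⟩
  smul := by
    rintro c _ ⟨d, rfl⟩
    exact ⟨c * d, rfl⟩
  resolvent := by
    rintro k ε _ - - ⟨c, rfl⟩
    exact ⟨∫ r in Set.Ioi (0 : ℝ), Real.exp (-k * r) * c, rfl⟩

/-! ### Recursive solution of systems of power series -/

/-- The sequence defined by course-of-values recursion. -/
def strongSeq {X : Type*} [Zero X] (Φ : ℕ → (ℕ → X) → X) : ℕ → X
  | n => Φ n fun i => if _h : i < n then strongSeq Φ i else 0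

theorem strongSeq_eq {X : Type*} [Zero X] (Φ : ℕ → (ℕ → X) → X) (n : ℕ) :
    strongSeq Φ n = Φ n fun i => if i < n then strongSeq Φ i else 0 := by
  rw [strongSeq]
  simp

/-- All coefficients have the property `P`. -/
def AllC (P : Fn → Prop) (Y : PowerSeries Fn) : Prop := ∀ n, P (PowerSeries.coeff n Y)

/-- The `n`-th coefficient of `R y z` depends only on the coefficients of `y, z` of index at most
`n - d`. -/
def Causal (d : ℕ) (R : PowerSeries Fn → PowerSeries Fn → PowerSeries Fn) : Prop :=
  ∀ n y z y' z', (∀ i, i + d ≤ n → PowerSeries.coeff i y = PowerSeries.coeff i y' ∧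
    PowerSeries.coeff i z = PowerSeries.coeff i z') →
    PowerSeries.coeff n (R y z) = PowerSeries.coeff n (R y' z')

/-- `∂/∂x` on power series. -/
def dXs (Y : PowerSeries Fn) : PowerSeries Fn :=
  PowerSeries.mk fun n => dX (PowerSeries.coeff n Y)

@[simp] theorem coeff_dXs (Y : PowerSeries Fn) (n : ℕ) :
    PowerSeries.coeff n (dXs Y) = dX (PowerSeries.coeff n Y) := PowerSeries.coeff_mk _ _

namespace Causal

variable {d : ℕ} {R S : PowerSeries Fn → PowerSeries Fn → PowerSeries Fn}

theorem fst : Causal 0 (fun y _ => y) := fun n _ _ _ _ h => (h n le_rfl).1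

theorem snd : Causal 0 (fun _ z => z) := fun n _ _ _ _ h => (h n le_rfl).2

theorem const (A : PowerSeries Fn) : Causal d (fun _ _ => A) := fun _ _ _ _ _ _ => rfl

theorem add (hR : Causal d R) (hS : Causal d S) : Causal d (fun y z => R y z + S y z) := by
  intro n y z y' z' h
  simp only [map_add, hR n y z y' z' h, hS n y z y' z' h]

theorem sub (hR : Causal d R) (hS : Causal d S) : Causal d (fun y z => R y z - S y z) := by
  intro n y z y' z' h
  simp only [map_sub, hR n y z y' z' h, hS n y z y' z' h]

theorem mul (hR : Causal d R) (hS : Causal d S) : Causal d (fun y z => R y z * S y z) := by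
  intro n y z y' z' h
  simp only [PowerSeries.coeff_mul]
  refine Finset.sum_congr rfl fun p hp => ?_
  rw [Finset.HasAntidiagonal.mem_antidiagonal] at hp
  rw [hR p.1 y z y' z' fun i hi => h i (by omega), hS p.2 y z y' z' fun i hi => h i (by omega)]

theorem dXs (hR : Causal d R) : Causal d (fun y z => dXs (R y z)) := by
  intro n y z y' z' h
  simp only [coeff_dXs, hR n y z y' z' h]

theorem X_mul (hR : Causal d R) : Causal (d + 1) (fun y z => PowerSeries.X * R y z) := by
  intro n y z y' z' h
  cases n with
  | zero => simp
  | succ n =>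
    simp only [PowerSeries.coeff_succ_X_mul]
    exact hR n y z y' z' fun i hi => h i (by omega)

theorem weaken (hR : Causal (d + 1) R) : Causal d R :=
  fun n y z y' z' h => hR n y z y' z' fun i hi => h i (by omega)

end Causal

/-- Since the right sides have delay `1`, their `n`-th coefficients are known once all earlier
coefficients are. One solution operator for `(L₁, L₂)` therefore drives a course-of-values
recursion. -/
theorem exists_recursive {P : Fn → Prop} (h0 : P 0) {L₁ L₂ : Fn → Fn → Fn}
    (hL : ∀ F G, P F → P G → ∃ y z, P y ∧ P z ∧ L₁ y z = F ∧ L₂ y z = G)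
    {R₁ R₂ : PowerSeries Fn → PowerSeries Fn → PowerSeries Fn}
    (hR₁ : Causal 1 R₁) (hR₂ : Causal 1 R₂)
    (hP₁ : ∀ y z, AllC P y → AllC P z → AllC P (R₁ y z))
    (hP₂ : ∀ y z, AllC P y → AllC P z → AllC P (R₂ y z)) :
    ∃ y z, AllC P y ∧ AllC P z ∧ ∀ n,
      L₁ (PowerSeries.coeff n y) (PowerSeries.coeff n z) = PowerSeries.coeff n (R₁ y z) ∧
      L₂ (PowerSeries.coeff n y) (PowerSeries.coeff n z) = PowerSeries.coeff n (R₂ y z) := by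
  choose! s₁ s₂ hs₁ hs₂ h₁ h₂ using hL
  let f : ℕ → Fn × Fn := strongSeq fun n g =>
    (s₁ (PowerSeries.coeff n (R₁ (.mk fun i => (g i).1) (.mk fun i => (g i).2)))
      (PowerSeries.coeff n (R₂ (.mk fun i => (g i).1) (.mk fun i => (g i).2))),
     s₂ (PowerSeries.coeff n (R₁ (.mk fun i => (g i).1) (.mk fun i => (g i).2)))
      (PowerSeries.coeff n (R₂ (.mk fun i => (g i).1) (.mk fun i => (g i).2))))
  -- The partial series known at stage `n`, filled up with `0`; this padding is why `P 0` is needed.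
  -- By causality the padding does not affect the `n`-th coefficient of the right sides.
  let y : ℕ → PowerSeries Fn := fun n => .mk fun i => (if i < n then f i else 0).1
  let z : ℕ → PowerSeries Fn := fun n => .mk fun i => (if i < n then f i else 0).2
  have hf : ∀ n, f n =
      (s₁ (PowerSeries.coeff n (R₁ (y n) (z n))) (PowerSeries.coeff n (R₂ (y n) (z n))),
       s₂ (PowerSeries.coeff n (R₁ (y n) (z n))) (PowerSeries.coeff n (R₂ (y n) (z n)))) :=
    fun n => strongSeq_eq _ n
  have hfP : ∀ n, P (f n).1 ∧ P (f n).2 := by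
    intro n
    induction n using Nat.strong_induction_on with
    | _ n ih =>
      have hy : AllC P (y n) := by
        intro i
        simp only [y, PowerSeries.coeff_mk]
        split_ifs with hi
        exacts [(ih i hi).1, h0]
      have hz : AllC P (z n) := by
        intro i
        simp only [z, PowerSeries.coeff_mk]
        split_ifs with hi
        exacts [(ih i hi).2, h0]
      rw [hf n]
      exact ⟨hs₁ _ _ (hP₁ _ _ hy hz n) (hP₂ _ _ hy hz n),
        hs₂ _ _ (hP₁ _ _ hy hz n) (hP₂ _ _ hy hz n)⟩
  have hyP : AllC P (.mk fun i => (f i).1) := fun n => by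
    rw [PowerSeries.coeff_mk]
    exact (hfP n).1
  have hzP : AllC P (.mk fun i => (f i).2) := fun n => by
    rw [PowerSeries.coeff_mk]
    exact (hfP n).2
  have htr : ∀ n i, i + 1 ≤ n →
      PowerSeries.coeff i (y n) = PowerSeries.coeff i (.mk fun i => (f i).1) ∧
      PowerSeries.coeff i (z n) = PowerSeries.coeff i (.mk fun i => (f i).2) := by
    intro n i hi
    have : i < n := hi
    simp [y, z, PowerSeries.coeff_mk, this]
  refine ⟨.mk fun i => (f i).1, .mk fun i => (f i).2, hyP, hzP, fun n => ?_⟩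
  rw [PowerSeries.coeff_mk, PowerSeries.coeff_mk]
  have e := hf n
  rw [hR₁ n _ _ _ _ (htr n), hR₂ n _ _ _ _ (htr n)] at e
  rw [e]
  exact ⟨h₁ _ _ (hP₁ _ _ hyP hzP n) (hP₂ _ _ hyP hzP n),
    h₂ _ _ (hP₁ _ _ hyP hzP n) (hP₂ _ _ hyP hzP n)⟩

/-- If two solutions agree below `n`, causality makes the right sides agree at `n`, and injectivity
on `P` gives the next coefficient. -/
theorem unique_recursive {P : Fn → Prop} {L₁ L₂ : Fn → Fn → Fn}
    (hL : ∀ y z y' z', P y → P z → P y' → P z' → L₁ y z = L₁ y' z' → L₂ y z = L₂ y' z' →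
      y = y' ∧ z = z')
    {R₁ R₂ : PowerSeries Fn → PowerSeries Fn → PowerSeries Fn}
    (hR₁ : Causal 1 R₁) (hR₂ : Causal 1 R₂) {y z y' z' : PowerSeries Fn}
    (hy : AllC P y) (hz : AllC P z) (hy' : AllC P y') (hz' : AllC P z')
    (h : ∀ n, L₁ (PowerSeries.coeff n y) (PowerSeries.coeff n z) = PowerSeries.coeff n (R₁ y z) ∧
      L₂ (PowerSeries.coeff n y) (PowerSeries.coeff n z) = PowerSeries.coeff n (R₂ y z))
    (h' : ∀ n, L₁ (PowerSeries.coeff n y') (PowerSeries.coeff n z')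
        = PowerSeries.coeff n (R₁ y' z') ∧
      L₂ (PowerSeries.coeff n y') (PowerSeries.coeff n z') = PowerSeries.coeff n (R₂ y' z')) :
    y = y' ∧ z = z' := by
  have key : ∀ n, PowerSeries.coeff n y = PowerSeries.coeff n y' ∧
      PowerSeries.coeff n z = PowerSeries.coeff n z' := by
    intro n
    induction n using Nat.strong_induction_on with
    | _ n ih =>
      refine hL _ _ _ _ (hy n) (hz n) (hy' n) (hz' n) ?_ ?_
      · rw [(h n).1, (h' n).1]
        exact hR₁ n _ _ _ _ fun i hi => ih i hi
      · rw [(h n).2, (h' n).2]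
        exact hR₂ n _ _ _ _ fun i hi => ih i hi
  exact ⟨PowerSeries.ext fun n => (key n).1, PowerSeries.ext fun n => (key n).2⟩

/-- A class of functions closed under the ring operations, except that it need not contain `1`. -/
structure RngClass (P : Fn → Prop) : Prop where
  zero : P 0
  add : ∀ {f g}, P f → P g → P (f + g)
  neg : ∀ {f}, P f → P (-f)
  mul : ∀ {f g}, P f → P g → P (f * g)

theorem ResolventClass.rngClass {P : Fn → Prop} (hP : ResolventClass P) : RngClass P :=
  ⟨hP.zero, hP.add, hP.neg, hP.mul⟩

namespace RngClass

theorem sub {P : Fn → Prop} (hP : RngClass P) {f g : Fn} (hf : P f) (hg : P g) : P (f - g) := by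
  rw [sub_eq_add_neg]
  exact hP.add hf (hP.neg hg)

theorem sum {P : Fn → Prop} (hP : RngClass P)
    {ι : Type*} {s : Finset ι} {f : ι → Fn} (h : ∀ i ∈ s, P (f i)) :
    P (∑ i ∈ s, f i) :=
  Finset.sum_induction _ _ (fun _ _ => hP.add) hP.zero h

theorem allC_add {P : Fn → Prop} (hP : RngClass P)
    {Y Z : PowerSeries Fn} (hY : AllC P Y) (hZ : AllC P Z) : AllC P (Y + Z) :=
  fun n => by
    rw [map_add]
    exact hP.add (hY n) (hZ n)

theorem allC_sub {P : Fn → Prop} (hP : RngClass P)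
    {Y Z : PowerSeries Fn} (hY : AllC P Y) (hZ : AllC P Z) : AllC P (Y - Z) :=
  fun n => by
    rw [map_sub]
    exact hP.sub (hY n) (hZ n)

theorem allC_mul {P : Fn → Prop} (hP : RngClass P)
    {Y Z : PowerSeries Fn} (hY : AllC P Y) (hZ : AllC P Z) : AllC P (Y * Z) :=
  fun n => by
    rw [PowerSeries.coeff_mul]
    exact hP.sum fun p _ => hP.mul (hY p.1) (hZ p.2)

theorem allC_C {P : Fn → Prop} (hP : RngClass P)
    {f : Fn} (hf : P f) : AllC P (PowerSeries.C f) := fun n => by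
  rw [PowerSeries.coeff_C]
  split_ifs
  exacts [hf, hP.zero]

theorem allC_X_mul {P : Fn → Prop} (hP : RngClass P)
    {Y : PowerSeries Fn} (hY : AllC P Y) : AllC P (PowerSeries.X * Y) :=
  fun n => by
    cases n with
    | zero =>
      rw [PowerSeries.coeff_zero_X_mul]
      exact hP.zero
    | succ n =>
      rw [PowerSeries.coeff_succ_X_mul]
      exact hY n

end RngClass

/-! ### The homogenized Riccati-type systems

The parameter `e` homogenizes the constant entries of `U`: the systems of `Defs` are obtained for
`e = 1`, while the expansion in powers of `X = λ⁻¹` has `e = X` and `l = 1`. -/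

section Homogenized

variable {A : Type*} [CommRing A]

/-- The homogenized density. -/
def hDensity (c : Chart) (e l : A) (q : Potential A) (y z : A) : A :=
  match c with
  | .I => l * q.n1 * y + l * q.m2 * z
  | .II => l * q.m1 * y + e * z
  | .III => e * y + l * q.n2 * z

/-- The right-hand side of the homogenized equation for `y`. -/
def hFst (c : Chart) (e l : A) (q : Potential A) (y z : A) : A :=
  match c with
  | .I => l * q.m1 + e * z - y * hDensity .I e l q y z
  | .II => l * q.n1 + l * q.m2 * z - y * hDensity .II e l q y z
  | .III => l * q.m1 * z + e - y * hDensity .III e l q y z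

/-- The right-hand side of the homogenized equation for `z`. -/
def hSnd (c : Chart) (e l : A) (q : Potential A) (y z : A) : A :=
  match c with
  | .I => e * y + l * q.n2 - z * hDensity .I e l q y z
  | .II => e + l * q.n2 * y - z * hDensity .II e l q y z
  | .III => l * q.n1 * y + l * q.m2 - z * hDensity .III e l q y z

end Homogenized

/-- Exchange of the first and the third component of `Φ`. -/
def Potential.swap {A : Type*} (q : Potential A) : Potential A := ⟨q.n2, q.n1, q.m2, q.m1⟩

/-- Power series solutions of the homogenized Riccati-type system. -/
structure IsPSSolution (c : Chart) (e l : PowerSeries Fn) (q : Potential Fn)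
    (Y Z : PowerSeries Fn) : Prop where
  fst : e * dXs Y = hFst c e l (q.map PowerSeries.C) Y Z
  snd : e * dXs Z = hSnd c e l (q.map PowerSeries.C) Y Z

/-- Conjugating `U` by the transposition of the outer components interchanges `m₁` with `n₂` and
`m₂` with `n₁`. This symmetry reduces Case III to Case II in the computation of the subleading
density. -/
theorem isPSSolution_swap {e l : PowerSeries Fn} {q : Potential Fn} {Y Z : PowerSeries Fn} :
    IsPSSolution .III e l q Y Z ↔ IsPSSolution .II e l q.swap Z Y := by
  constructor
  · rintro ⟨h1, h2⟩
    constructor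
    · rw [h2]
      simp only [hSnd, hFst, hDensity, Potential.map, Potential.swap]
      ring
    · rw [h1]
      simp only [hSnd, hFst, hDensity, Potential.map, Potential.swap]
      ring
  · rintro ⟨h1, h2⟩
    constructor
    · rw [h2]
      simp only [hSnd, hFst, hDensity, Potential.map, Potential.swap]
      ring
    · rw [h1]
      simp only [hSnd, hFst, hDensity, Potential.map, Potential.swap]
      ring

/-- The density of a power series solution. -/
def psRho (c : Chart) (e l : PowerSeries Fn) (q : Potential Fn) (Y Z : PowerSeries Fn) :
    PowerSeries Fn :=
  hDensity c e l (q.map PowerSeries.C) Y Z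

theorem psRho_swap {e l : PowerSeries Fn} {q : Potential Fn} {Y Z : PowerSeries Fn} :
    psRho .III e l q Y Z = psRho .II e l q.swap Z Y := by
  simp only [psRho, hDensity, Potential.map, Potential.swap]
  ring

theorem Potential.All.swap {A : Type*} {P : A → Prop} {q : Potential A} (h : q.All P) :
    q.swap.All P := ⟨h.2.2.2, h.2.2.1, h.2.1, h.1⟩

theorem dXs_add {Y Z : PowerSeries Fn} (hY : AllC Smooth Y) (hZ : AllC Smooth Z) :
    dXs (Y + Z) = dXs Y + dXs Z := by
  ext1 n
  simp only [coeff_dXs, map_add, dX_add (hY n) (hZ n)]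

@[simp] theorem dXs_X_mul (Y : PowerSeries Fn) :
    dXs (PowerSeries.X * Y) = PowerSeries.X * dXs Y := by
  ext1 n
  cases n with
  | zero => simp
  | succ n => simp [PowerSeries.coeff_succ_X_mul]

@[simp] theorem dXs_C (f : Fn) : dXs (PowerSeries.C f) = PowerSeries.C (dX f) := by
  ext1 n
  rw [coeff_dXs, PowerSeries.coeff_C, PowerSeries.coeff_C]
  split_ifs
  exacts [rfl, map_zero dX]

theorem X_mul_inj {Y Z : PowerSeries Fn} : PowerSeries.X * Y = PowerSeries.X * Z ↔ Y = Z := by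
  refine ⟨fun h => ?_, fun h => by rw [h]⟩
  ext1 n
  rw [← PowerSeries.coeff_succ_X_mul, h, PowerSeries.coeff_succ_X_mul]

/-- The series without its constant term, divided by `X`. -/
def psTail (Y : PowerSeries Fn) : PowerSeries Fn :=
  PowerSeries.mk fun n => PowerSeries.coeff (n + 1) Y

theorem eq_C_add_X_mul_psTail (Y : PowerSeries Fn) :
    Y = PowerSeries.C (PowerSeries.coeff 0 Y) + PowerSeries.X * psTail Y := by
  ext1 n
  cases n with
  | zero => simp
  | succ n =>
    simp [PowerSeries.coeff_succ_X_mul, psTail]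

theorem AllC.psTail {P : Fn → Prop} {Y : PowerSeries Fn} (hY : AllC P Y) : AllC P (psTail Y) :=
  fun n => by
    rw [FourCH.psTail, PowerSeries.coeff_mk]
    exact hY (n + 1)

theorem AllC.mono {P Q : Fn → Prop} (h : ∀ f, P f → Q f) {Y : PowerSeries Fn} (hY : AllC P Y) :
    AllC Q Y := fun n => h _ (hY n)

theorem rngClass_smooth : RngClass Smooth := ⟨smooth_zero, Smooth.add, Smooth.neg, Smooth.mul⟩

theorem dXs_C_add_X_mul {f : Fn} {Y : PowerSeries Fn} (hf : Smooth f) (hY : AllC Smooth Y) :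
    dXs (PowerSeries.C f + PowerSeries.X * Y) =
      PowerSeries.C (dX f) + PowerSeries.X * dXs Y := by
  rw [dXs_add (rngClass_smooth.allC_C hf) (rngClass_smooth.allC_X_mul hY), dXs_C, dXs_X_mul]

/-! ### Expansion in non-negative powers -/

/-- The value at `λ = 0` of the first projective coordinate. -/
def Chart.base₁ : Chart → Fn
  | .I => 0
  | .II => 0
  | .III => 1

/-- The value at `λ = 0` of the second projective coordinate. -/
def Chart.base₂ : Chart → Fn
  | .I => 0
  | .II => 1
  | .III => 0

/-- The combinations `a + b` and `a - b` diagonalize the system, with rates `1` and `-1`, and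
neither rate admits a nonzero bounded solution. -/
theorem bdd_eq_zero_of_system {a b : Fn} (ha : Bdd a) (hb : Bdd b) (h1 : dX a - b = 0)
    (h2 : dX b - a = 0) : a = 0 ∧ b = 0 := by
  have e1 := eq_zero_of_dX_eq_smul (ha.add hb) (κ := 1) one_ne_zero (by
    rw [dX_add ha.smooth hb.smooth, one_smul]
    linear_combination h1 + h2)
  have e2 := eq_zero_of_dX_eq_smul (ha.sub hb) (κ := -1) (by norm_num) (by
    rw [dX_sub ha.smooth hb.smooth, neg_smul, one_smul]
    linear_combination h1 - h2)
  have e3 : (2 : ℝ) • a = 0 := by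
    rw [two_smul]
    linear_combination e1 + e2
  have ha0 : a = 0 := by simpa using e3
  refine ⟨ha0, ?_⟩
  rw [ha0] at e1
  simpa using e1

/-- In terms of `s = (a + b)/2` and `d = (a - b)/2` the system decouples into `s_x = s + (F + G)/2`
and `d_x = -d + (F - G)/2`. -/
theorem ResolventClass.exists_system {P : Fn → Prop} (hP : ResolventClass P) {F G : Fn}
    (hF : P F) (hG : P G) : ∃ a b, P a ∧ P b ∧ dX a - b = F ∧ dX b - a = G := by
  obtain ⟨s, hs, hs'⟩ :=
    hP.exists_solution (κ := 1) one_ne_zero (hP.smul (1 / 2) (hP.add hF hG))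
  obtain ⟨d, hd, hd'⟩ :=
    hP.exists_solution (κ := -1) (by norm_num) (hP.smul (1 / 2) (hP.rngClass.sub hF hG))
  have hss := (hP.bdd hs).smooth
  have hds := (hP.bdd hd).smooth
  refine ⟨s + d, s - d, hP.add hs hd, hP.rngClass.sub hs hd, ?_, ?_⟩
  · rw [dX_add hss hds, hs', hd']
    funext x t
    simp only [Pi.add_apply, Pi.sub_apply, Pi.smul_apply, smul_eq_mul]
    ring
  · rw [dX_sub hss hds, hs', hd']
    funext x t
    simp only [Pi.add_apply, Pi.sub_apply, Pi.smul_apply, smul_eq_mul]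
    ring

/-- At `λ = 0` the potentials drop out. In Case I there remains `a_x = b`, `b_x = a` up to a term
with `ρ = 0`, whose only bounded solution is zero. In Cases II and III the normalization fixes one
coordinate as `1`, and the other then satisfies `u_x = -u`. -/
theorem coeff_zero_of_isPSSolution {c : Chart} {q : Potential Fn} {Y Z : PowerSeries Fn}
    (h : IsPSSolution c 1 PowerSeries.X q Y Z) (hY : AllC Bdd Y) (hZ : AllC Bdd Z)
    (h0 : PowerSeries.coeff 0 (psRho c 1 PowerSeries.X q Y Z) = c.zeroth) :
    PowerSeries.coeff 0 Y = c.base₁ ∧ PowerSeries.coeff 0 Z = c.base₂ := by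
  obtain ⟨h1, h2⟩ := h
  have h1 := congrArg (PowerSeries.coeff 0) h1
  have h2 := congrArg (PowerSeries.coeff 0) h2
  cases c
  · simp [hFst, hSnd, hDensity] at h1 h2
    exact bdd_eq_zero_of_system (hY 0) (hZ 0) (by simp [h1]) (by simp [h2])
  · simp [hFst, hSnd, hDensity, psRho, Chart.zeroth] at h0 h1 h2
    refine ⟨?_, by simpa [Chart.base₂] using h0⟩
    refine eq_zero_of_dX_eq_smul (hY 0) (κ := -1) (by norm_num) ?_
    simp [h1, h0]
  · simp [hFst, hSnd, hDensity, psRho, Chart.zeroth] at h0 h1 h2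
    refine ⟨by simpa [Chart.base₁] using h0, ?_⟩
    refine eq_zero_of_dX_eq_smul (hZ 0) (κ := -1) (by norm_num) ?_
    simp [h2, h0]

/-- The nonlinear terms of the recursion in non-negative powers of `λ`. -/
def remZero₁ (c : Chart) (q : Potential Fn) (S T : PowerSeries Fn) : PowerSeries Fn :=
  match c with
  | .I => .C q.m1 - .X * (.X * (S * (.C q.n1 * S + .C q.m2 * T)))
  | .II => .C q.n1 + .C q.m2 + .X * (.C q.m2 * T - S * (.X * (.C q.m1 * S) + T))
  | .III => .X * ((.C q.m1 - .C q.n2) * T - S * (.X * (.C q.n2 * T) + S))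

/-- The nonlinear terms of the recursion in non-negative powers of `λ`. -/
def remZero₂ (c : Chart) (q : Potential Fn) (S T : PowerSeries Fn) : PowerSeries Fn :=
  match c with
  | .I => .C q.n2 - .X * (.X * (T * (.C q.n1 * S + .C q.m2 * T)))
  | .II => .X * ((.C q.n2 - .C q.m1) * S - T * (.X * (.C q.m1 * S) + T))
  | .III => .C q.m2 + .C q.n1 + .X * (.C q.n1 * S - T * (.X * (.C q.n2 * T) + S))

/-- The linear part of the recursion in non-negative powers of `λ`. -/
def linZero₁ (c : Chart) (S T : Fn) : Fn :=
  match c with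
  | .I => dX S - T
  | .II => dX S + S
  | .III => dX S + 2 * S

/-- The linear part of the recursion in non-negative powers of `λ`. -/
def linZero₂ (c : Chart) (S T : Fn) : Fn :=
  match c with
  | .I => dX T - S
  | .II => dX T + 2 * T
  | .III => dX T + T

/-- The values `c.base₁`, `c.base₂` solve the system at `λ = 0`, so after inserting them every term
is divisible by `X`. After the division, the only terms containing the unknowns without a further
factor `X` are those with constant coefficients, and these form the linear part. -/
theorem isPSSolution_zero_iff {c : Chart} {q : Potential Fn} {S T : PowerSeries Fn}
    (hS : AllC Smooth S) (hT : AllC Smooth T) :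
    IsPSSolution c 1 PowerSeries.X q (.C c.base₁ + .X * S) (.C c.base₂ + .X * T) ↔
      ∀ n, linZero₁ c (PowerSeries.coeff n S) (PowerSeries.coeff n T)
          = PowerSeries.coeff n (remZero₁ c q S T) ∧
        linZero₂ c (PowerSeries.coeff n S) (PowerSeries.coeff n T)
          = PowerSeries.coeff n (remZero₂ c q S T) := by
  have key : ∀ A B A' B' : PowerSeries Fn, (A = A' ∧ B = B') ↔
      ∀ n, PowerSeries.coeff n A = PowerSeries.coeff n A' ∧
        PowerSeries.coeff n B = PowerSeries.coeff n B' := fun A B A' B' =>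
    ⟨fun h n => by rw [h.1, h.2]; exact ⟨rfl, rfl⟩,
      fun h => ⟨PowerSeries.ext fun n => (h n).1, PowerSeries.ext fun n => (h n).2⟩⟩
  have h2 : ∀ (n : ℕ) (S : PowerSeries Fn),
      (2 : Fn) * PowerSeries.coeff n S = PowerSeries.coeff n (2 * S) := by
    intro n S
    rw [two_mul, two_mul, map_add]
  have e1 : dXs (.C c.base₁ + .X * S) = .X * dXs S := by
    rw [dXs_C_add_X_mul _ hS] <;> cases c <;>
      simp [Chart.base₁, smooth_zero, smooth_one]
  have e2 : dXs (.C c.base₂ + .X * T) = .X * dXs T := by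
    rw [dXs_C_add_X_mul _ hT] <;> cases c <;>
      simp [Chart.base₂, smooth_zero, smooth_one]
  have hiff : IsPSSolution c 1 PowerSeries.X q (.C c.base₁ + .X * S) (.C c.base₂ + .X * T) ↔
      (.X * dXs S = hFst c 1 .X (q.map PowerSeries.C) (.C c.base₁ + .X * S) (.C c.base₂ + .X * T) ∧
      .X * dXs T = hSnd c 1 .X (q.map PowerSeries.C) (.C c.base₁ + .X * S)
        (.C c.base₂ + .X * T)) := by
    rw [← e1, ← e2]
    exact ⟨fun h => ⟨by simpa using h.fst, by simpa using h.snd⟩,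
      fun h => ⟨by simpa using h.1, by simpa using h.2⟩⟩
  rw [hiff]
  cases c
  · have h3 : hFst .I 1 .X (q.map PowerSeries.C) (.C (Chart.base₁ .I) + .X * S)
        (.C (Chart.base₂ .I) + .X * T) = .X * (T + remZero₁ .I q S T) := by
      simp only [hFst, hDensity, remZero₁, Potential.map, Chart.base₁, Chart.base₂, map_zero]
      ring
    have h4 : hSnd .I 1 .X (q.map PowerSeries.C) (.C (Chart.base₁ .I) + .X * S)
        (.C (Chart.base₂ .I) + .X * T) = .X * (S + remZero₂ .I q S T) := by
      simp only [hSnd, hDensity, remZero₂, Potential.map, Chart.base₁, Chart.base₂, map_zero]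
      ring
    rw [h3, h4, X_mul_inj, X_mul_inj, ← sub_eq_iff_eq_add', ← sub_eq_iff_eq_add', key]
    simp only [map_sub, coeff_dXs, linZero₁, linZero₂]
  · have h3 : hFst .II 1 .X (q.map PowerSeries.C) (.C (Chart.base₁ .II) + .X * S)
        (.C (Chart.base₂ .II) + .X * T) = .X * (remZero₁ .II q S T - S) := by
      simp only [hFst, hDensity, remZero₁, Potential.map, Chart.base₁, Chart.base₂, map_zero,
        map_one]
      ring
    have h4 : hSnd .II 1 .X (q.map PowerSeries.C) (.C (Chart.base₁ .II) + .X * S)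
        (.C (Chart.base₂ .II) + .X * T) = .X * (remZero₂ .II q S T - 2 * T) := by
      simp only [hSnd, hDensity, remZero₂, Potential.map, Chart.base₁, Chart.base₂, map_zero,
        map_one]
      ring
    rw [h3, h4, X_mul_inj, X_mul_inj, eq_sub_iff_add_eq, eq_sub_iff_add_eq, key]
    simp only [map_add, coeff_dXs, linZero₁, linZero₂, h2]
  · have h3 : hFst .III 1 .X (q.map PowerSeries.C) (.C (Chart.base₁ .III) + .X * S)
        (.C (Chart.base₂ .III) + .X * T) = .X * (remZero₁ .III q S T - 2 * S) := by
      simp only [hFst, hDensity, remZero₁, Potential.map, Chart.base₁, Chart.base₂, map_zero,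
        map_one]
      ring
    have h4 : hSnd .III 1 .X (q.map PowerSeries.C) (.C (Chart.base₁ .III) + .X * S)
        (.C (Chart.base₂ .III) + .X * T) = .X * (remZero₂ .III q S T - T) := by
      simp only [hSnd, hDensity, remZero₂, Potential.map, Chart.base₁, Chart.base₂, map_zero,
        map_one]
      ring
    rw [h3, h4, X_mul_inj, X_mul_inj, eq_sub_iff_add_eq, eq_sub_iff_add_eq, key]
    simp only [map_add, coeff_dXs, linZero₁, linZero₂, h2]

theorem Causal.lin (A B : PowerSeries Fn) : Causal 0 (fun y z => A * y + B * z) :=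
  ((Causal.const A).mul Causal.fst).add ((Causal.const B).mul Causal.snd)

theorem causal_remZero₁ (c : Chart) (q : Potential Fn) : Causal 1 (remZero₁ c q) := by
  cases c
  · exact (Causal.const (.C q.m1)).sub
      ((Causal.fst.mul (Causal.lin (.C q.n1) (.C q.m2))).X_mul.weaken).X_mul
  · exact (Causal.const (.C q.n1 + .C q.m2)).add ((((Causal.const (.C q.m2)).mul Causal.snd).sub
      (Causal.fst.mul ((((Causal.const (.C q.m1)).mul Causal.fst).X_mul.weaken).add
        Causal.snd))).X_mul)
  · exact (((Causal.const (.C q.m1 - .C q.n2)).mul Causal.snd).sub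
      (Causal.fst.mul ((((Causal.const (.C q.n2)).mul Causal.snd).X_mul.weaken).add
        Causal.fst))).X_mul

theorem causal_remZero₂ (c : Chart) (q : Potential Fn) : Causal 1 (remZero₂ c q) := by
  cases c
  · exact (Causal.const (.C q.n2)).sub
      ((Causal.snd.mul (Causal.lin (.C q.n1) (.C q.m2))).X_mul.weaken).X_mul
  · exact (((Causal.const (.C q.n2 - .C q.m1)).mul Causal.fst).sub
      (Causal.snd.mul ((((Causal.const (.C q.m1)).mul Causal.fst).X_mul.weaken).add
        Causal.snd))).X_mul
  · exact (Causal.const (.C q.m2 + .C q.n1)).add ((((Causal.const (.C q.n1)).mul Causal.fst).sub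
      (Causal.snd.mul ((((Causal.const (.C q.n2)).mul Causal.snd).X_mul.weaken).add
        Causal.fst))).X_mul)

theorem RngClass.remZero {P : Fn → Prop} (hP : RngClass P) (c : Chart) {q : Potential Fn}
    (hq : q.All P) {S T : PowerSeries Fn} (hS : AllC P S) (hT : AllC P T) :
    AllC P (remZero₁ c q S T) ∧ AllC P (remZero₂ c q S T) := by
  obtain ⟨h1, h2, h3, h4⟩ := hq
  have h1 := hP.allC_C h1
  have h2 := hP.allC_C h2
  have h3 := hP.allC_C h3
  have h4 := hP.allC_C h4
  cases c
  · exact ⟨hP.allC_sub h1 (hP.allC_X_mul (hP.allC_X_mul (hP.allC_mul hS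
        (hP.allC_add (hP.allC_mul h3 hS) (hP.allC_mul h2 hT))))),
      hP.allC_sub h4 (hP.allC_X_mul (hP.allC_X_mul (hP.allC_mul hT
        (hP.allC_add (hP.allC_mul h3 hS) (hP.allC_mul h2 hT)))))⟩
  · exact ⟨hP.allC_add (hP.allC_add h3 h2) (hP.allC_X_mul (hP.allC_sub (hP.allC_mul h2 hT)
        (hP.allC_mul hS (hP.allC_add (hP.allC_X_mul (hP.allC_mul h1 hS)) hT)))),
      hP.allC_X_mul (hP.allC_sub (hP.allC_mul (hP.allC_sub h4 h1) hS)
        (hP.allC_mul hT (hP.allC_add (hP.allC_X_mul (hP.allC_mul h1 hS)) hT)))⟩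
  · exact ⟨hP.allC_X_mul (hP.allC_sub (hP.allC_mul (hP.allC_sub h1 h4) hT)
        (hP.allC_mul hS (hP.allC_add (hP.allC_X_mul (hP.allC_mul h4 hT)) hS))),
      hP.allC_add (hP.allC_add h2 h3) (hP.allC_X_mul (hP.allC_sub (hP.allC_mul h3 hS)
        (hP.allC_mul hT (hP.allC_add (hP.allC_X_mul (hP.allC_mul h4 hT)) hS))))⟩

theorem ResolventClass.exists_linZero {P : Fn → Prop} (hP : ResolventClass P) (c : Chart)
    (F G : Fn) (hF : P F) (hG : P G) :
    ∃ y z, P y ∧ P z ∧ linZero₁ c y z = F ∧ linZero₂ c y z = G := by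
  have h1 : ∀ F, P F → ∃ y, P y ∧ dX y + y = F := by
    intro F hF
    obtain ⟨y, hy, hy'⟩ := hP.exists_solution (κ := -1) (by norm_num) hF
    exact ⟨y, hy, by rw [hy']; simp⟩
  have h2 : ∀ F, P F → ∃ y, P y ∧ dX y + 2 * y = F := by
    intro F hF
    obtain ⟨y, hy, hy'⟩ := hP.exists_solution (κ := -2) (by norm_num) hF
    refine ⟨y, hy, ?_⟩
    rw [hy']
    funext x t
    simp
  cases c
  · exact hP.exists_system hF hG
  · obtain ⟨y, hy, hy'⟩ := h1 F hF
    obtain ⟨z, hz, hz'⟩ := h2 G hG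
    exact ⟨y, z, hy, hz, hy', hz'⟩
  · obtain ⟨y, hy, hy'⟩ := h2 F hF
    obtain ⟨z, hz, hz'⟩ := h1 G hG
    exact ⟨y, z, hy, hz, hy', hz'⟩

theorem linZero_eq_zero (c : Chart) {y z : Fn} (hy : Bdd y) (hz : Bdd z)
    (h1 : linZero₁ c y z = 0) (h2 : linZero₂ c y z = 0) : y = 0 ∧ z = 0 := by
  have e1 : ∀ {y}, Bdd y → dX y + y = 0 → y = 0 := fun hy h =>
    eq_zero_of_dX_eq_smul hy (κ := -1) (by norm_num) (by
      rw [eq_neg_of_add_eq_zero_left h]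
      simp)
  have e2 : ∀ {y}, Bdd y → dX y + 2 * y = 0 → y = 0 := fun hy h =>
    eq_zero_of_dX_eq_smul hy (κ := -2) (by norm_num) (by
      rw [eq_neg_of_add_eq_zero_left h]
      funext x t
      simp)
  cases c
  · exact bdd_eq_zero_of_system hy hz h1 h2
  · exact ⟨e1 hy h1, e2 hz h2⟩
  · exact ⟨e2 hy h1, e1 hz h2⟩

theorem linZero_sub (c : Chart) {y z y' z' : Fn} (hy : Bdd y) (hz : Bdd z) (hy' : Bdd y')
    (hz' : Bdd z') : linZero₁ c (y - y') (z - z') = linZero₁ c y z - linZero₁ c y' z' ∧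
      linZero₂ c (y - y') (z - z') = linZero₂ c y z - linZero₂ c y' z' := by
  have e1 := dX_sub hy.smooth hy'.smooth
  have e2 := dX_sub hz.smooth hz'.smooth
  cases c <;> simp only [linZero₁, linZero₂, e1, e2] <;> constructor <;> ring

theorem linZero_injective (c : Chart) (y z y' z' : Fn) (hy : Bdd y) (hz : Bdd z) (hy' : Bdd y')
    (hz' : Bdd z') (h1 : linZero₁ c y z = linZero₁ c y' z')
    (h2 : linZero₂ c y z = linZero₂ c y' z') : y = y' ∧ z = z' := by
  have := linZero_eq_zero c (hy.sub hy') (hz.sub hz')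
    (by rw [(linZero_sub c hy hz hy' hz').1, h1, sub_self])
    (by rw [(linZero_sub c hy hz hy' hz').2, h2, sub_self])
  exact ⟨sub_eq_zero.1 this.1, sub_eq_zero.1 this.2⟩

/-- Formulated for an arbitrary class, so that together with uniqueness among bounded series it
later gives periodicity, decay or constancy of the coefficients. The base values are kept apart
because they need not lie in `P`. -/
theorem exists_psSolution_zero {P : Fn → Prop} (hP : ResolventClass P) (c : Chart)
    {q : Potential Fn} (hq : q.All P) :
    ∃ S T, AllC P S ∧ AllC P T ∧
      IsPSSolution c 1 PowerSeries.X q (.C c.base₁ + .X * S) (.C c.base₂ + .X * T) := by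
  obtain ⟨S, T, hS, hT, h⟩ := exists_recursive hP.zero (hP.exists_linZero c)
    (causal_remZero₁ c q) (causal_remZero₂ c q)
    (fun _ _ hy hz => (hP.rngClass.remZero c hq hy hz).1)
    (fun _ _ hy hz => (hP.rngClass.remZero c hq hy hz).2)
  have hs : ∀ f, P f → Smooth f := fun f hf => (hP.bdd hf).smooth
  exact ⟨S, T, hS, hT, (isPSSolution_zero_iff (hS.mono hs) (hT.mono hs)).2 h⟩

theorem unique_psSolution_zero {c : Chart} {q : Potential Fn} {Y Z Y' Z' : PowerSeries Fn}
    (hY : AllC Bdd Y) (hZ : AllC Bdd Z) (hY' : AllC Bdd Y') (hZ' : AllC Bdd Z')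
    (h : IsPSSolution c 1 PowerSeries.X q Y Z) (h' : IsPSSolution c 1 PowerSeries.X q Y' Z')
    (h0 : PowerSeries.coeff 0 (psRho c 1 PowerSeries.X q Y Z) = c.zeroth)
    (h0' : PowerSeries.coeff 0 (psRho c 1 PowerSeries.X q Y' Z') = c.zeroth) :
    Y = Y' ∧ Z = Z' := by
  obtain ⟨hy, hz⟩ := coeff_zero_of_isPSSolution h hY hZ h0
  obtain ⟨hy', hz'⟩ := coeff_zero_of_isPSSolution h' hY' hZ' h0'
  have eY := eq_C_add_X_mul_psTail Y
  have eZ := eq_C_add_X_mul_psTail Z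
  have eY' := eq_C_add_X_mul_psTail Y'
  have eZ' := eq_C_add_X_mul_psTail Z'
  rw [hy] at eY
  rw [hz] at eZ
  rw [hy'] at eY'
  rw [hz'] at eZ'
  have hs : ∀ f, Bdd f → Smooth f := fun f hf => hf.smooth
  rw [eY, eZ, isPSSolution_zero_iff (hY.psTail.mono hs) (hZ.psTail.mono hs)] at h
  rw [eY', eZ', isPSSolution_zero_iff (hY'.psTail.mono hs) (hZ'.psTail.mono hs)] at h'
  have := unique_recursive (linZero_injective c) (causal_remZero₁ c q) (causal_remZero₂ c q)
    hY.psTail hZ.psTail hY'.psTail hZ'.psTail h h'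
  rw [eY, eZ, eY', eZ', this.1, this.2]
  exact ⟨rfl, rfl⟩

theorem coeff_zero_psRho_base (c : Chart) (q : Potential Fn) (S T : PowerSeries Fn) :
    PowerSeries.coeff 0 (psRho c 1 PowerSeries.X q (.C c.base₁ + .X * S) (.C c.base₂ + .X * T))
      = c.zeroth := by
  cases c <;> simp [psRho, hDensity, Chart.base₁, Chart.base₂, Chart.zeroth]

/-! ### Expansion in non-positive powers -/

/-- A class of smooth functions closed under the operations that occur in the expansion in
non-positive powers of `λ`. -/
structure FieldClass (P : Fn → Prop) : Prop extends RngClass P where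
  smooth : ∀ {f}, P f → Smooth f
  one : P 1
  dX : ∀ {f}, P f → P (dX f)
  inv : ∀ {f}, P f → (∀ x t, f x t ≠ 0) → P f⁻¹
  sqrt : ∀ {f}, P f → (∀ x t, 0 < f x t) → P fun x t => √(f x t)

theorem fieldClass_smooth : FieldClass Smooth where
  toRngClass := rngClass_smooth
  smooth := id
  one := smooth_one
  dX := Smooth.dX
  inv := Smooth.inv
  sqrt hf h := hf.sqrt fun x t => (h x t).ne'

theorem dX_periodic {L : ℝ} {f : Fn} (hf : PeriodicX L f) : PeriodicX L (dX f) := by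
  intro x t
  have : (fun y => f y t) = fun y => f (y + L) t := funext fun y => (hf y t).symm
  rw [dX_apply, dX_apply]
  conv_rhs => rw [this]
  exact (deriv_comp_add_const (fun y => f y t) L x).symm

theorem dT_periodic {L : ℝ} {f : Fn} (hf : PeriodicX L f) : PeriodicX L (dT f) := by
  intro x t
  rw [dT_apply, dT_apply]
  simp only [hf x]

theorem fieldClass_periodic (L : ℝ) : FieldClass fun f => Smooth f ∧ PeriodicX L f where
  zero := ⟨smooth_zero, fun _ _ => rfl⟩
  add hf hg := ⟨hf.1.add hg.1, fun x t => by simp [hf.2 x t, hg.2 x t]⟩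
  neg hf := ⟨hf.1.neg, fun x t => by simp [hf.2 x t]⟩
  mul hf hg := ⟨hf.1.mul hg.1, fun x t => by simp [hf.2 x t, hg.2 x t]⟩
  smooth hf := hf.1
  one := ⟨smooth_one, fun _ _ => rfl⟩
  dX hf := ⟨hf.1.dX, dX_periodic hf.2⟩
  inv hf h := ⟨hf.1.inv h, fun x t => by simp [hf.2 x t]⟩
  sqrt hf h := ⟨hf.1.sqrt fun x t => (h x t).ne', fun x t => by simp [hf.2 x t]⟩

theorem fieldClass_isConst : FieldClass IsConst where
  toRngClass := resolventClass_isConst.rngClass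
  smooth := by
    rintro _ ⟨c, rfl⟩
    exact smooth_const c
  one := ⟨1, rfl⟩
  dX := by
    rintro _ ⟨c, rfl⟩
    exact ⟨0, dX_const c⟩
  inv := by
    rintro _ ⟨c, rfl⟩ -
    exact ⟨c⁻¹, rfl⟩
  sqrt := by
    rintro _ ⟨c, rfl⟩ -
    exact ⟨√c, rfl⟩

/-- The leading coefficient of the first projective coordinate at `λ = ∞`. -/
def baseInfty₁ (c : Chart) (q : Potential Fn) : Fn :=
  match c with
  | .I => q.m1 * (rho0 q)⁻¹
  | .II => rho0 q * q.m1⁻¹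
  | .III => q.m1 * q.n2⁻¹

/-- The leading coefficient of the second projective coordinate at `λ = ∞`. -/
def baseInfty₂ (c : Chart) (q : Potential Fn) : Fn :=
  match c with
  | .I => q.n2 * (rho0 q)⁻¹
  | .II => q.n2 * q.m1⁻¹
  | .III => rho0 q * q.n2⁻¹

theorem Nondegenerate.rho0_pos {c : Chart} {q : Potential Fn} (h : Nondegenerate c q) (x t : ℝ) :
    0 < rho0 q x t := Real.sqrt_pos.2 (h.1 x t)

theorem Nondegenerate.rho0_mul_self {c : Chart} {q : Potential Fn} (h : Nondegenerate c q) :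
    rho0 q * rho0 q = q.m1 * q.n1 + q.m2 * q.n2 := by
  funext x t
  exact Real.mul_self_sqrt (h.1 x t).le

theorem mul_inv_eq_one {f : Fn} (h : ∀ x t, f x t ≠ 0) : f * f⁻¹ = 1 := by
  funext x t
  exact mul_inv_cancel₀ (h x t)

theorem Nondegenerate.rho0_mul_inv {c : Chart} {q : Potential Fn} (h : Nondegenerate c q) :
    rho0 q * (rho0 q)⁻¹ = 1 := mul_inv_eq_one fun x t => (h.rho0_pos x t).ne'

/-- The inverse of twice `√(m₁ n₁ + m₂ n₂)`. -/
def halfInvRho0 (q : Potential Fn) : Fn := (2 * rho0 q)⁻¹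

theorem Nondegenerate.two_rho0_mul_inv {c : Chart} {q : Potential Fn} (h : Nondegenerate c q) :
    2 * rho0 q * halfInvRho0 q = 1 :=
  mul_inv_eq_one fun x t => mul_ne_zero two_ne_zero (h.rho0_pos x t).ne'

theorem FieldClass.rho0 {P : Fn → Prop} (hP : FieldClass P) {c : Chart} {q : Potential Fn}
    (h : Nondegenerate c q) (hq : q.All P) : P (rho0 q) :=
  hP.sqrt (hP.add (hP.mul hq.1 hq.2.2.1) (hP.mul hq.2.1 hq.2.2.2)) h.1

theorem FieldClass.inv_rho0 {P : Fn → Prop} (hP : FieldClass P) {c : Chart} {q : Potential Fn}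
    (h : Nondegenerate c q) (hq : q.All P) : P (FourCH.rho0 q)⁻¹ :=
  hP.inv (hP.rho0 h hq) fun x t => (h.rho0_pos x t).ne'

theorem FieldClass.halfInvRho0 {P : Fn → Prop} (hP : FieldClass P) {c : Chart}
    {q : Potential Fn} (h : Nondegenerate c q) (hq : q.All P) : P (halfInvRho0 q) := by
  refine hP.inv ?_ fun x t => mul_ne_zero two_ne_zero (h.rho0_pos x t).ne'
  rw [two_mul]
  exact hP.add (hP.rho0 h hq) (hP.rho0 h hq)

theorem FieldClass.baseInfty {P : Fn → Prop} (hP : FieldClass P) {c : Chart} {q : Potential Fn}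
    (h : Nondegenerate c q) (hq : q.All P) : P (baseInfty₁ c q) ∧ P (baseInfty₂ c q) := by
  cases c
  · exact ⟨hP.mul hq.1 (hP.inv_rho0 h hq), hP.mul hq.2.2.2 (hP.inv_rho0 h hq)⟩
  · exact ⟨hP.mul (hP.rho0 h hq) (hP.inv hq.1 h.2), hP.mul hq.2.2.2 (hP.inv hq.1 h.2)⟩
  · exact ⟨hP.mul hq.1 (hP.inv hq.2.2.2 h.2), hP.mul (hP.rho0 h hq) (hP.inv hq.2.2.2 h.2)⟩

/-- The algebraic relations between the leading coefficients at `λ = ∞`. -/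
def LeadingRelations (c : Chart) (q : Potential Fn) (a b r : Fn) : Prop :=
  match c with
  | .I => q.m1 = a * r ∧ q.n2 = b * r ∧ q.n1 * a + q.m2 * b = r
  | .II => q.m1 * a = r ∧ q.n2 = q.m1 * b ∧ q.n1 + q.m2 * b = a * r
  | .III => q.m1 = q.n2 * a ∧ q.n2 * b = r ∧ q.m2 + q.n1 * a = b * r

theorem Nondegenerate.leadingRelations {c : Chart} {q : Potential Fn} (h : Nondegenerate c q) :
    LeadingRelations c q (baseInfty₁ c q) (baseInfty₂ c q) (rho0 q) := by
  have h1 := h.rho0_mul_self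
  have h2 := h.rho0_mul_inv
  cases c
  · simp only [LeadingRelations, baseInfty₁, baseInfty₂]
    refine ⟨?_, ?_, ?_⟩
    · linear_combination (-q.m1) * h2
    · linear_combination (-q.n2) * h2
    · linear_combination (-(rho0 q)⁻¹) * h1 + rho0 q * h2
  · simp only [LeadingRelations, baseInfty₁, baseInfty₂]
    have h3 := mul_inv_eq_one h.2
    refine ⟨?_, ?_, ?_⟩
    · linear_combination rho0 q * h3
    · linear_combination (-q.n2) * h3
    · linear_combination (-q.m1⁻¹) * h1 - q.n1 * h3
  · simp only [LeadingRelations, baseInfty₁, baseInfty₂]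
    have h3 := mul_inv_eq_one h.2
    refine ⟨?_, ?_, ?_⟩
    · linear_combination (-q.m1) * h3
    · linear_combination rho0 q * h3
    · linear_combination (-q.n2⁻¹) * h1 - q.m2 * h3

/-- The linear part of the recursion in non-positive powers of `λ`. -/
def linInfty₁ (c : Chart) (q : Potential Fn) (S T : Fn) : Fn :=
  match c with
  | .I => rho0 q * S + baseInfty₁ .I q * (q.n1 * S + q.m2 * T)
  | .II => q.m2 * T - 2 * rho0 q * S
  | .III => -(rho0 q * S)

/-- The linear part of the recursion in non-positive powers of `λ`. -/
def linInfty₂ (c : Chart) (q : Potential Fn) (S T : Fn) : Fn :=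
  match c with
  | .I => rho0 q * T + baseInfty₂ .I q * (q.n1 * S + q.m2 * T)
  | .II => -(rho0 q * T)
  | .III => q.n1 * S - 2 * rho0 q * T

/-- The remaining terms of the recursion in non-positive powers of `λ`. -/
def remInfty₁ (c : Chart) (q : Potential Fn) (S T : PowerSeries Fn) : PowerSeries Fn :=
  match c with
  | .I => .C (baseInfty₂ .I q - dX (baseInfty₁ .I q))
      + .X * (T - dXs S - S * (.C q.n1 * S + .C q.m2 * T))
  | .II => .C (dX (baseInfty₁ .II q) + baseInfty₁ .II q * baseInfty₂ .II q)
      + .X * (dXs S + .C (baseInfty₁ .II q) * T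
        + S * (.C q.m1 * S + .C (baseInfty₂ .II q) + .X * T))
  | .III => .C (dX (baseInfty₁ .III q) - 1 + baseInfty₁ .III q * baseInfty₁ .III q)
      + .X * (dXs S + .C (baseInfty₁ .III q) * S
        + S * (.C q.n2 * T + .C (baseInfty₁ .III q) + .X * S))

/-- The remaining terms of the recursion in non-positive powers of `λ`. -/
def remInfty₂ (c : Chart) (q : Potential Fn) (S T : PowerSeries Fn) : PowerSeries Fn :=
  match c with
  | .I => .C (baseInfty₁ .I q - dX (baseInfty₂ .I q))
      + .X * (S - dXs T - T * (.C q.n1 * S + .C q.m2 * T))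
  | .II => .C (dX (baseInfty₂ .II q) - 1 + baseInfty₂ .II q * baseInfty₂ .II q)
      + .X * (dXs T + .C (baseInfty₂ .II q) * T
        + T * (.C q.m1 * S + .C (baseInfty₂ .II q) + .X * T))
  | .III => .C (dX (baseInfty₂ .III q) + baseInfty₂ .III q * baseInfty₁ .III q)
      + .X * (dXs T + .C (baseInfty₂ .III q) * S
        + T * (.C q.n2 * T + .C (baseInfty₁ .III q) + .X * S))

theorem ps_pair_eq_iff {A B A' B' : PowerSeries Fn} : (A = A' ∧ B = B') ↔
    ∀ n, PowerSeries.coeff n A = PowerSeries.coeff n A' ∧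
      PowerSeries.coeff n B = PowerSeries.coeff n B' :=
  ⟨fun h n => by rw [h.1, h.2]; exact ⟨rfl, rfl⟩,
    fun h => ⟨PowerSeries.ext fun n => (h n).1, PowerSeries.ext fun n => (h n).2⟩⟩

theorem eq_add_sub_iff {A : Type*} [CommRing A] {a b c : A} : a = a + b - c ↔ c = b :=
  ⟨fun h => by linear_combination h, fun h => by linear_combination h⟩

theorem eq_sub_add_iff {A : Type*} [CommRing A] {a b c : A} : a = a - b + c ↔ c = b :=
  ⟨fun h => by linear_combination -h, fun h => by linear_combination -h⟩

/-- The leading relations cancel the terms without `X`. The derivative enters with the factor `X`,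
so after division the derivatives of the unknown coefficients are delayed by one order and the
linear part is purely algebraic. This is why no boundedness in `x` is required here. -/
theorem isPSSolution_infty_iff {c : Chart} {q : Potential Fn} (hq : q.All Smooth)
    (h : Nondegenerate c q) {S T : PowerSeries Fn} (hS : AllC Smooth S) (hT : AllC Smooth T) :
    IsPSSolution c PowerSeries.X 1 q (.C (baseInfty₁ c q) + .X * S)
        (.C (baseInfty₂ c q) + .X * T) ↔
      ∀ n, linInfty₁ c q (PowerSeries.coeff n S) (PowerSeries.coeff n T)
          = PowerSeries.coeff n (remInfty₁ c q S T) ∧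
        linInfty₂ c q (PowerSeries.coeff n S) (PowerSeries.coeff n T)
          = PowerSeries.coeff n (remInfty₂ c q S T) := by
  have hb := fieldClass_smooth.baseInfty h hq
  have hrel := h.leadingRelations
  have e1 := dXs_C_add_X_mul hb.1 hS
  have e2 := dXs_C_add_X_mul hb.2 hT
  have hiff : IsPSSolution c PowerSeries.X 1 q (.C (baseInfty₁ c q) + .X * S)
        (.C (baseInfty₂ c q) + .X * T) ↔
      (.X * (.C (dX (baseInfty₁ c q)) + .X * dXs S) = hFst c .X 1 (q.map PowerSeries.C)
          (.C (baseInfty₁ c q) + .X * S) (.C (baseInfty₂ c q) + .X * T) ∧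
      .X * (.C (dX (baseInfty₂ c q)) + .X * dXs T) = hSnd c .X 1 (q.map PowerSeries.C)
          (.C (baseInfty₁ c q) + .X * S) (.C (baseInfty₂ c q) + .X * T)) := by
    rw [← e1, ← e2]
    exact ⟨fun h => ⟨h.fst, h.snd⟩, fun h => ⟨h.1, h.2⟩⟩
  have h2 : ∀ (n : ℕ) (S : PowerSeries Fn),
      (2 : Fn) * PowerSeries.coeff n S = PowerSeries.coeff n (2 * S) := by
    intro n S
    rw [two_mul, two_mul, map_add]
  rw [hiff]
  set a := baseInfty₁ c q with ha
  set b := baseInfty₂ c q with hb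
  set r := rho0 q with hr
  cases c
  · obtain ⟨r1, r2, r3⟩ := hrel
    have r1 := congrArg (PowerSeries.C (R := Fn)) r1
    have r2 := congrArg (PowerSeries.C (R := Fn)) r2
    have r3 := congrArg (PowerSeries.C (R := Fn)) r3
    simp only [map_mul, map_add] at r1 r2 r3
    have h3 : hFst .I .X 1 (q.map PowerSeries.C) (.C a + .X * S) (.C b + .X * T) =
        .X * (.C (dX a) + .X * dXs S + remInfty₁ .I q S T
          - (.C r * S + .C a * (.C q.n1 * S + .C q.m2 * T))) := by
      simp only [hFst, hDensity, remInfty₁, Potential.map, ← ha, ← hb, map_sub]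
      linear_combination r1 - (PowerSeries.C a + PowerSeries.X * S) * r3
    have h4 : hSnd .I .X 1 (q.map PowerSeries.C) (.C a + .X * S) (.C b + .X * T) =
        .X * (.C (dX b) + .X * dXs T + remInfty₂ .I q S T
          - (.C r * T + .C b * (.C q.n1 * S + .C q.m2 * T))) := by
      simp only [hSnd, hDensity, remInfty₂, Potential.map, ← ha, ← hb, map_sub]
      linear_combination r2 - (PowerSeries.C b + PowerSeries.X * T) * r3
    rw [h3, h4, X_mul_inj, X_mul_inj, eq_add_sub_iff, eq_add_sub_iff, ps_pair_eq_iff]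
    simp only [map_add, PowerSeries.coeff_C_mul, linInfty₁, linInfty₂, ← ha, ← hb, ← hr]
  · obtain ⟨r1, r2, r3⟩ := hrel
    have r1 := congrArg (PowerSeries.C (R := Fn)) r1
    have r2 := congrArg (PowerSeries.C (R := Fn)) r2
    have r3 := congrArg (PowerSeries.C (R := Fn)) r3
    simp only [map_mul, map_add] at r1 r2 r3
    have h3 : hFst .II .X 1 (q.map PowerSeries.C) (.C a + .X * S) (.C b + .X * T) =
        .X * (.C (dX a) + .X * dXs S - remInfty₁ .II q S T
          + (.C q.m2 * T - 2 * (.C r * S))) := by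
      simp only [hFst, hDensity, remInfty₁, Potential.map, ← ha, ← hb, map_add, map_mul]
      linear_combination r3 - (PowerSeries.C a + 2 * PowerSeries.X * S) * r1
    have h4 : hSnd .II .X 1 (q.map PowerSeries.C) (.C a + .X * S) (.C b + .X * T) =
        .X * (.C (dX b) + .X * dXs T - remInfty₂ .II q S T + (-(.C r * T))) := by
      simp only [hSnd, hDensity, remInfty₂, Potential.map, ← hb, map_add, map_sub, map_mul,
        map_one]
      linear_combination (PowerSeries.C a + PowerSeries.X * S) * r2
        - PowerSeries.X * T * r1
    rw [h3, h4, X_mul_inj, X_mul_inj, eq_sub_add_iff, eq_sub_add_iff, ps_pair_eq_iff]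
    simp only [map_neg, map_sub, PowerSeries.coeff_C_mul, linInfty₁, linInfty₂, ← hr, ← h2,
      mul_assoc]
  · obtain ⟨r1, r2, r3⟩ := hrel
    have r1 := congrArg (PowerSeries.C (R := Fn)) r1
    have r2 := congrArg (PowerSeries.C (R := Fn)) r2
    have r3 := congrArg (PowerSeries.C (R := Fn)) r3
    simp only [map_mul, map_add] at r1 r2 r3
    have h3 : hFst .III .X 1 (q.map PowerSeries.C) (.C a + .X * S) (.C b + .X * T) =
        .X * (.C (dX a) + .X * dXs S - remInfty₁ .III q S T + (-(.C r * S))) := by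
      simp only [hFst, hDensity, remInfty₁, Potential.map, ← ha, map_add, map_sub, map_mul,
        map_one]
      linear_combination (PowerSeries.C b + PowerSeries.X * T) * r1
        - PowerSeries.X * S * r2
    have h4 : hSnd .III .X 1 (q.map PowerSeries.C) (.C a + .X * S) (.C b + .X * T) =
        .X * (.C (dX b) + .X * dXs T - remInfty₂ .III q S T
          + (.C q.n1 * S - 2 * (.C r * T))) := by
      simp only [hSnd, hDensity, remInfty₂, Potential.map, ← ha, ← hb, map_add, map_mul]
      linear_combination r3 - (PowerSeries.C b + 2 * PowerSeries.X * T) * r2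
    rw [h3, h4, X_mul_inj, X_mul_inj, eq_sub_add_iff, eq_sub_add_iff, ps_pair_eq_iff]
    simp only [map_neg, map_sub, PowerSeries.coeff_C_mul, linInfty₁, linInfty₂, ← hr, ← h2,
      mul_assoc]

theorem causal_remInfty₁ (c : Chart) (q : Potential Fn) : Causal 1 (remInfty₁ c q) := by
  cases c
  · exact (Causal.const (.C (baseInfty₂ .I q - dX (baseInfty₁ .I q)))).add
      (((Causal.snd.sub Causal.fst.dXs).sub
        (Causal.fst.mul (Causal.lin (.C q.n1) (.C q.m2)))).X_mul)
  · exact (Causal.const (.C (dX (baseInfty₁ .II q) + baseInfty₁ .II q * baseInfty₂ .II q))).add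
      (((Causal.fst.dXs.add ((Causal.const (.C (baseInfty₁ .II q))).mul Causal.snd)).add
        (Causal.fst.mul ((((Causal.const (.C q.m1)).mul Causal.fst).add
          (Causal.const (.C (baseInfty₂ .II q)))).add Causal.snd.X_mul.weaken))).X_mul)
  · exact (Causal.const (.C (dX (baseInfty₁ .III q) - 1
        + baseInfty₁ .III q * baseInfty₁ .III q))).add
      (((Causal.fst.dXs.add ((Causal.const (.C (baseInfty₁ .III q))).mul Causal.fst)).add
        (Causal.fst.mul ((((Causal.const (.C q.n2)).mul Causal.snd).add
          (Causal.const (.C (baseInfty₁ .III q)))).add Causal.fst.X_mul.weaken))).X_mul)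

theorem causal_remInfty₂ (c : Chart) (q : Potential Fn) : Causal 1 (remInfty₂ c q) := by
  cases c
  · exact (Causal.const (.C (baseInfty₁ .I q - dX (baseInfty₂ .I q)))).add
      (((Causal.fst.sub Causal.snd.dXs).sub
        (Causal.snd.mul (Causal.lin (.C q.n1) (.C q.m2)))).X_mul)
  · exact (Causal.const (.C (dX (baseInfty₂ .II q) - 1
        + baseInfty₂ .II q * baseInfty₂ .II q))).add
      (((Causal.snd.dXs.add ((Causal.const (.C (baseInfty₂ .II q))).mul Causal.snd)).add
        (Causal.snd.mul ((((Causal.const (.C q.m1)).mul Causal.fst).add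
          (Causal.const (.C (baseInfty₂ .II q)))).add Causal.snd.X_mul.weaken))).X_mul)
  · exact (Causal.const (.C (dX (baseInfty₂ .III q)
        + baseInfty₂ .III q * baseInfty₁ .III q))).add
      (((Causal.snd.dXs.add ((Causal.const (.C (baseInfty₂ .III q))).mul Causal.fst)).add
        (Causal.snd.mul ((((Causal.const (.C q.n2)).mul Causal.snd).add
          (Causal.const (.C (baseInfty₁ .III q)))).add Causal.fst.X_mul.weaken))).X_mul)

theorem FieldClass.allC_dXs {P : Fn → Prop} (hP : FieldClass P) {Y : PowerSeries Fn}
    (hY : AllC P Y) : AllC P (dXs Y) := fun n => by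
  rw [coeff_dXs]
  exact hP.dX (hY n)

theorem FieldClass.remInfty {P : Fn → Prop} (hP : FieldClass P) {c : Chart} {q : Potential Fn}
    (h : Nondegenerate c q) (hq : q.All P) {S T : PowerSeries Fn} (hS : AllC P S)
    (hT : AllC P T) : AllC P (remInfty₁ c q S T) ∧ AllC P (remInfty₂ c q S T) := by
  obtain ⟨ha, hb⟩ := hP.baseInfty h hq
  obtain ⟨h1, h2, h3, h4⟩ := hq
  have h1 := hP.allC_C h1
  have h2 := hP.allC_C h2
  have h3 := hP.allC_C h3
  have h4 := hP.allC_C h4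
  have hA := hP.allC_C ha
  have hB := hP.allC_C hb
  have hS' := hP.allC_dXs hS
  have hT' := hP.allC_dXs hT
  cases c
  · exact ⟨hP.allC_add (hP.allC_C (hP.sub hb (hP.dX ha))) (hP.allC_X_mul (hP.allC_sub
        (hP.allC_sub hT hS') (hP.allC_mul hS (hP.allC_add (hP.allC_mul h3 hS)
          (hP.allC_mul h2 hT))))),
      hP.allC_add (hP.allC_C (hP.sub ha (hP.dX hb))) (hP.allC_X_mul (hP.allC_sub
        (hP.allC_sub hS hT') (hP.allC_mul hT (hP.allC_add (hP.allC_mul h3 hS)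
          (hP.allC_mul h2 hT)))))⟩
  · have hR := hP.allC_add (hP.allC_add (hP.allC_mul h1 hS) hB) (hP.allC_X_mul hT)
    exact ⟨hP.allC_add (hP.allC_C (hP.add (hP.dX ha) (hP.mul ha hb))) (hP.allC_X_mul
        (hP.allC_add (hP.allC_add hS' (hP.allC_mul hA hT)) (hP.allC_mul hS hR))),
      hP.allC_add (hP.allC_C (hP.add (hP.sub (hP.dX hb) hP.one) (hP.mul hb hb))) (hP.allC_X_mul
        (hP.allC_add (hP.allC_add hT' (hP.allC_mul hB hT)) (hP.allC_mul hT hR)))⟩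
  · have hR := hP.allC_add (hP.allC_add (hP.allC_mul h4 hT) hA) (hP.allC_X_mul hS)
    exact ⟨hP.allC_add (hP.allC_C (hP.add (hP.sub (hP.dX ha) hP.one) (hP.mul ha ha)))
        (hP.allC_X_mul (hP.allC_add (hP.allC_add hS' (hP.allC_mul hA hS)) (hP.allC_mul hS hR))),
      hP.allC_add (hP.allC_C (hP.add (hP.dX hb) (hP.mul hb ha))) (hP.allC_X_mul
        (hP.allC_add (hP.allC_add hT' (hP.allC_mul hB hS)) (hP.allC_mul hT hR)))⟩

/-- In Case I the matrix is `√(m₁n₁ + m₂n₂)` times the identity plus a matrix of rank one, and the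
other two cases are triangular. All divisions are by `√(m₁n₁ + m₂n₂)` or its double. -/
theorem FieldClass.exists_linInfty {P : Fn → Prop} (hP : FieldClass P) {c : Chart}
    {q : Potential Fn} (h : Nondegenerate c q) (hq : q.All P) (F G : Fn) (hF : P F) (hG : P G) :
    ∃ y z, P y ∧ P z ∧ linInfty₁ c q y z = F ∧ linInfty₂ c q y z = G := by
  obtain ⟨ha, hb⟩ := hP.baseInfty h hq
  have hi := hP.inv_rho0 h hq
  have hh := hP.halfInvRho0 h hq
  have e1 := h.rho0_mul_inv
  have e2 := h.two_rho0_mul_inv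
  have hrel := h.leadingRelations
  cases c
  · obtain ⟨-, -, r3⟩ := hrel
    -- This is the value that `n₁ y + m₂ z` must have: contracting the system with `(n₁, m₂)` gives
    -- `2 √(m₁n₁ + m₂n₂) (n₁ y + m₂ z) = n₁ F + m₂ G`. Once it is known, `y` and `z` follow
    -- separately.
    have hs : P ((q.n1 * F + q.m2 * G) * FourCH.halfInvRho0 q) :=
      hP.mul (hP.add (hP.mul hq.2.2.1 hF) (hP.mul hq.2.1 hG)) hh
    refine ⟨_, _, hP.mul (hP.sub hF (hP.mul ha hs)) hi, hP.mul (hP.sub hG (hP.mul hb hs)) hi,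
      ?_, ?_⟩
    · simp only [linInfty₁]
      linear_combination F * e1
        - baseInfty₁ .I q * (FourCH.rho0 q)⁻¹ * (q.n1 * F + q.m2 * G) * FourCH.halfInvRho0 q * r3
        - baseInfty₁ .I q * (FourCH.rho0 q)⁻¹ * (q.n1 * F + q.m2 * G) * e2
    · simp only [linInfty₂]
      linear_combination G * e1
        - baseInfty₂ .I q * (FourCH.rho0 q)⁻¹ * (q.n1 * F + q.m2 * G) * FourCH.halfInvRho0 q * r3
        - baseInfty₂ .I q * (FourCH.rho0 q)⁻¹ * (q.n1 * F + q.m2 * G) * e2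
  · have hz := hP.neg (hP.mul hG hi)
    refine ⟨_, _, hP.mul (hP.sub (hP.mul hq.2.1 hz) hF) hh, hz, ?_, ?_⟩
    · simp only [linInfty₁]
      linear_combination (F + q.m2 * (G * (FourCH.rho0 q)⁻¹)) * e2
    · simp only [linInfty₂]
      linear_combination G * e1
  · have hy := hP.neg (hP.mul hF hi)
    refine ⟨_, _, hy, hP.mul (hP.sub (hP.mul hq.2.2.1 hy) hG) hh, ?_, ?_⟩
    · simp only [linInfty₁]
      linear_combination F * e1
    · simp only [linInfty₂]
      linear_combination (G + q.n1 * (F * (FourCH.rho0 q)⁻¹)) * e2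

theorem linInfty_eq_zero {c : Chart} {q : Potential Fn} (h : Nondegenerate c q) {y z : Fn}
    (h1 : linInfty₁ c q y z = 0) (h2 : linInfty₂ c q y z = 0) : y = 0 ∧ z = 0 := by
  have e1 := h.rho0_mul_inv
  have e2 := h.two_rho0_mul_inv
  have hrel := h.leadingRelations
  cases c
  · obtain ⟨-, -, r3⟩ := hrel
    simp only [linInfty₁, linInfty₂] at h1 h2
    have hu : q.n1 * y + q.m2 * z = 0 := by
      linear_combination halfInvRho0 q * (q.n1 * h1 + q.m2 * h2)
        - (q.n1 * y + q.m2 * z) * e2 - (q.n1 * y + q.m2 * z) * halfInvRho0 q * r3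
    rw [hu, mul_zero, add_zero] at h1 h2
    exact ⟨by linear_combination (rho0 q)⁻¹ * h1 - y * e1,
      by linear_combination (rho0 q)⁻¹ * h2 - z * e1⟩
  · simp only [linInfty₁, linInfty₂] at h1 h2
    have hz : z = 0 := by linear_combination -(rho0 q)⁻¹ * h2 - z * e1
    rw [hz] at h1
    exact ⟨by linear_combination -halfInvRho0 q * h1 - y * e2, hz⟩
  · simp only [linInfty₁, linInfty₂] at h1 h2
    have hy : y = 0 := by linear_combination -(rho0 q)⁻¹ * h1 - y * e1
    rw [hy] at h2
    exact ⟨hy, by linear_combination -halfInvRho0 q * h2 - z * e2⟩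

theorem linInfty_injective {c : Chart} {q : Potential Fn} (h : Nondegenerate c q)
    (y z y' z' : Fn) (h1 : linInfty₁ c q y z = linInfty₁ c q y' z')
    (h2 : linInfty₂ c q y z = linInfty₂ c q y' z') : y = y' ∧ z = z' := by
  have e : ∀ c, linInfty₁ c q (y - y') (z - z') = linInfty₁ c q y z - linInfty₁ c q y' z' ∧
      linInfty₂ c q (y - y') (z - z') = linInfty₂ c q y z - linInfty₂ c q y' z' := by
    intro c
    cases c <;> simp only [linInfty₁, linInfty₂] <;> constructor <;> ring
  have := linInfty_eq_zero h (y := y - y') (z := z - z') (by rw [(e c).1, h1, sub_self])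
    (by rw [(e c).2, h2, sub_self])
  exact ⟨sub_eq_zero.1 this.1, sub_eq_zero.1 this.2⟩

/-- At order zero the equations say that the normalized vector is an eigenvector of the part of `U`
linear in `λ`, with eigenvalue the leading coefficient of `ρ`. Prescribing the eigenvalue makes the
equations for the vector linear, and nondegeneracy lets one solve them. -/
theorem coeff_zero_of_isPSSolution_infty {c : Chart} {q : Potential Fn} (h : Nondegenerate c q)
    {Y Z : PowerSeries Fn} (hs : IsPSSolution c PowerSeries.X 1 q Y Z)
    (h0 : PowerSeries.coeff 0 (psRho c PowerSeries.X 1 q Y Z) = rho0 q) :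
    PowerSeries.coeff 0 Y = baseInfty₁ c q ∧ PowerSeries.coeff 0 Z = baseInfty₂ c q := by
  obtain ⟨h1, h2⟩ := hs
  have h1 := congrArg (PowerSeries.coeff 0) h1
  have h2 := congrArg (PowerSeries.coeff 0) h2
  have e1 := h.rho0_mul_inv
  rw [PowerSeries.coeff_zero_eq_constantCoeff] at h0 h1 h2 ⊢
  cases c
  · simp [hFst, hSnd, hDensity, psRho, Potential.map] at h0 h1 h2
    rw [h0] at h1 h2
    simp only [baseInfty₁, baseInfty₂]
    exact ⟨by linear_combination (rho0 q)⁻¹ * h1 - PowerSeries.constantCoeff Y * e1,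
      by linear_combination (rho0 q)⁻¹ * h2 - PowerSeries.constantCoeff Z * e1⟩
  · have e3 := mul_inv_eq_one h.2
    simp [hFst, hSnd, hDensity, psRho, Potential.map] at h0 h1 h2
    simp only [baseInfty₁, baseInfty₂]
    rw [h0] at h2
    exact ⟨by linear_combination q.m1⁻¹ * h0 - PowerSeries.constantCoeff Y * e3, by
      linear_combination (rho0 q)⁻¹ * h2 - PowerSeries.constantCoeff Z * e1
        + q.n2 * (rho0 q)⁻¹ * q.m1⁻¹ * h0
        - q.n2 * PowerSeries.constantCoeff Y * (rho0 q)⁻¹ * e3 + q.n2 * q.m1⁻¹ * e1⟩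
  · have e3 := mul_inv_eq_one h.2
    simp [hFst, hSnd, hDensity, psRho, Potential.map] at h0 h1 h2
    simp only [baseInfty₁, baseInfty₂]
    rw [h0] at h1
    exact ⟨by
      linear_combination (rho0 q)⁻¹ * h1 - PowerSeries.constantCoeff Y * e1
        + q.m1 * (rho0 q)⁻¹ * q.n2⁻¹ * h0
        - q.m1 * PowerSeries.constantCoeff Z * (rho0 q)⁻¹ * e3 + q.m1 * q.n2⁻¹ * e1,
      by linear_combination q.n2⁻¹ * h0 - PowerSeries.constantCoeff Z * e3⟩

theorem coeff_zero_psRho_baseInfty {c : Chart} {q : Potential Fn} (h : Nondegenerate c q)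
    (S T : PowerSeries Fn) :
    PowerSeries.coeff 0 (psRho c PowerSeries.X 1 q (.C (baseInfty₁ c q) + .X * S)
      (.C (baseInfty₂ c q) + .X * T)) = rho0 q := by
  have hrel := h.leadingRelations
  cases c
  · simpa [psRho, hDensity, Potential.map] using hrel.2.2
  · simpa [psRho, hDensity, Potential.map] using hrel.1
  · simpa [psRho, hDensity, Potential.map] using hrel.2.1

theorem exists_psSolution_infty {P : Fn → Prop} (hP : FieldClass P) {c : Chart}
    {q : Potential Fn} (h : Nondegenerate c q) (hq : q.All P) :
    ∃ Y Z, AllC P Y ∧ AllC P Z ∧ IsPSSolution c PowerSeries.X 1 q Y Z ∧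
      PowerSeries.coeff 0 (psRho c PowerSeries.X 1 q Y Z) = rho0 q := by
  obtain ⟨S, T, hS, hT, hST⟩ := exists_recursive hP.zero (hP.exists_linInfty h hq)
    (causal_remInfty₁ c q) (causal_remInfty₂ c q)
    (fun _ _ hy hz => (hP.remInfty h hq hy hz).1)
    (fun _ _ hy hz => (hP.remInfty h hq hy hz).2)
  have hs : ∀ f, P f → Smooth f := fun f hf => hP.smooth hf
  have hb := hP.baseInfty h hq
  exact ⟨_, _, hP.allC_add (hP.allC_C hb.1) (hP.allC_X_mul hS),
    hP.allC_add (hP.allC_C hb.2) (hP.allC_X_mul hT),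
    (isPSSolution_infty_iff ⟨hs _ hq.1, hs _ hq.2.1, hs _ hq.2.2.1, hs _ hq.2.2.2⟩ h
      (hS.mono hs) (hT.mono hs)).2 hST, coeff_zero_psRho_baseInfty h S T⟩

theorem unique_psSolution_infty {c : Chart} {q : Potential Fn} (hq : q.All Smooth)
    (hn : Nondegenerate c q) {Y Z Y' Z' : PowerSeries Fn}
    (hY : AllC Smooth Y) (hZ : AllC Smooth Z) (hY' : AllC Smooth Y') (hZ' : AllC Smooth Z')
    (h : IsPSSolution c PowerSeries.X 1 q Y Z) (h' : IsPSSolution c PowerSeries.X 1 q Y' Z')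
    (h0 : PowerSeries.coeff 0 (psRho c PowerSeries.X 1 q Y Z) = rho0 q)
    (h0' : PowerSeries.coeff 0 (psRho c PowerSeries.X 1 q Y' Z') = rho0 q) :
    Y = Y' ∧ Z = Z' := by
  obtain ⟨hy, hz⟩ := coeff_zero_of_isPSSolution_infty hn h h0
  obtain ⟨hy', hz'⟩ := coeff_zero_of_isPSSolution_infty hn h' h0'
  have eY := eq_C_add_X_mul_psTail Y
  have eZ := eq_C_add_X_mul_psTail Z
  have eY' := eq_C_add_X_mul_psTail Y'
  have eZ' := eq_C_add_X_mul_psTail Z'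
  rw [hy] at eY
  rw [hz] at eZ
  rw [hy'] at eY'
  rw [hz'] at eZ'
  rw [eY, eZ, isPSSolution_infty_iff hq hn hY.psTail hZ.psTail] at h
  rw [eY', eZ', isPSSolution_infty_iff hq hn hY'.psTail hZ'.psTail] at h'
  have := unique_recursive (fun y z y' z' _ _ _ _ => linInfty_injective hn y z y' z')
    (causal_remInfty₁ c q) (causal_remInfty₂ c q)
    hY.psTail hZ.psTail hY'.psTail hZ'.psTail h h'
  rw [eY, eZ, eY', eZ', this.1, this.2]
  exact ⟨rfl, rfl⟩

/-! ### Formal Laurent series -/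

section Hom

variable {A B : Type*} [CommRing A] [CommRing B]

theorem map_hDensity (f : A →+* B) (c : Chart) (e l : A) (q : Potential A) (y z : A) :
    f (hDensity c e l q y z) = hDensity c (f e) (f l) (q.map f) (f y) (f z) := by
  cases c <;> simp [hDensity, Potential.map]

theorem map_hFst (f : A →+* B) (c : Chart) (e l : A) (q : Potential A) (y z : A) :
    f (hFst c e l q y z) = hFst c (f e) (f l) (q.map f) (f y) (f z) := by
  cases c <;> simp [hFst, hDensity, Potential.map]

theorem map_hSnd (f : A →+* B) (c : Chart) (e l : A) (q : Potential A) (y z : A) :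
    f (hSnd c e l q y z) = hSnd c (f e) (f l) (q.map f) (f y) (f z) := by
  cases c <;> simp [hSnd, hDensity, Potential.map]

theorem mul_density (c : Chart) (k l : A) (q : Potential A) (y z : A) :
    k * density c l q y z = hDensity c k (k * l) q y z := by
  cases c <;> simp only [density, hDensity] <;> ring

theorem mul_riccatiFst (c : Chart) (k l : A) (q : Potential A) (y z : A) :
    k * riccatiFst c l q y z = hFst c k (k * l) q y z := by
  cases c <;> simp only [density, hDensity, riccatiFst, hFst] <;> ring

theorem mul_riccatiSnd (c : Chart) (k l : A) (q : Potential A) (y z : A) :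
    k * riccatiSnd c l q y z = hSnd c k (k * l) q y z := by
  cases c <;> simp only [density, hDensity, riccatiSnd, hSnd] <;> ring

end Hom

/-- The embedding of power series into Laurent series. -/
abbrev toLS : PowerSeries Fn →+* Fn⸨X⸩ := HahnSeries.ofPowerSeries ℤ Fn

theorem coeff_toLS (Y : PowerSeries Fn) (j : ℤ) :
    (toLS Y).coeff j = if j < 0 then 0 else PowerSeries.coeff j.natAbs Y :=
  PowerSeries.coeff_coe Y j

theorem coeff_toLS_natCast (Y : PowerSeries Fn) (n : ℕ) :
    (toLS Y).coeff n = PowerSeries.coeff n Y := by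
  simp [coeff_toLS]

theorem exists_toLS {y : Fn⸨X⸩} (h : ∀ j < 0, y.coeff j = 0) : ∃ Y, toLS Y = y := by
  refine ⟨PowerSeries.mk fun n => y.coeff n, ?_⟩
  ext1
  funext j
  rw [coeff_toLS]
  split_ifs with hj
  · exact (h j hj).symm
  · rw [PowerSeries.coeff_mk, Int.natAbs_of_nonneg (not_lt.1 hj)]

theorem toLS_dXs (Y : PowerSeries Fn) : toLS (dXs Y) = (toLS Y).map dX := by
  ext1
  funext j
  rw [HahnSeries.map_coeff, coeff_toLS, coeff_toLS]
  split_ifs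
  exacts [(map_zero dX).symm, coeff_dXs _ _]

theorem series_eq (q : Potential Fn) : series q = (q.map PowerSeries.C).map toLS := by
  simp only [series, Potential.map, toLS, HahnSeries.ofPowerSeries_C]

theorem toLS_X : toLS PowerSeries.X = HahnSeries.single 1 1 := HahnSeries.ofPowerSeries_X

theorem lam_one : lam 1 = toLS PowerSeries.X := toLS_X.symm

theorem toLS_X_mul_lam : toLS PowerSeries.X * lam (-1) = 1 := by
  rw [toLS_X, lam, HahnSeries.single_mul_single]
  simp

theorem toLS_X_mul_inj {a b : Fn⸨X⸩} :
    toLS PowerSeries.X * a = toLS PowerSeries.X * b ↔ a = b := by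
  refine ⟨fun h => ?_, fun h => by rw [h]⟩
  linear_combination lam (-1) * h - (a - b) * toLS_X_mul_lam

theorem allC_iff_coeff_toLS {P : Fn → Prop} (h0 : P 0) {Y : PowerSeries Fn} :
    AllC P Y ↔ ∀ j, P ((toLS Y).coeff j) := by
  constructor
  · intro h j
    rw [coeff_toLS]
    split_ifs
    exacts [h0, h _]
  · intro h n
    rw [← coeff_toLS_natCast]
    exact h n

theorem isFormalSolution_one_iff {c : Chart} {P : Fn → Prop} (h0 : P 0) {q : Potential Fn}
    {Y Z : PowerSeries Fn} : IsFormalSolution c 1 P q (toLS Y) (toLS Z) ↔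
      AllC P Y ∧ AllC P Z ∧ IsPSSolution c 1 PowerSeries.X q Y Z := by
  have h1 : riccatiFst c (lam 1) (series q) (toLS Y) (toLS Z) =
      toLS (hFst c 1 PowerSeries.X (q.map PowerSeries.C) Y Z) := by
    rw [map_hFst, series_eq, lam_one, map_one, ← one_mul (riccatiFst _ _ _ _ _), mul_riccatiFst,
      one_mul]
  have h2 : riccatiSnd c (lam 1) (series q) (toLS Y) (toLS Z) =
      toLS (hSnd c 1 PowerSeries.X (q.map PowerSeries.C) Y Z) := by
    rw [map_hSnd, series_eq, lam_one, map_one, ← one_mul (riccatiSnd _ _ _ _ _), mul_riccatiSnd,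
      one_mul]
  constructor
  · intro h
    refine ⟨(allC_iff_coeff_toLS h0).2 h.coeff_fst, (allC_iff_coeff_toLS h0).2 h.coeff_snd, ?_⟩
    refine ⟨?_, ?_⟩
    · have := h.eq_fst
      rw [← toLS_dXs, h1] at this
      rw [one_mul]
      exact HahnSeries.ofPowerSeries_injective this
    · have := h.eq_snd
      rw [← toLS_dXs, h2] at this
      rw [one_mul]
      exact HahnSeries.ofPowerSeries_injective this
  · rintro ⟨hY, hZ, h⟩
    refine ⟨(allC_iff_coeff_toLS h0).1 hY, (allC_iff_coeff_toLS h0).1 hZ, ?_, ?_, ?_, ?_⟩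
    · intro j hj
      simp [coeff_toLS, hj]
    · intro j hj
      simp [coeff_toLS, hj]
    · rw [← toLS_dXs, h1, ← h.fst, one_mul]
    · rw [← toLS_dXs, h2, ← h.snd, one_mul]

/-- Multiplying by `X = λ⁻¹` turns the parameters `(1, λ)` into `(X, 1)`, so that only power series
occur. Nothing is lost, as `X` is a unit among Laurent series. -/
theorem isFormalSolution_neg_one_iff {c : Chart} {P : Fn → Prop} (h0 : P 0) {q : Potential Fn}
    {Y Z : PowerSeries Fn} : IsFormalSolution c (-1) P q (toLS Y) (toLS Z) ↔
      AllC P Y ∧ AllC P Z ∧ IsPSSolution c PowerSeries.X 1 q Y Z := by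
  have h1 : toLS PowerSeries.X * riccatiFst c (lam (-1)) (series q) (toLS Y) (toLS Z) =
      toLS (hFst c PowerSeries.X 1 (q.map PowerSeries.C) Y Z) := by
    rw [map_hFst, series_eq, map_one, mul_riccatiFst, toLS_X_mul_lam]
  have h2 : toLS PowerSeries.X * riccatiSnd c (lam (-1)) (series q) (toLS Y) (toLS Z) =
      toLS (hSnd c PowerSeries.X 1 (q.map PowerSeries.C) Y Z) := by
    rw [map_hSnd, series_eq, map_one, mul_riccatiSnd, toLS_X_mul_lam]
  constructor
  · intro h
    refine ⟨(allC_iff_coeff_toLS h0).2 h.coeff_fst, (allC_iff_coeff_toLS h0).2 h.coeff_snd, ?_⟩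
    refine ⟨HahnSeries.ofPowerSeries_injective (Γ := ℤ) ?_,
      HahnSeries.ofPowerSeries_injective (Γ := ℤ) ?_⟩
    · exact h1 ▸ (by rw [map_mul, toLS_dXs, h.eq_fst])
    · exact h2 ▸ (by rw [map_mul, toLS_dXs, h.eq_snd])
  · rintro ⟨hY, hZ, h⟩
    refine ⟨(allC_iff_coeff_toLS h0).1 hY, (allC_iff_coeff_toLS h0).1 hZ, ?_, ?_, ?_, ?_⟩
    · intro j hj
      simp [coeff_toLS, hj]
    · intro j hj
      simp [coeff_toLS, hj]
    · rw [← toLS_X_mul_inj, h1, ← h.fst, map_mul, toLS_dXs]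
    · rw [← toLS_X_mul_inj, h2, ← h.snd, map_mul, toLS_dXs]

theorem rho_one (c : Chart) (q : Potential Fn) (Y Z : PowerSeries Fn) :
    rho c 1 q (toLS Y) (toLS Z) = toLS (psRho c 1 PowerSeries.X q Y Z) := by
  rw [psRho, map_hDensity, rho, series_eq, lam_one, map_one, ← one_mul (density _ _ _ _ _),
    mul_density, one_mul]

theorem X_mul_rho_neg_one (c : Chart) (q : Potential Fn) (Y Z : PowerSeries Fn) :
    toLS PowerSeries.X * rho c (-1) q (toLS Y) (toLS Z) =
      toLS (psRho c PowerSeries.X 1 q Y Z) := by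
  rw [psRho, map_hDensity, rho, series_eq, map_one, mul_density, toLS_X_mul_lam]

theorem coeff_toLS_X_mul (f : Fn⸨X⸩) (j : ℤ) :
    (toLS PowerSeries.X * f).coeff (j + 1) = f.coeff j := by
  rw [toLS_X, HahnSeries.coeff_single_mul_add, one_mul]

theorem lamCoeff_rho_one (c : Chart) (q : Potential Fn) (Y Z : PowerSeries Fn) (n : ℕ) :
    lamCoeff 1 (rho c 1 q (toLS Y) (toLS Z)) n =
      PowerSeries.coeff n (psRho c 1 PowerSeries.X q Y Z) := by
  rw [rho_one, lamCoeff, one_mul, coeff_toLS_natCast]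

/-- The index is shifted by one because `ρ` begins with `λ¹`: it is `λ⁻¹ρ` that is a power series in
`λ⁻¹`. -/
theorem lamCoeff_rho_neg_one (c : Chart) (q : Potential Fn) (Y Z : PowerSeries Fn) (n : ℕ) :
    lamCoeff (-1) (rho c (-1) q (toLS Y) (toLS Z)) (1 - n) =
      PowerSeries.coeff n (psRho c PowerSeries.X 1 q Y Z) := by
  rw [← coeff_toLS_natCast, ← X_mul_rho_neg_one, lamCoeff, ← coeff_toLS_X_mul]
  congr 1
  ring

theorem isExpansionZero_iff {c : Chart} {q : Potential Fn} {Y Z : PowerSeries Fn} :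
    IsExpansionZero c q (toLS Y) (toLS Z) ↔
      (AllC Bdd Y ∧ AllC Bdd Z ∧ IsPSSolution c 1 PowerSeries.X q Y Z) ∧
      PowerSeries.coeff 0 (psRho c 1 PowerSeries.X q Y Z) = c.zeroth := by
  rw [IsExpansionZero, isFormalSolution_one_iff bdd_zero, ← lamCoeff_rho_one]
  rfl

theorem isExpansionInfty_iff {c : Chart} {q : Potential Fn} {Y Z : PowerSeries Fn} :
    IsExpansionInfty c q (toLS Y) (toLS Z) ↔
      (AllC Smooth Y ∧ AllC Smooth Z ∧ IsPSSolution c PowerSeries.X 1 q Y Z) ∧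
      PowerSeries.coeff 0 (psRho c PowerSeries.X 1 q Y Z) = rho0 q := by
  rw [IsExpansionInfty, isFormalSolution_neg_one_iff smooth_zero, ← lamCoeff_rho_neg_one]
  simp

theorem IsFormalSolution.exists_ps {c : Chart} {s : ℤ} {P : Fn → Prop} {q : Potential Fn}
    {y z : Fn⸨X⸩} (h : IsFormalSolution c s P q y z) : ∃ Y Z, toLS Y = y ∧ toLS Z = z := by
  obtain ⟨Y, hY⟩ := exists_toLS h.neg_fst
  obtain ⟨Z, hZ⟩ := exists_toLS h.neg_snd
  exact ⟨Y, Z, hY, hZ⟩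

theorem unique_expansionZero {c : Chart} {q : Potential Fn} {y z y' z' : Fn⸨X⸩}
    (h : IsExpansionZero c q y z) (h' : IsExpansionZero c q y' z') : y = y' ∧ z = z' := by
  obtain ⟨Y, Z, rfl, rfl⟩ := h.1.exists_ps
  obtain ⟨Y', Z', rfl, rfl⟩ := h'.1.exists_ps
  rw [isExpansionZero_iff] at h h'
  obtain ⟨rfl, rfl⟩ := unique_psSolution_zero h.1.1 h.1.2.1 h'.1.1 h'.1.2.1 h.1.2.2 h'.1.2.2
    h.2 h'.2
  exact ⟨rfl, rfl⟩

theorem unique_expansionInfty {c : Chart} {q : Potential Fn} (hq : q.All Smooth)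
    (hn : Nondegenerate c q) {y z y' z' : Fn⸨X⸩}
    (h : IsExpansionInfty c q y z) (h' : IsExpansionInfty c q y' z') : y = y' ∧ z = z' := by
  obtain ⟨Y, Z, rfl, rfl⟩ := h.1.exists_ps
  obtain ⟨Y', Z', rfl, rfl⟩ := h'.1.exists_ps
  rw [isExpansionInfty_iff] at h h'
  obtain ⟨rfl, rfl⟩ := unique_psSolution_infty hq hn h.1.1 h.1.2.1 h'.1.1 h'.1.2.1 h.1.2.2
    h'.1.2.2 h.2 h'.2
  exact ⟨rfl, rfl⟩

theorem bdd_base (c : Chart) : Bdd c.base₁ ∧ Bdd c.base₂ := by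
  cases c
  exacts [⟨bdd_zero, bdd_zero⟩, ⟨bdd_zero, bdd_one⟩, ⟨bdd_one, bdd_zero⟩]

theorem exists_expansionZero {P : Fn → Prop} (hP : ResolventClass P) (c : Chart)
    {q : Potential Fn} (hq : q.All P) :
    ∃ S T, AllC P S ∧ AllC P T ∧ IsExpansionZero c q (toLS (.C c.base₁ + .X * S))
      (toLS (.C c.base₂ + .X * T)) := by
  obtain ⟨S, T, hS, hT, h⟩ := exists_psSolution_zero hP c hq
  have hr := resolventClass_bdd.rngClass
  have hs : ∀ f, P f → Bdd f := fun f hf => hP.bdd hf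
  refine ⟨S, T, hS, hT, isExpansionZero_iff.2 ⟨⟨?_, ?_, h⟩, coeff_zero_psRho_base c q S T⟩⟩
  · exact hr.allC_add (hr.allC_C (bdd_base c).1) (hr.allC_X_mul (hS.mono hs))
  · exact hr.allC_add (hr.allC_C (bdd_base c).2) (hr.allC_X_mul (hT.mono hs))

theorem existsUnique_expansionZero (c : Chart) {q : Potential Fn} (hq : q.All Bdd) :
    ∃! yz : LaurentSeries Fn × LaurentSeries Fn, IsExpansionZero c q yz.1 yz.2 := by
  obtain ⟨S, T, -, -, h⟩ := exists_expansionZero resolventClass_bdd c hq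
  refine ⟨(_, _), h, fun yz h' => ?_⟩
  obtain ⟨h1, h2⟩ := unique_expansionZero h' h
  exact Prod.ext h1 h2

theorem existsUnique_expansionInfty {c : Chart} {q : Potential Fn} (hq : q.All Smooth)
    (hn : Nondegenerate c q) :
    ∃! yz : LaurentSeries Fn × LaurentSeries Fn, IsExpansionInfty c q yz.1 yz.2 := by
  obtain ⟨Y, Z, hY, hZ, h, h0⟩ := exists_psSolution_infty fieldClass_smooth hn hq
  refine ⟨(toLS Y, toLS Z), isExpansionInfty_iff.2 ⟨⟨hY, hZ, h⟩, h0⟩, fun yz h' => ?_⟩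
  obtain ⟨h1, h2⟩ := unique_expansionInfty hq hn h' (isExpansionInfty_iff.2 ⟨⟨hY, hZ, h⟩, h0⟩)
  exact Prod.ext h1 h2

theorem Potential.All.mono {A : Type*} {P Q : A → Prop} (h : ∀ a, P a → Q a) {q : Potential A}
    (hq : q.All P) : q.All Q := ⟨h _ hq.1, h _ hq.2.1, h _ hq.2.2.1, h _ hq.2.2.2⟩

theorem coeff_zero_C_add_X_mul (f : Fn) (S : PowerSeries Fn) :
    (toLS (.C f + .X * S)).coeff 0 = f := by
  have := coeff_toLS_natCast (.C f + .X * S) 0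
  simpa using this

theorem coeff_succ_C_add_X_mul (f : Fn) (S : PowerSeries Fn) {j : ℤ} (hj : 1 ≤ j) :
    ∃ n, (toLS (.C f + .X * S)).coeff j = PowerSeries.coeff n S := by
  obtain ⟨n, rfl⟩ : ∃ n : ℕ, j = ((n + 1 : ℕ) : ℤ) := ⟨(j - 1).toNat, by omega⟩
  refine ⟨n, ?_⟩
  rw [coeff_toLS_natCast, map_add, PowerSeries.coeff_succ_X_mul, PowerSeries.coeff_C]
  simp

theorem IsExpansionZero.coeff_zero {c : Chart} {q : Potential Fn} (hq : q.All Bdd)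
    {y z : Fn⸨X⸩} (h : IsExpansionZero c q y z) :
    y.coeff 0 = c.base₁ ∧ z.coeff 0 = c.base₂ := by
  obtain ⟨S, T, -, -, h'⟩ := exists_expansionZero resolventClass_bdd c hq
  obtain ⟨rfl, rfl⟩ := unique_expansionZero h h'
  exact ⟨coeff_zero_C_add_X_mul _ _, coeff_zero_C_add_X_mul _ _⟩

/-- The expansion constructed inside `P` is bounded, so uniqueness identifies it with the given one.
Index `0` is excluded because a base value may be the constant `1`, which is not rapidly decreasing.
-/
theorem IsExpansionZero.coeff_class {P : Fn → Prop} (hP : ResolventClass P) {c : Chart}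
    {q : Potential Fn} (hq : q.All P) {y z : Fn⸨X⸩} (h : IsExpansionZero c q y z) {j : ℤ}
    (hj : 1 ≤ j) : P (y.coeff j) ∧ P (z.coeff j) := by
  obtain ⟨S, T, hS, hT, h'⟩ := exists_expansionZero hP c hq
  obtain ⟨rfl, rfl⟩ := unique_expansionZero h h'
  obtain ⟨n, hn⟩ := coeff_succ_C_add_X_mul c.base₁ S hj
  obtain ⟨k, hk⟩ := coeff_succ_C_add_X_mul c.base₂ T hj
  rw [hn, hk]
  exact ⟨hS n, hT k⟩

/-- The same comparison by uniqueness; here the leading coefficients lie in `P` too, so every index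
is allowed. -/
theorem IsExpansionInfty.coeff_class {P : Fn → Prop} (hP : FieldClass P) {c : Chart}
    {q : Potential Fn} (hn : Nondegenerate c q) (hq : q.All P) {y z : Fn⸨X⸩}
    (h : IsExpansionInfty c q y z) (j : ℤ) : P (y.coeff j) ∧ P (z.coeff j) := by
  have hs : ∀ f, P f → Smooth f := fun f hf => hP.smooth hf
  obtain ⟨Y, Z, hY, hZ, hYZ, h0⟩ := exists_psSolution_infty hP hn hq
  obtain ⟨rfl, rfl⟩ := unique_expansionInfty (hq.mono hs) hn h
    (isExpansionInfty_iff.2 ⟨⟨hY.mono hs, hZ.mono hs, hYZ⟩, h0⟩)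
  exact ⟨(allC_iff_coeff_toLS hP.zero).1 hY j, (allC_iff_coeff_toLS hP.zero).1 hZ j⟩

/-! ### Derivatives of formal Laurent series -/

/-- Operators that act as derivations on smooth functions. -/
structure SmoothDerivation (D : ZeroHom Fn Fn) : Prop where
  add : ∀ {f g}, Smooth f → Smooth g → D (f + g) = D f + D g
  neg : ∀ f, D (-f) = -D f
  mul : ∀ {f g}, Smooth f → Smooth g → D (f * g) = D f * g + f * D g
  one : D 1 = 0
  smooth : ∀ {f}, Smooth f → Smooth (D f)

theorem smoothDerivation_dX : SmoothDerivation dX := ⟨dX_add, dX_neg, dX_mul, dX_one, Smooth.dX⟩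

theorem smoothDerivation_dT : SmoothDerivation dT := ⟨dT_add, dT_neg, dT_mul, dT_one, Smooth.dT⟩

/-- All coefficients of a formal Laurent series have the property `P`. -/
def AllL (P : Fn → Prop) (f : Fn⸨X⸩) : Prop := ∀ j, P (f.coeff j)

namespace RngClass

theorem allL_add {P : Fn → Prop} (hP : RngClass P) {f g : Fn⸨X⸩} (hf : AllL P f)
    (hg : AllL P g) : AllL P (f + g) := fun j => hP.add (hf j) (hg j)

theorem allL_sub {P : Fn → Prop} (hP : RngClass P) {f g : Fn⸨X⸩} (hf : AllL P f)
    (hg : AllL P g) : AllL P (f - g) := fun j => hP.sub (hf j) (hg j)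

theorem allL_mul {P : Fn → Prop} (hP : RngClass P) {f g : Fn⸨X⸩} (hf : AllL P f)
    (hg : AllL P g) : AllL P (f * g) := fun j => by
  rw [HahnSeries.coeff_mul]
  exact hP.sum fun p _ => hP.mul (hf p.1) (hg p.2)

theorem allL_single {P : Fn → Prop} (hP : RngClass P) (k : ℤ) {f : Fn} (hf : P f) :
    AllL P (HahnSeries.single k f) := fun j => by
  rw [HahnSeries.coeff_single]
  split_ifs
  exacts [hf, hP.zero]

end RngClass

namespace SmoothDerivation

theorem sub {D : ZeroHom Fn Fn} (hD : SmoothDerivation D) {f g : Fn} (hf : Smooth f)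
    (hg : Smooth g) : D (f - g) = D f - D g := by
  rw [sub_eq_add_neg, hD.add hf hg.neg, hD.neg, sub_eq_add_neg]

theorem sum {D : ZeroHom Fn Fn} (hD : SmoothDerivation D) {ι : Type*} {s : Finset ι}
    {f : ι → Fn} (h : ∀ i ∈ s, Smooth (f i)) : D (∑ i ∈ s, f i) = ∑ i ∈ s, D (f i) := by
  classical
  induction s using Finset.induction_on with
  | empty => simp
  | insert i s hi ih =>
    rw [Finset.forall_mem_insert] at h
    rw [Finset.sum_insert hi, Finset.sum_insert hi, hD.add h.1 (Smooth.sum h.2), ih h.2]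

theorem map_add {D : ZeroHom Fn Fn} (hD : SmoothDerivation D) {f g : Fn⸨X⸩}
    (hf : AllL Smooth f) (hg : AllL Smooth g) : (f + g).map D = f.map D + g.map D := by
  ext1
  funext j
  exact hD.add (hf j) (hg j)

theorem map_sub {D : ZeroHom Fn Fn} (hD : SmoothDerivation D) {f g : Fn⸨X⸩}
    (hf : AllL Smooth f) (hg : AllL Smooth g) : (f - g).map D = f.map D - g.map D := by
  ext1
  funext j
  exact hD.sub (hf j) (hg j)

theorem map_mul {D : ZeroHom Fn Fn} (hD : SmoothDerivation D) {f g : Fn⸨X⸩}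
    (hf : AllL Smooth f) (hg : AllL Smooth g) :
    (f * g).map D = f.map D * g + f * g.map D := by
  ext1
  funext j
  -- Differentiation can shrink the support of a series. The inclusions allow all three products to
  -- be summed over the same index set, the one belonging to `f` and `g`.
  have h1 : (f.map D).support ⊆ f.support := fun i hi h => hi (by simp [h])
  have h2 : (g.map D).support ⊆ g.support := fun i hi h => hi (by simp [h])
  rw [HahnSeries.map_coeff, HahnSeries.coeff_add, HahnSeries.coeff_mul,
    HahnSeries.coeff_mul_left' f.isPWO_support h1, HahnSeries.coeff_mul_right' g.isPWO_support h2,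
    hD.sum fun p _ => (hf p.1).mul (hg p.2), ← Finset.sum_add_distrib]
  exact Finset.sum_congr rfl fun p _ => hD.mul (hf p.1) (hg p.2)

theorem map_one {D : ZeroHom Fn Fn} (hD : SmoothDerivation D) :
    (1 : Fn⸨X⸩).map D = 0 := by
  ext1
  funext j
  rw [HahnSeries.map_coeff, HahnSeries.coeff_one, HahnSeries.coeff_zero]
  split_ifs
  exacts [hD.one, map_zero D]

theorem map_smooth {D : ZeroHom Fn Fn} (hD : SmoothDerivation D) {f : Fn⸨X⸩}
    (hf : AllL Smooth f) : AllL Smooth (f.map D) := fun j => hD.smooth (hf j)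

theorem map_mulVec {D : ZeroHom Fn Fn} (hD : SmoothDerivation D)
    {M : Matrix (Fin 3) (Fin 3) Fn⸨X⸩} {v : Fin 3 → Fn⸨X⸩} (hM : ∀ i j, AllL Smooth (M i j))
    (hv : ∀ i, AllL Smooth (v i)) :
    (fun i => (M.mulVec v i).map D) = (M.map fun f => f.map D).mulVec v +
      M.mulVec (fun i => (v i).map D) := by
  have hs : ∀ i j, AllL Smooth (M i j * v j) := fun i j => rngClass_smooth.allL_mul (hM i j) (hv j)
  funext i
  simp only [Matrix.mulVec, dotProduct, Fin.sum_univ_three, Pi.add_apply, Matrix.map_apply]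
  rw [hD.map_add (rngClass_smooth.allL_add (hs i 0) (hs i 1)) (hs i 2),
    hD.map_add (hs i 0) (hs i 1), hD.map_mul (hM i 0) (hv 0), hD.map_mul (hM i 1) (hv 1),
    hD.map_mul (hM i 2) (hv 2)]
  ring

end SmoothDerivation

/-! ### Expansion of the zero-curvature equation -/

/-- Expansion of Laurent polynomials, as a ring homomorphism. -/
def expandHom (s : ℤ) : Fn[T;T⁻¹] →+* Fn⸨X⸩ :=
  AddMonoidAlgebra.liftNCRingHom HahnSeries.C
    { toFun := fun j => HahnSeries.single (s * j.toAdd) 1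
      map_one' := by simp
      map_mul' := fun a b => by
        rw [HahnSeries.single_mul_single, toAdd_mul, mul_add, one_mul] }
    (fun _ _ => Commute.all _ _)

theorem expand_single (s j : ℤ) (f : Fn) :
    expand s (.single j f) = HahnSeries.single (s * j) f :=
  Finsupp.sum_single_index (by simp)

theorem expand_add (s : ℤ) (p p' : Fn[T;T⁻¹]) : expand s (p + p') = expand s p + expand s p' :=
  Finsupp.sum_add_index' (by simp) (by simp)

theorem expand_eq_expandHom (s : ℤ) (p : Fn[T;T⁻¹]) : expand s p = expandHom s p := by
  induction p using AddMonoidAlgebra.induction_linear with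
  | zero => simp [expand]
  | add p p' h h' => rw [expand_add, h, h', map_add]
  | single j f =>
    rw [expand_single, expandHom, AddMonoidAlgebra.liftNCRingHom_single]
    change _ = HahnSeries.single 0 f * HahnSeries.single (s * j) 1
    rw [HahnSeries.single_mul_single, zero_add, mul_one]

theorem coeff_expand {s : ℤ} (hs : s * s = 1) (p : Fn[T;T⁻¹]) (k : ℤ) :
    (expand s p).coeff k = p.coeff (s * k) := by
  induction p using AddMonoidAlgebra.induction_linear with
  | zero => simp [expand]
  | add p p' h h' => rw [expand_add, HahnSeries.coeff_add, h, h']; rfl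
  | single j f =>
    rw [expand_single, HahnSeries.coeff_single]
    change _ = Finsupp.single j f (s * k)
    rw [Finsupp.single_apply]
    have : k = s * j ↔ j = s * k :=
      ⟨fun h => by rw [h, ← mul_assoc, hs, one_mul], fun h => by rw [h, ← mul_assoc, hs, one_mul]⟩
    simp only [this]

theorem expand_mapCoeff {s : ℤ} (hs : s * s = 1) (D : ZeroHom Fn Fn) (p : Fn[T;T⁻¹]) :
    expand s (mapCoeff D p) = (expand s p).map D := by
  ext1
  funext k
  rw [coeff_expand hs, HahnSeries.map_coeff, coeff_expand hs]
  rfl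

/-- The matrix `V`, expanded in powers of `λ ^ s`. -/
def expandMatrix (s : ℤ) (V : LaxMatrix) : Matrix (Fin 3) (Fin 3) Fn⸨X⸩ := V.map (expand s)

theorem expandMatrix_eq (s : ℤ) (V : LaxMatrix) :
    expandMatrix s V = (expandHom s).mapMatrix V := by
  ext1 i j
  exact expand_eq_expandHom s _

theorem expandMatrix_laxU (s : ℤ) (q : Potential Fn) :
    expandMatrix s (laxU q) = spectralU (lam s) (series q) := by
  have hC : ∀ f, expandHom s (LaurentPolynomial.C f) = HahnSeries.C f := by
    intro f
    rw [← expand_eq_expandHom]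
    exact (expand_single s 0 f).trans (by rw [mul_zero]; rfl)
  have hT : expandHom s (LaurentPolynomial.T 1) = lam s := by
    rw [← expand_eq_expandHom]
    exact (expand_single s 1 1).trans (by rw [mul_one]; rfl)
  rw [expandMatrix_eq]
  ext1 i j
  have hm : ∀ f, expandHom s (LaurentPolynomial.T 1 * LaurentPolynomial.C f)
      = lam s * HahnSeries.C f := fun f => by rw [map_mul, hT, hC]
  have h0 : expandHom s 0 = 0 := map_zero _
  have h1 : expandHom s 1 = 1 := map_one _
  fin_cases i <;> fin_cases j
  exacts [h0, hm _, h1, hm _, h0, hm _, h1, hm _, h0]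

theorem IsFlow.expandMatrix {q : Potential Fn} {V : LaxMatrix} (h : IsFlow q V) {s : ℤ}
    (hs : s * s = 1) :
    (spectralU (lam s) (series q)).map (fun f => f.map dT)
      - (expandMatrix s V).map (fun f => f.map dX)
      + (spectralU (lam s) (series q) * FourCH.expandMatrix s V
        - FourCH.expandMatrix s V * spectralU (lam s) (series q)) = 0 := by
  have h1 := congrArg (expandHom s).mapMatrix h
  rw [map_zero, map_add, map_sub, map_sub, map_mul, map_mul, ← expandMatrix_eq, ← expandMatrix_eq,
    ← expandMatrix_eq, ← expandMatrix_eq, expandMatrix_laxU] at h1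
  rw [← h1, ← expandMatrix_laxU]
  congr 2 <;> ext1 i j <;> exact (expand_mapCoeff hs _ _).symm

theorem allL_expand {P : Fn → Prop} {s : ℤ} (hs : s * s = 1) {V : LaxMatrix} (hV : V.All P)
    (i j : Fin 3) : AllL P (expandMatrix s V i j) := fun k => by
  rw [expandMatrix, Matrix.map_apply, coeff_expand hs]
  exact hV i j _

theorem allL_laxU {P : Fn → Prop} (hP : RngClass P) (h1 : P 1) (s : ℤ) {q : Potential Fn}
    (hq : q.All P) (i j : Fin 3) : AllL P (spectralU (lam s) (series q) i j) := by
  obtain ⟨a, b, c, d⟩ := hq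
  have h0 : AllL P (0 : Fn⸨X⸩) := fun k => hP.zero
  have hone : AllL P (1 : Fn⸨X⸩) := hP.allL_single 0 h1
  have hl : ∀ {f}, P f → AllL P (lam s * HahnSeries.C f) := fun hf =>
    hP.allL_mul (hP.allL_single s h1) (hP.allL_single 0 hf)
  fin_cases i <;> fin_cases j
  exacts [h0, hl a, hone, hl c, h0, hl b, hone, hl d, h0]

/-! ### The evolution of the projective coordinates -/

/-- The vector `Φ` normalized by `φ_den = 1`. -/
def Chart.vec {A : Type*} [One A] (c : Chart) (y z : A) : Fin 3 → A :=
  match c with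
  | .I => ![y, 1, z]
  | .II => ![1, y, z]
  | .III => ![y, z, 1]

theorem density_eq_mulVec {A : Type*} [CommRing A] (c : Chart) (l : A) (q : Potential A)
    (y z : A) : density c l q y z = (spectralU l q).mulVec (c.vec y z) c.den := by
  cases c <;> simp [density, spectralU, Chart.vec, Chart.den, Matrix.mulVec, dotProduct,
    Fin.sum_univ_three]

theorem flux_eq_mulVec {A : Type*} [CommRing A] (c : Chart) (V : Matrix (Fin 3) (Fin 3) A)
    (y z : A) : flux c V y z = V.mulVec (c.vec y z) c.den := by
  cases c <;> simp [flux, Chart.vec, Chart.den, Matrix.mulVec, dotProduct,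
    Fin.sum_univ_three]

theorem riccatiFst_eq_mulVec {A : Type*} [CommRing A] (c : Chart) (l : A) (q : Potential A)
    (y z : A) : riccatiFst c l q y z =
      (spectralU l q).mulVec (c.vec y z) c.fst - density c l q y z * y := by
  cases c <;> simp [riccatiFst, spectralU, Chart.vec, Chart.fst, Matrix.mulVec, dotProduct,
    Fin.sum_univ_three] <;> ring

theorem riccatiSnd_eq_mulVec {A : Type*} [CommRing A] (c : Chart) (l : A) (q : Potential A)
    (y z : A) : riccatiSnd c l q y z =
      (spectralU l q).mulVec (c.vec y z) c.snd - density c l q y z * z := by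
  cases c <;> simp [riccatiSnd, spectralU, Chart.vec, Chart.snd, Matrix.mulVec, dotProduct,
    Fin.sum_univ_three] <;> ring

/-- This puts the three Riccati systems into the single vector equation `Φ_x = UΦ - ρΦ` for the
normalized `Φ`, so that the zero-curvature computation need not distinguish charts. -/
theorem riccati_eq_mulVec {A : Type*} [CommRing A] (c : Chart) (l : A) (q : Potential A)
    (y z : A) : (spectralU l q).mulVec (c.vec y z) - density c l q y z • c.vec y z =
      (match c with
        | .I => ![riccatiFst .I l q y z, 0, riccatiSnd .I l q y z]
        | .II => ![0, riccatiFst .II l q y z, riccatiSnd .II l q y z]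
        | .III => ![riccatiFst .III l q y z, riccatiSnd .III l q y z, 0]) := by
  funext i
  cases c <;> fin_cases i <;>
    simp [riccatiFst, riccatiSnd, density, spectralU, Chart.vec] <;> ring

/-- The derivative of a vector of formal Laurent series. -/
def mapVec (D : ZeroHom Fn Fn) (v : Fin 3 → Fn⸨X⸩) : Fin 3 → Fn⸨X⸩ := fun i => (v i).map D

theorem Chart.vec_den {A : Type*} [One A] (c : Chart) (y z : A) : c.vec y z c.den = 1 := by
  cases c <;> rfl

theorem allL_vec {P : Fn → Prop} (hP : RngClass P) (h1 : P 1) {c : Chart} {y z : Fn⸨X⸩}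
    (hy : AllL P y) (hz : AllL P z) (i : Fin 3) : AllL P (c.vec y z i) := by
  have h1 : AllL P (1 : Fn⸨X⸩) := hP.allL_single 0 h1
  cases c <;> fin_cases i <;> assumption

theorem RngClass.allL_mulVec {P : Fn → Prop} (hP : RngClass P)
    {M : Matrix (Fin 3) (Fin 3) Fn⸨X⸩} {v : Fin 3 → Fn⸨X⸩} (hM : ∀ i j, AllL P (M i j))
    (hv : ∀ i, AllL P (v i)) (i : Fin 3) : AllL P (M.mulVec v i) := by
  simp only [Matrix.mulVec, dotProduct, Fin.sum_univ_three]
  exact hP.allL_add (hP.allL_add (hP.allL_mul (hM i 0) (hv 0)) (hP.allL_mul (hM i 1) (hv 1)))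
    (hP.allL_mul (hM i 2) (hv 2))

theorem mapVec_dX_vec {c : Chart} {s : ℤ} {P : Fn → Prop} {q : Potential Fn} {y z : Fn⸨X⸩}
    (h : IsFormalSolution c s P q y z) :
    mapVec dX (c.vec y z) = (spectralU (lam s) (series q)).mulVec (c.vec y z)
      - rho c s q y z • c.vec y z := by
  have h1 : (1 : Fn⸨X⸩).map dX = 0 := smoothDerivation_dX.map_one
  rw [rho, riccati_eq_mulVec]
  funext i
  cases c <;> fin_cases i
  exacts [h.eq_fst, h1, h.eq_snd, h1, h.eq_fst, h.eq_snd, h.eq_fst, h.eq_snd, h1]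

/-- The defect of the equation `Φ_t = V Φ` for the projective coordinates. -/
def defect (c : Chart) (s : ℤ) (V : LaxMatrix) (y z : Fn⸨X⸩) : Fin 3 → Fn⸨X⸩ :=
  mapVec dT (c.vec y z) - (expandMatrix s V).mulVec (c.vec y z)
    + current c s V y z • c.vec y z

theorem defect_den (c : Chart) (s : ℤ) (V : LaxMatrix) (y z : Fn⸨X⸩) :
    defect c s V y z c.den = 0 := by
  have h1 : (1 : Fn⸨X⸩).map dT = 0 := smoothDerivation_dT.map_one
  simp only [defect, Pi.add_apply, Pi.sub_apply, Pi.smul_apply, mapVec, Chart.vec_den, h1, current,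
    flux_eq_mulVec]
  simp [expandMatrix]

section Defect

variable {c : Chart} {s : ℤ} {q : Potential Fn} {V : LaxMatrix} {y z : Fn⸨X⸩}

theorem mapVec_add {D : ZeroHom Fn Fn} (hD : SmoothDerivation D) {v w : Fin 3 → Fn⸨X⸩}
    (hv : ∀ i, AllL Smooth (v i)) (hw : ∀ i, AllL Smooth (w i)) :
    mapVec D (v + w) = mapVec D v + mapVec D w := funext fun i => hD.map_add (hv i) (hw i)

theorem mapVec_sub {D : ZeroHom Fn Fn} (hD : SmoothDerivation D) {v w : Fin 3 → Fn⸨X⸩}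
    (hv : ∀ i, AllL Smooth (v i)) (hw : ∀ i, AllL Smooth (w i)) :
    mapVec D (v - w) = mapVec D v - mapVec D w := funext fun i => hD.map_sub (hv i) (hw i)

theorem mapVec_smul {D : ZeroHom Fn Fn} (hD : SmoothDerivation D) {f : Fn⸨X⸩}
    {v : Fin 3 → Fn⸨X⸩} (hf : AllL Smooth f) (hv : ∀ i, AllL Smooth (v i)) :
    mapVec D (f • v) = f.map D • v + f • mapVec D v := funext fun i => hD.map_mul hf (hv i)

theorem mapVec_dX_dT {v : Fin 3 → Fn⸨X⸩} (hv : ∀ i, AllL Smooth (v i)) :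
    mapVec dX (mapVec dT v) = mapVec dT (mapVec dX v) := by
  funext i
  ext1
  funext j
  exact dX_dT (hv i j)

/-- Differentiate `w = Φ_t - VΦ + JΦ` in `x`, insert `Φ_x = UΦ - ρΦ`, and replace `U_t - V_x` by `VU
- UV`. All inhomogeneous terms combine into `-(ρ_t - J_x)Φ`, and the entry `c.den`, where `w`
vanishes and `Φ` is `1`, identifies `ρ_t - J_x`. Thus failure of the conservation law is itself
linear in `w`. -/
theorem mapVec_dX_defect (hs : s * s = 1) (hq : q.All Smooth) (hV : V.All Smooth)
    (hflow : IsFlow q V) (h : IsFormalSolution c s Smooth q y z) :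
    mapVec dX (defect c s V y z) = (spectralU (lam s) (series q)).mulVec (defect c s V y z)
        - rho c s q y z • defect c s V y z
        - (spectralU (lam s) (series q)).mulVec (defect c s V y z) c.den • c.vec y z ∧
      (rho c s q y z).map dT - (current c s V y z).map dX =
        (spectralU (lam s) (series q)).mulVec (defect c s V y z) c.den := by
  have hZ := hflow.expandMatrix hs
  have hUs := allL_laxU rngClass_smooth smooth_one s hq
  have hVs := allL_expand hs hV
  have hΦs := allL_vec rngClass_smooth smooth_one h.coeff_fst h.coeff_snd (c := c)
  have hΦx := mapVec_dX_vec h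
  have hρ : rho c s q y z = _ := density_eq_mulVec c _ _ y z
  have hJ : current c s V y z = (expandMatrix s V).mulVec (c.vec y z) c.den :=
    flux_eq_mulVec c _ y z
  have hw : defect c s V y z = mapVec dT (c.vec y z) - (expandMatrix s V).mulVec (c.vec y z)
    + current c s V y z • c.vec y z := rfl
  set U := spectralU (lam s) (series q)
  set W := expandMatrix s V
  set Φ := c.vec y z
  set ρ := rho c s q y z
  set J := current c s V y z
  set w := defect c s V y z
  have hUΦs := rngClass_smooth.allL_mulVec hUs hΦs
  have hWΦs := rngClass_smooth.allL_mulVec hVs hΦs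
  have hρs : AllL Smooth ρ := hρ ▸ hUΦs c.den
  have hJs : AllL Smooth J := hJ ▸ hWΦs c.den
  have hΦts : ∀ i, AllL Smooth (mapVec dT Φ i) := fun i => smoothDerivation_dT.map_smooth (hΦs i)
  have hρΦs : ∀ i, AllL Smooth ((ρ • Φ) i) := fun i => rngClass_smooth.allL_mul hρs (hΦs i)
  have hJΦs : ∀ i, AllL Smooth ((J • Φ) i) := fun i => rngClass_smooth.allL_mul hJs (hΦs i)
  have eU : mapVec dT (U.mulVec Φ) = (U.map fun f => f.map dT).mulVec Φ
      + U.mulVec (mapVec dT Φ) := smoothDerivation_dT.map_mulVec hUs hΦs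
  have eW : mapVec dX (W.mulVec Φ) = (W.map fun f => f.map dX).mulVec Φ
      + W.mulVec (mapVec dX Φ) := smoothDerivation_dX.map_mulVec hVs hΦs
  -- The zero-curvature equation enters only here, applied to the vector `Φ`.
  have hZ' : (U.map fun f => f.map dT).mulVec Φ - (W.map fun f => f.map dX).mulVec Φ
      + (U.mulVec (W.mulVec Φ) - W.mulVec (U.mulVec Φ)) = 0 := by
    rw [Matrix.mulVec_mulVec, Matrix.mulVec_mulVec, ← Matrix.sub_mulVec, ← Matrix.sub_mulVec,
      ← Matrix.add_mulVec, hZ, Matrix.zero_mulVec]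
  have hUw : U.mulVec w = U.mulVec (mapVec dT Φ) - U.mulVec (W.mulVec Φ) + J • U.mulVec Φ := by
    rw [hw, Matrix.mulVec_add, Matrix.mulVec_sub, Matrix.mulVec_smul]
  have hWx : W.mulVec (mapVec dX Φ) = W.mulVec (U.mulVec Φ) - ρ • W.mulVec Φ := by
    rw [hΦx, Matrix.mulVec_sub, Matrix.mulVec_smul]
  have hcons : ρ.map dT - J.map dX = U.mulVec w c.den := by
    have h1 : ρ.map dT = mapVec dT (U.mulVec Φ) c.den := by rw [hρ]; rfl
    have h2 : J.map dX = mapVec dX (W.mulVec Φ) c.den := by rw [hJ]; rfl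
    have h3 := congrFun hZ' c.den
    rw [h1, h2, eU, eW, hWx, hUw]
    simp only [Pi.add_apply, Pi.sub_apply, Pi.smul_apply, smul_eq_mul, Pi.zero_apply] at h3 ⊢
    rw [← hρ, ← hJ]
    linear_combination h3
  refine ⟨?_, hcons⟩
  have hds : ∀ i, AllL Smooth ((mapVec dT Φ - W.mulVec Φ) i) := fun i =>
    rngClass_smooth.allL_sub (hΦts i) (hWΦs i)
  -- The `x`- and `t`-derivatives of `Φ` are interchanged, so that the equation for `Φ_x` can be
  -- differentiated in `t`.
  have hwx : mapVec dX w = mapVec dT (U.mulVec Φ - ρ • Φ) - mapVec dX (W.mulVec Φ)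
      + (J.map dX • Φ + J • mapVec dX Φ) := by
    rw [← hΦx, ← mapVec_dX_dT hΦs, ← mapVec_smul smoothDerivation_dX hJs hΦs,
      ← mapVec_sub smoothDerivation_dX hΦts hWΦs, ← mapVec_add smoothDerivation_dX hds hJΦs, hw]
  rw [hwx, mapVec_sub smoothDerivation_dT hUΦs hρΦs, mapVec_smul smoothDerivation_dT hρs hΦs, eU,
    eW, hWx, hΦx, ← hcons, hUw]
  funext i
  have h3 := congrFun hZ' i
  have h4 := congrFun hw i
  simp only [Pi.add_apply, Pi.sub_apply, Pi.smul_apply, smul_eq_mul, Pi.zero_apply] at h3 h4 ⊢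
  rw [h4]
  linear_combination h3

end Defect

/-! ### Vanishing of the defect -/

/-- All coefficients of index less than `k` vanish. -/
def VanishBelow (k : ℤ) (f : Fn⸨X⸩) : Prop := ∀ j < k, f.coeff j = 0

namespace VanishBelow

variable {k l : ℤ} {f g : Fn⸨X⸩}

theorem coeff_mul (hf : VanishBelow k f) (hg : VanishBelow l g) :
    (f * g).coeff (k + l) = f.coeff k * g.coeff l := by
  rw [HahnSeries.coeff_mul]
  refine Finset.sum_eq_single (k, l) ?_ ?_ |>.trans rfl
  · rintro ⟨i, j⟩ hij hne
    have h1 : i + j = k + l := (Finset.mem_antidiagonal.1 hij).2.2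
    rcases lt_trichotomy i k with h | h | h
    · rw [hf i h, zero_mul]
    · exact absurd (Prod.ext h (by simp only; omega)) hne
    · rw [hg j (by omega), mul_zero]
  · intro h
    by_contra hne
    refine h (Finset.mem_antidiagonal.2 ⟨?_, ?_, rfl⟩)
    · exact fun h0 => hne (by rw [h0, zero_mul])
    · exact fun h0 => hne (by rw [h0, mul_zero])

theorem mul (hf : VanishBelow k f) (hg : VanishBelow l g) : VanishBelow (k + l) (f * g) := by
  intro j hj
  rw [HahnSeries.coeff_mul]
  refine Finset.sum_eq_zero ?_
  rintro ⟨a, b⟩ hab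
  have h1 : a + b = j := (Finset.mem_antidiagonal.1 hab).2.2
  rcases lt_or_ge a k with h | h
  · rw [hf a h, zero_mul]
  · rw [hg b (by omega), mul_zero]

theorem add (hf : VanishBelow k f) (hg : VanishBelow k g) : VanishBelow k (f + g) := by
  intro j hj
  rw [HahnSeries.coeff_add, hf j hj, hg j hj, add_zero]

theorem zero_mul (hf : VanishBelow 0 f) (hg : VanishBelow k g) : VanishBelow k (f * g) := by
  simpa using hf.mul hg

theorem coeff_zero_mul (hf : VanishBelow 0 f) (hg : VanishBelow k g) :
    (f * g).coeff k = f.coeff 0 * g.coeff k := by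
  simpa using hf.coeff_mul hg

end VanishBelow

theorem vanishBelow_C (f : Fn) : VanishBelow 0 (HahnSeries.C f) := fun _ hj =>
  HahnSeries.coeff_single_of_ne hj.ne

theorem coeff_X_mul {k : ℤ} {f : Fn⸨X⸩} (hf : VanishBelow k f) :
    (toLS PowerSeries.X * f).coeff k = 0 := by
  have h := coeff_toLS_X_mul f (k - 1)
  rw [sub_add_cancel] at h
  rw [h]
  exact hf _ (by omega)

theorem vanishBelow_X_mul {k : ℤ} {f : Fn⸨X⸩} (hf : VanishBelow k f) :
    VanishBelow k (toLS PowerSeries.X * f) := by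
  intro j hj
  have h := coeff_toLS_X_mul f (j - 1)
  rw [sub_add_cancel] at h
  rw [h]
  exact hf _ (by omega)

/-- Each Laurent series has only finitely many terms with negative exponent, so the induction can
start below the orders of both. The default order of the zero series does no harm, since its
coefficients vanish anyway. -/
theorem eq_zero_of_vanishBelow_step {f g : Fn⸨X⸩}
    (h : ∀ k, VanishBelow k f → VanishBelow k g → f.coeff k = 0 ∧ g.coeff k = 0) :
    f = 0 ∧ g = 0 := by
  have key : ∀ n : ℕ, VanishBelow (min f.order g.order + n) f ∧
      VanishBelow (min f.order g.order + n) g := by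
    intro n
    induction n with
    | zero =>
      constructor <;> intro j hj <;> apply HahnSeries.coeff_eq_zero_of_lt_order <;> omega
    | succ n ih =>
      have h1 := h _ ih.1 ih.2
      constructor
      · intro j hj
        rcases (show j < min f.order g.order + n ∨ j = min f.order g.order + n by omega) with h | h
        exacts [ih.1 j h, h ▸ h1.1]
      · intro j hj
        rcases (show j < min f.order g.order + n ∨ j = min f.order g.order + n by omega) with h | h
        exacts [ih.2 j h, h ▸ h1.2]
  constructor <;> ext1 <;> funext j
  · exact (key (j - min f.order g.order + 1).toNat).1 j (by omega)
  · exact (key (j - min f.order g.order + 1).toNat).2 j (by omega)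

section Linearized

variable {A : Type*} [CommRing A]

/-- The linearization of the homogenized density. -/
def linDensity (c : Chart) (e l : A) (q : Potential A) (p r : A) : A :=
  match c with
  | .I => l * (q.n1 * p + q.m2 * r)
  | .II => l * (q.m1 * p) + e * r
  | .III => e * p + l * (q.n2 * r)

/-- The linearized homogenized Riccati-type system, first equation. -/
def linFst (c : Chart) (e l : A) (q : Potential A) (R y p r : A) : A :=
  match c with
  | .I => e * r - R * p - y * linDensity .I e l q p r
  | .II => l * (q.m2 * r) - R * p - y * linDensity .II e l q p r
  | .III => l * (q.m1 * r) - R * p - y * linDensity .III e l q p r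

/-- The linearized homogenized Riccati-type system, second equation. -/
def linSnd (c : Chart) (e l : A) (q : Potential A) (R z p r : A) : A :=
  match c with
  | .I => e * p - R * r - z * linDensity .I e l q p r
  | .II => l * (q.n2 * p) - R * r - z * linDensity .II e l q p r
  | .III => l * (q.n1 * p) - R * r - z * linDensity .III e l q p r

theorem linFst_eq_mulVec (c : Chart) (l : A) (q : Potential A) (R y z : A) {w : Fin 3 → A}
    (hw : w c.den = 0) : ((spectralU l q).mulVec w - R • w
        - (spectralU l q).mulVec w c.den • c.vec y z) c.fst =
      linFst c 1 l q R y (w c.fst) (w c.snd) := by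
  simp only [Pi.sub_apply, Pi.smul_apply, smul_eq_mul]
  cases c <;> simp only [Chart.den] at hw <;>
    simp [linFst, linDensity, spectralU, Chart.vec, Chart.fst, Chart.snd, Chart.den, Matrix.mulVec,
      dotProduct, Fin.sum_univ_three, hw] <;> ring

theorem linSnd_eq_mulVec (c : Chart) (l : A) (q : Potential A) (R y z : A) {w : Fin 3 → A}
    (hw : w c.den = 0) : ((spectralU l q).mulVec w - R • w
        - (spectralU l q).mulVec w c.den • c.vec y z) c.snd =
      linSnd c 1 l q R z (w c.fst) (w c.snd) := by
  simp only [Pi.sub_apply, Pi.smul_apply, smul_eq_mul]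
  cases c <;> simp only [Chart.den] at hw <;>
    simp [linSnd, linDensity, spectralU, Chart.vec, Chart.fst, Chart.snd, Chart.den, Matrix.mulVec,
      dotProduct, Fin.sum_univ_three, hw] <;> ring

theorem mul_linFst (c : Chart) (k l : A) (q : Potential A) (R y p r : A) :
    k * linFst c 1 l q R y p r = linFst c k (k * l) q (k * R) y p r := by
  cases c <;> simp only [linFst, linDensity] <;> ring

theorem mul_linSnd (c : Chart) (k l : A) (q : Potential A) (R z p r : A) :
    k * linSnd c 1 l q R z p r = linSnd c k (k * l) q (k * R) z p r := by
  cases c <;> simp only [linSnd, linDensity] <;> ring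

end Linearized

theorem coeff_linDensity_zero (c : Chart) {q : Potential Fn} {p r : Fn⸨X⸩} {k : ℤ}
    (hp : VanishBelow k p) (hr : VanishBelow k r) :
    VanishBelow k (linDensity c 1 (lam 1) (series q) p r) ∧
    (linDensity c 1 (lam 1) (series q) p r).coeff k =
      match c with
      | .I => 0
      | .II => r.coeff k
      | .III => p.coeff k := by
  have hC : ∀ (f : Fn) {g}, VanishBelow k g → VanishBelow k (HahnSeries.C f * g) :=
    fun f _ hg => (vanishBelow_C f).zero_mul hg
  have hV : ∀ {g}, VanishBelow k g → VanishBelow k (lam 1 * g) := fun hg => by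
    rw [lam_one]
    exact vanishBelow_X_mul hg
  have h0 : ∀ {g}, VanishBelow k g → (lam 1 * g).coeff k = 0 := fun hg => by
    rw [lam_one]
    exact coeff_X_mul hg
  cases c
  · have := (hC q.n1 hp).add (hC q.m2 hr)
    exact ⟨hV this, h0 this⟩
  · have := hC q.m1 hp
    simp only [linDensity, one_mul]
    refine ⟨(hV this).add hr, ?_⟩
    rw [HahnSeries.coeff_add]
    exact (congrArg (· + r.coeff k) (h0 this)).trans (zero_add _)
  · have := hC q.n2 hr
    simp only [linDensity, one_mul]
    refine ⟨hp.add (hV this), ?_⟩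
    rw [HahnSeries.coeff_add]
    exact (congrArg (p.coeff k + ·) (h0 this)).trans (add_zero _)

/-- On the lowest coefficients only the values of `R`, `y`, `z` at `λ = 0` act, so the linearized
system reduces to the operator of the recursion for the expansion itself. -/
theorem coeff_lin_zero {c : Chart} {q : Potential Fn} {R y z p r : Fn⸨X⸩} {k : ℤ}
    (hR : VanishBelow 0 R) (hy : VanishBelow 0 y) (hz : VanishBelow 0 z)
    (hR0 : R.coeff 0 = c.zeroth) (hy0 : y.coeff 0 = c.base₁) (hz0 : z.coeff 0 = c.base₂)
    (hp : VanishBelow k p) (hr : VanishBelow k r) :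
    dX (p.coeff k) - (linFst c 1 (lam 1) (series q) R y p r).coeff k
        = linZero₁ c (p.coeff k) (r.coeff k) ∧
      dX (r.coeff k) - (linSnd c 1 (lam 1) (series q) R z p r).coeff k
        = linZero₂ c (p.coeff k) (r.coeff k) := by
  have hC : ∀ (f : Fn) {g}, VanishBelow k g → VanishBelow k (HahnSeries.C f * g) :=
    fun f _ hg => (vanishBelow_C f).zero_mul hg
  have h0 : ∀ (f : Fn) {g}, VanishBelow k g → (lam 1 * (HahnSeries.C f * g)).coeff k = 0 :=
    fun f _ hg => by
      rw [lam_one]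
      exact coeff_X_mul (hC f hg)
  obtain ⟨hd, hd0⟩ := coeff_linDensity_zero c (q := q) hp hr
  have e1 := hR.coeff_zero_mul hp
  have e2 := hR.coeff_zero_mul hr
  have e3 := hy.coeff_zero_mul hd
  have e4 := hz.coeff_zero_mul hd
  rw [hd0] at e3 e4
  rw [hR0] at e1 e2
  rw [hy0] at e3
  rw [hz0] at e4
  cases c
  · simp only [linFst, linSnd, HahnSeries.coeff_sub, e1, e2, e3, e4, linZero₁, linZero₂, one_mul,
      Chart.zeroth, Chart.base₁, Chart.base₂]
    constructor <;> ring
  · simp only [linFst, linSnd, HahnSeries.coeff_sub, e1, e2, e3, e4, linZero₁, linZero₂, one_mul,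
      Chart.zeroth, Chart.base₁, Chart.base₂]
    rw [series, Potential.map, h0 _ hr, h0 _ hp]
    constructor <;> ring
  · simp only [linFst, linSnd, HahnSeries.coeff_sub, e1, e2, e3, e4, linZero₁, linZero₂, one_mul,
      Chart.zeroth, Chart.base₁, Chart.base₂]
    rw [series, Potential.map, h0 _ hr, h0 _ hp]
    constructor <;> ring

theorem coeff_linDensity_infty (c : Chart) {q : Potential Fn} {p r : Fn⸨X⸩} {k : ℤ}
    (hp : VanishBelow k p) (hr : VanishBelow k r) :
    VanishBelow k (linDensity c (toLS PowerSeries.X) 1 (series q) p r) ∧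
    (linDensity c (toLS PowerSeries.X) 1 (series q) p r).coeff k =
      match c with
      | .I => q.n1 * p.coeff k + q.m2 * r.coeff k
      | .II => q.m1 * p.coeff k
      | .III => q.n2 * r.coeff k := by
  have hC : ∀ (f : Fn) {g}, VanishBelow k g → VanishBelow k (HahnSeries.C f * g) :=
    fun f _ hg => (vanishBelow_C f).zero_mul hg
  have hC0 : ∀ (f : Fn) {g}, VanishBelow k g → (HahnSeries.C f * g).coeff k = f * g.coeff k :=
    fun f _ hg => by
      rw [(vanishBelow_C f).coeff_zero_mul hg]
      simp
  cases c
  · simp only [linDensity, one_mul, HahnSeries.coeff_add, series, Potential.map]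
    exact ⟨(hC q.n1 hp).add (hC q.m2 hr), by rw [hC0 _ hp, hC0 _ hr]⟩
  · simp only [linDensity, one_mul, HahnSeries.coeff_add, series, Potential.map]
    exact ⟨(hC q.m1 hp).add (vanishBelow_X_mul hr), by rw [hC0 _ hp, coeff_X_mul hr, add_zero]⟩
  · simp only [linDensity, one_mul, HahnSeries.coeff_add, series, Potential.map]
    exact ⟨(vanishBelow_X_mul hp).add (hC q.n2 hr), by rw [hC0 _ hr, coeff_X_mul hp, zero_add]⟩

/-- After multiplication by `X` the derivative of the lowest coefficient is pushed to the next
order. What remains at order `k` is, up to sign and the leading relations, the invertible matrix of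
the recursion. -/
theorem coeff_lin_infty {c : Chart} {q : Potential Fn} (hn : Nondegenerate c q)
    {R y z p r : Fn⸨X⸩} {k : ℤ}
    (hR : VanishBelow 0 R) (hy : VanishBelow 0 y) (hz : VanishBelow 0 z)
    (hR0 : R.coeff 0 = rho0 q) (hy0 : y.coeff 0 = baseInfty₁ c q)
    (hz0 : z.coeff 0 = baseInfty₂ c q) (hp : VanishBelow k p) (hr : VanishBelow k r)
    (h1 : (linFst c (toLS PowerSeries.X) 1 (series q) R y p r).coeff k = 0)
    (h2 : (linSnd c (toLS PowerSeries.X) 1 (series q) R z p r).coeff k = 0) :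
    p.coeff k = 0 ∧ r.coeff k = 0 := by
  have hC0 : ∀ (f : Fn) {g}, VanishBelow k g → (HahnSeries.C f * g).coeff k = f * g.coeff k :=
    fun f _ hg => by
      rw [(vanishBelow_C f).coeff_zero_mul hg]
      simp
  obtain ⟨hd, hd0⟩ := coeff_linDensity_infty c (q := q) hp hr
  have e1 := hR.coeff_zero_mul hp
  have e2 := hR.coeff_zero_mul hr
  have e3 := hy.coeff_zero_mul hd
  have e4 := hz.coeff_zero_mul hd
  rw [hd0] at e3 e4
  rw [hR0] at e1 e2
  rw [hy0] at e3
  rw [hz0] at e4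
  have hrel := hn.leadingRelations
  refine linInfty_eq_zero hn ?_ ?_
  · cases c
    · simp only [linFst, HahnSeries.coeff_sub, e1, e3, coeff_X_mul hr] at h1
      simp only [linInfty₁]
      linear_combination -h1
    · simp only [linFst, HahnSeries.coeff_sub, e1, e3, one_mul] at h1
      simp only [series, Potential.map, hC0 _ hr] at h1
      simp only [linInfty₁]
      linear_combination h1 + p.coeff k * hrel.1
    · simp only [linFst, HahnSeries.coeff_sub, e1, e3, one_mul] at h1
      simp only [series, Potential.map, hC0 _ hr] at h1
      simp only [linInfty₁]
      linear_combination h1 - r.coeff k * hrel.1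
  · cases c
    · simp only [linSnd, HahnSeries.coeff_sub, e2, e4, coeff_X_mul hp] at h2
      simp only [linInfty₂]
      linear_combination -h2
    · simp only [linSnd, HahnSeries.coeff_sub, e2, e4, one_mul] at h2
      simp only [series, Potential.map, hC0 _ hp] at h2
      simp only [linInfty₂]
      linear_combination h2 - p.coeff k * hrel.2.1
    · simp only [linSnd, HahnSeries.coeff_sub, e2, e4, one_mul] at h2
      simp only [series, Potential.map, hC0 _ hp] at h2
      simp only [linInfty₂]
      linear_combination h2 + r.coeff k * hrel.2.1

/-! ### The local conservation law -/

theorem lamCoeff_map (D : ZeroHom Fn Fn) (s : ℤ) (f : Fn⸨X⸩) (j : ℤ) :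
    lamCoeff s (f.map D) j = D (lamCoeff s f j) := rfl

section Conservation

variable {c : Chart} {q : Potential Fn} {V : LaxMatrix} {y z : Fn⸨X⸩}

theorem eq_zero_of_fst_snd {c : Chart} {w : Fin 3 → Fn⸨X⸩} (h0 : w c.den = 0) (h1 : w c.fst = 0)
    (h2 : w c.snd = 0) : w = 0 := by
  funext i
  cases c <;> fin_cases i <;> assumption

theorem local_law_of_defect {s : ℤ} (hs : s * s = 1) (hq : q.All Smooth)
    (hV : V.All Smooth) (hflow : IsFlow q V) (h : IsFormalSolution c s Smooth q y z)
    (h0 : ∀ w : Fin 3 → Fn⸨X⸩, w = defect c s V y z →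
      (w c.fst).map dX = linFst c 1 (lam s) (series q) (rho c s q y z) y (w c.fst) (w c.snd) →
      (w c.snd).map dX = linSnd c 1 (lam s) (series q) (rho c s q y z) z (w c.fst) (w c.snd) →
      w c.fst = 0 ∧ w c.snd = 0) (j : ℤ) :
    dT (lamCoeff s (rho c s q y z) j) = dX (lamCoeff s (current c s V y z) j) := by
  obtain ⟨h1, h2⟩ := mapVec_dX_defect hs hq hV hflow h
  have hden := defect_den c s V y z
  obtain ⟨e1, e2⟩ := h0 _ rfl
    ((congrFun h1 c.fst).trans (linFst_eq_mulVec c _ _ _ y z hden))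
    ((congrFun h1 c.snd).trans (linSnd_eq_mulVec c _ _ _ y z hden))
  rw [eq_zero_of_fst_snd hden e1 e2, Matrix.mulVec_zero, Pi.zero_apply, sub_eq_zero] at h2
  rw [← lamCoeff_map, ← lamCoeff_map, h2]

theorem IsFormalSolution.mono {s : ℤ} {P Q : Fn → Prop} (hPQ : ∀ f, P f → Q f)
    (h : IsFormalSolution c s P q y z) : IsFormalSolution c s Q q y z :=
  ⟨fun j => hPQ _ (h.coeff_fst j), fun j => hPQ _ (h.coeff_snd j), h.neg_fst, h.neg_snd, h.eq_fst,
    h.eq_snd⟩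

theorem allL_rho {P : Fn → Prop} (hP : RngClass P) (h1 : P 1) (c : Chart) (s : ℤ) (hq : q.All P)
    (hy : AllL P y) (hz : AllL P z) : AllL P (rho c s q y z) := by
  rw [rho, density_eq_mulVec]
  exact hP.allL_mulVec (allL_laxU hP h1 s hq) (allL_vec hP h1 hy hz) _

theorem allL_current {P : Fn → Prop} (hP : RngClass P) (h1 : P 1) (c : Chart) {s : ℤ}
    (hs : s * s = 1) (hV : V.All P) (hy : AllL P y) (hz : AllL P z) :
    AllL P (current c s V y z) := by
  rw [current, flux_eq_mulVec]
  exact hP.allL_mulVec (allL_expand hs hV) (allL_vec hP h1 hy hz) _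

theorem rngClass_bdd : RngClass Bdd := resolventClass_bdd.rngClass

theorem allL_defect {P : Fn → Prop} (hP : RngClass P) (h1 : P 1) (hT : ∀ {f}, P f → P (dT f))
    (c : Chart) {s : ℤ} (hs : s * s = 1) (hV : V.All P) (hy : AllL P y) (hz : AllL P z)
    (i : Fin 3) : AllL P (defect c s V y z i) := by
  have hv := allL_vec hP h1 hy hz (c := c)
  exact hP.allL_add (hP.allL_sub (fun j => hT (hv i j)) (hP.allL_mulVec (allL_expand hs hV) hv i))
    (hP.allL_mul (allL_current hP h1 c hs hV hy hz) (hv i))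

/-- Boundedness of `V` makes the defect bounded, and it is among bounded functions that the
lowest-order equation has only the zero solution. -/
theorem IsExpansionZero.local_law (hq : q.All Bdd) (hV : V.All Bdd) (hflow : IsFlow q V)
    (h : IsExpansionZero c q y z) (j : ℤ) :
    dT (lamCoeff 1 (rho c 1 q y z) j) = dX (lamCoeff 1 (current c 1 V y z) j) := by
  refine local_law_of_defect (one_mul 1) (hq.mono fun _ h => h.smooth)
    (fun i j k => (hV i j k).smooth) hflow (h.1.mono fun _ h => h.smooth) ?_ j
  rintro w hw e1 e2
  have hwb : ∀ i, AllL Bdd (w i) := hw ▸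
    allL_defect rngClass_bdd bdd_one Bdd.dT c (one_mul 1) hV h.1.coeff_fst h.1.coeff_snd
  obtain ⟨hy0, hz0⟩ := h.coeff_zero hq
  have hR : VanishBelow 0 (rho c 1 q y z) := by
    obtain ⟨Y, Z, rfl, rfl⟩ := h.1.exists_ps
    intro j hj
    rw [rho_one, coeff_toLS, if_pos hj]
  refine eq_zero_of_vanishBelow_step fun k hp hr => ?_
  obtain ⟨l1, l2⟩ := coeff_lin_zero hR h.1.neg_fst h.1.neg_snd h.2 hy0 hz0 hp hr
  refine linZero_eq_zero c (hwb _ k) (hwb _ k) (l1.symm.trans ?_) (l2.symm.trans ?_)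
  · rw [← e1]
    exact sub_self _
  · rw [← e2]
    exact sub_self _

theorem IsExpansionInfty.local_law (hn : Nondegenerate c q) (hq : q.All Smooth)
    (hV : V.All Smooth) (hflow : IsFlow q V) (h : IsExpansionInfty c q y z) (j : ℤ) :
    dT (lamCoeff (-1) (rho c (-1) q y z) j) = dX (lamCoeff (-1) (current c (-1) V y z) j) := by
  refine local_law_of_defect (by norm_num) hq hV hflow h.1 ?_ j
  rintro w - e1 e2
  obtain ⟨Y, Z, rfl, rfl⟩ := h.1.exists_ps
  have h' := isExpansionInfty_iff.1 h
  obtain ⟨hy0, hz0⟩ := coeff_zero_of_isPSSolution_infty hn h'.1.2.2 h'.2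
  have hR : ∀ j < 0, (toLS (psRho c PowerSeries.X 1 q Y Z)).coeff j = 0 := fun j hj => by
    rw [coeff_toLS, if_pos hj]
  refine eq_zero_of_vanishBelow_step fun k hp hr => ?_
  have hX : ∀ {f : Fn⸨X⸩}, VanishBelow k f → (toLS PowerSeries.X * f.map dX).coeff k = 0 :=
    fun hf => coeff_X_mul fun j hj => by
      rw [HahnSeries.map_coeff, hf j hj, map_zero]
  refine coeff_lin_infty hn hR h.1.neg_fst h.1.neg_snd ?_ ?_ ?_ hp hr ?_ ?_
  · exact (coeff_toLS_natCast _ 0).trans h'.2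
  · exact (coeff_toLS_natCast _ 0).trans hy0
  · exact (coeff_toLS_natCast _ 0).trans hz0
  -- Multiplied by `X`, the linearized equation has left side `X` times a derivative of `w`, which
  -- has no coefficient at the lowest order `k`.
  · rw [← X_mul_rho_neg_one, ← toLS_X_mul_lam, ← mul_linFst, ← e1]
    exact hX hp
  · rw [← X_mul_rho_neg_one, ← toLS_X_mul_lam, ← mul_linSnd, ← e2]
    exact hX hr

end Conservation

theorem rngClass_timeAddDecaying : RngClass TimeAddDecaying where
  zero := timeAddDecaying_const 0
  add := TimeAddDecaying.add
  neg hf := by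
    have := (timeAddDecaying_const (-1)).mul hf
    convert this using 1
    funext x t
    simp
  mul := TimeAddDecaying.mul

/-! ### Conserved integrals -/

/-- Differentiation under the integral sign, for an integrand that is continuously differentiable
near a compact interval. -/
theorem hasDerivAt_intervalIntegral {E : Type*} [NormedAddCommGroup E] [NormedSpace ℝ E]
    {f f' : ℝ → ℝ → E} {a b t₀ δ : ℝ} (hδ : 0 < δ)
    (hf : ∀ t ∈ Metric.closedBall t₀ δ, ContinuousOn (fun x => f x t) (Set.uIcc a b))
    (hf' : ContinuousOn (fun z : ℝ × ℝ => f' z.1 z.2)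
      (Set.uIcc a b ×ˢ Metric.closedBall t₀ δ))
    (hd : ∀ x ∈ Set.uIcc a b, ∀ t ∈ Metric.closedBall t₀ δ,
      HasDerivAt (fun s => f x s) (f' x t) t) :
    HasDerivAt (fun t => ∫ x in a..b, f x t) (∫ x in a..b, f' x t₀) t₀ := by
  obtain ⟨C, hC⟩ := (isCompact_uIcc.prod (isCompact_closedBall t₀ δ)).exists_bound_of_continuousOn
    hf'
  have hsub : Set.uIoc a b ⊆ Set.uIcc a b := Set.uIoc_subset_uIcc
  have hmem : Metric.closedBall t₀ δ ∈ 𝓝 t₀ := Metric.closedBall_mem_nhds t₀ hδ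
  have h0 := Metric.mem_closedBall_self (x := t₀) hδ.le
  refine (intervalIntegral.hasDerivAt_integral_of_dominated_loc_of_deriv_le (μ := volume)
    (F := fun t x => f x t) (F' := fun t x => f' x t) (bound := fun _ => C) hmem ?_ ?_ ?_ ?_
    intervalIntegrable_const ?_).2
  · filter_upwards [hmem] with t ht
    exact ((hf t ht).mono hsub).aestronglyMeasurable measurableSet_uIoc
  · exact (hf t₀ h0).intervalIntegrable
  · have : ContinuousOn (fun x => f' x t₀) (Set.uIcc a b) :=
      hf'.comp (Continuous.prodMk_left t₀).continuousOn fun x hx => ⟨hx, h0⟩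
    exact (this.mono hsub).aestronglyMeasurable measurableSet_uIoc
  · exact ae_of_all _ fun x hx t ht => hC (x, t) ⟨hsub hx, ht⟩
  · exact ae_of_all _ fun x hx t ht => hd x (hsub hx) t ht

theorem intervalIntegral_dX {f : Fn} (hf : Smooth f) (a b t : ℝ) :
    ∫ x in a..b, dX f x t = f b t - f a t :=
  intervalIntegral.integral_eq_sub_of_hasDerivAt (fun x _ => hf.hasDerivAt_dX x t)
    ((hf.dX.continuous_fst t).intervalIntegrable a b)

theorem hasDerivAt_intervalIntegral_of_local_law {ρ J : Fn} (hρ : Smooth ρ) (hJ : Smooth J)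
    (h : dT ρ = dX J) (a b t : ℝ) :
    HasDerivAt (fun t => ∫ x in a..b, ρ x t) (J b t - J a t) t := by
  rw [← intervalIntegral_dX hJ, ← h]
  exact hasDerivAt_intervalIntegral one_pos (fun t _ => (hρ.continuous_fst t).continuousOn)
    hρ.dT.continuous.continuousOn fun x _ t _ => hρ.hasDerivAt_dT x t

theorem tendsto_intervalIntegral_symm {f : ℝ → ℝ} (hf : Integrable f) :
    Tendsto (fun R : ℝ => ∫ x in (-R)..R, f x) atTop (𝓝 (∫ x, f x)) :=
  intervalIntegral_tendsto_integral hf tendsto_neg_atTop_atBot tendsto_id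

/-- The integral over an interval has `t`-derivative the difference of `J` at the ends. Over a
period it is zero. Over `[-R, R]` it is small uniformly for `t` in a compact interval, and the mean
value inequality bounds the change of the integral before the limit `R → ∞` is taken. -/
theorem isConserved_of_local_law {q : Potential Fn} {V : LaxMatrix} {ρ J : Fn} (hρ : Smooth ρ)
    (hJ : Smooth J) (h : dT ρ = dX J)
    (hp : ∀ L > 0, q.All (PeriodicX L) → V.All (PeriodicX L) → PeriodicX L J) :
    IsConserved q V ρ J where
  smooth_density := hρ
  smooth_flux := hJ
  local_law := h
  periodic L hL hq hV t t' := by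
    have hd : ∀ t, HasDerivAt (fun t => ∫ x in (0 : ℝ)..L, ρ x t) 0 t := fun t => by
      have := hasDerivAt_intervalIntegral_of_local_law hρ hJ h 0 L t
      have e := hp L hL hq hV 0 t
      rw [zero_add] at e
      rwa [e, sub_self] at this
    exact is_const_of_deriv_eq_zero (fun t => (hd t).differentiableAt) (fun t => (hd t).deriv) t t'
  line hJ0 hint t t' := by
    have h1 := (tendsto_intervalIntegral_symm (hint t)).sub (tendsto_intervalIntegral_symm (hint t'))
    have h2 : Tendsto (fun R : ℝ => (∫ x in (-R)..R, ρ x t) - ∫ x in (-R)..R, ρ x t') atTop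
        (𝓝 0) := by
      have hu := tendstoLocallyUniformly_iff_forall_isCompact.1 hJ0 _ (isCompact_uIcc (a := t) (b := t'))
      rw [Metric.tendstoUniformlyOn_iff] at hu
      rw [Metric.tendsto_nhds]
      intro ε hε
      have hpos : 0 < |t - t'| + 1 := by positivity
      filter_upwards [hu (ε / (|t - t'| + 1)) (by positivity)] with R hR
      have := (convex_uIcc t t').norm_image_sub_le_of_norm_hasDerivWithin_le
        (f := fun t => ∫ x in (-R)..R, ρ x t) (C := ε / (|t - t'| + 1))
        (fun s _ => (hasDerivAt_intervalIntegral_of_local_law hρ hJ h (-R) R s).hasDerivWithinAt)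
        (fun s hs => by
          have := (hR s hs).le
          rwa [dist_zero_left] at this) Set.right_mem_uIcc Set.left_mem_uIcc
      rw [dist_zero_right]
      refine this.trans_lt ?_
      rw [Real.norm_eq_abs, div_mul_eq_mul_div, div_lt_iff₀ hpos]
      nlinarith [abs_nonneg (t - t')]
    exact sub_eq_zero.1 (tendsto_nhds_unique h1 h2)

theorem TimeAddDecaying.tendsto_boundary {J : Fn} (hJ : TimeAddDecaying J) :
    TendstoLocallyUniformly (fun R t => J R t - J (-R) t) (fun _ => 0) atTop := by
  obtain ⟨k, -, hk⟩ := hJ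
  have hD : ∃ D : Fn, D = J - fun _ t => k t := ⟨_, rfl⟩
  obtain ⟨D, hD⟩ := hD
  rw [← hD] at hk
  rw [Metric.tendstoLocallyUniformly_iff]
  intro ε hε t
  obtain ⟨C, hC⟩ := (hk 1).bound (|t| + 1)
  refine ⟨Metric.closedBall t 1, Metric.closedBall_mem_nhds t one_pos, ?_⟩
  -- The part depending on `t` alone cancels between `R` and `-R`. The rest is at most `2C / (1 +
  -- R)`, which this choice of `R` makes smaller than `ε`.
  filter_upwards [eventually_ge_atTop (2 * |C| / ε), eventually_ge_atTop 0] with R hR hR0 s hs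
  have hs' : |s| ≤ |t| + 1 := by
    have h1 : |s - t| ≤ 1 := hs
    have := abs_add_le (s - t) t
    rw [sub_add_cancel] at this
    linarith
  have h1 := hC R s hs'
  have h2 := hC (-R) s hs'
  rw [abs_neg] at h2
  rw [pow_one, abs_of_nonneg hR0] at h1 h2
  have e : J R s - J (-R) s = D R s - D (-R) s := by
    simp [hD]
  rw [e, dist_zero_left, Real.norm_eq_abs]
  have h3 := abs_sub (D R s) (D (-R) s)
  rw [div_le_iff₀ hε] at hR
  have h4 := le_abs_self C
  refine h3.trans_lt ?_
  by_contra hcon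
  rw [not_lt] at hcon
  nlinarith

theorem IsConserved.decaying {q : Potential Fn} {V : LaxMatrix} {ρ J : Fn}
    (h : IsConserved q V ρ J) (hρ : q.All Decaying → Decaying ρ)
    (hJ : q.All Decaying → V.All TimeAddDecaying → TimeAddDecaying J) (hV : V.All Smooth) :
    IsConservedDecaying q V ρ := fun hq hVd =>
  ⟨(hρ hq).integrable, h.line (hJ hq fun i j k => (hVd i j k).timeAddDecaying (hV i j k)).tendsto_boundary
    (hρ hq).integrable⟩

/-! ### Conservation of the coefficients of the two expansions. -/

theorem coeff_lam_C_mul (f : Fn) (g : Fn⸨X⸩) (j : ℤ) :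
    (lam 1 * HahnSeries.C f * g).coeff j = f * g.coeff (j - 1) := by
  have h := HahnSeries.coeff_single_mul_add (r := f) (x := g) (a := j - 1) (b := (1 : ℤ))
  rw [sub_add_cancel] at h
  rw [← h, lam, HahnSeries.C_apply, HahnSeries.single_mul_single, add_zero, one_mul]

theorem lamCoeff_rho_one_eq (c : Chart) (q : Potential Fn) (y z : Fn⸨X⸩) (j : ℤ) :
    lamCoeff 1 (rho c 1 q y z) j = match c with
      | .I => q.n1 * y.coeff (j - 1) + q.m2 * z.coeff (j - 1)
      | .II => q.m1 * y.coeff (j - 1) + z.coeff j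
      | .III => y.coeff j + q.n2 * z.coeff (j - 1) := by
  rw [lamCoeff, one_mul]
  cases c <;> simp only [rho, density, HahnSeries.coeff_add, series, Potential.map, coeff_lam_C_mul]

section Zero

variable {c : Chart} {q : Potential Fn} {V : LaxMatrix} {y z : Fn⸨X⸩}

theorem Chart.isConst_base (c : Chart) : IsConst c.base₁ ∧ IsConst c.base₂ := by
  cases c
  exacts [⟨⟨0, rfl⟩, ⟨0, rfl⟩⟩, ⟨⟨0, rfl⟩, ⟨1, rfl⟩⟩, ⟨⟨1, rfl⟩, ⟨0, rfl⟩⟩]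

/-- The coefficient of index `0` is a constant and may lie outside `P`; the larger class `Q`
accommodates it together with all the others. -/
theorem IsExpansionZero.allL {P Q : Fn → Prop} (hP : ResolventClass P) (hPQ : ∀ f, P f → Q f)
    (hc : ∀ f, IsConst f → Q f) (hq : q.All P) (h : IsExpansionZero c q y z) :
    AllL Q y ∧ AllL Q z := by
  obtain ⟨hy, hz⟩ := h.coeff_zero (hq.mono fun _ h => hP.bdd h)
  refine ⟨fun j => ?_, fun j => ?_⟩ <;> rcases lt_trichotomy j 0 with hj | rfl | hj
  · rw [h.1.neg_fst j hj]
    exact hc _ ⟨0, rfl⟩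
  · rw [hy]
    exact hc _ c.isConst_base.1
  · exact hPQ _ (h.coeff_class hP hq hj).1
  · rw [h.1.neg_snd j hj]
    exact hc _ ⟨0, rfl⟩
  · rw [hz]
    exact hc _ c.isConst_base.2
  · exact hPQ _ (h.coeff_class hP hq hj).2

theorem Potential.All.and {A : Type*} {P Q : A → Prop} {q : Potential A} (h : q.All P)
    (h' : q.All Q) : q.All fun a => P a ∧ Q a :=
  ⟨⟨h.1, h'.1⟩, ⟨h.2.1, h'.2.1⟩, ⟨h.2.2.1, h'.2.2.1⟩, ⟨h.2.2.2, h'.2.2.2⟩⟩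

theorem IsConst.bdd_and_periodic {f : Fn} (hf : IsConst f) (L : ℝ) : Bdd f ∧ PeriodicX L f := by
  obtain ⟨k, rfl⟩ := hf
  exact ⟨bdd_const k, fun _ _ => rfl⟩

theorem IsExpansionZero.current_periodic (hq : q.All Bdd) (hV : V.All Bdd)
    (h : IsExpansionZero c q y z) {L : ℝ} (hqL : q.All (PeriodicX L)) (hVL : V.All (PeriodicX L))
    (j : ℤ) : PeriodicX L (lamCoeff 1 (current c 1 V y z) j) := by
  obtain ⟨h1, h2⟩ := h.allL (resolventClass_periodic L) (fun _ h => h)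
    (fun f hf => hf.bdd_and_periodic L) (hq.and hqL)
  exact (allL_current (resolventClass_periodic L).rngClass (IsConst.bdd_and_periodic ⟨1, rfl⟩ L) c
    (one_mul 1) (fun i j k => ⟨hV i j k, hVL i j k⟩) h1 h2 _).2

theorem IsExpansionZero.current_timeAddDecaying (h : IsExpansionZero c q y z)
    (hq : q.All Decaying) (hV : V.All TimeAddDecaying) (j : ℤ) :
    TimeAddDecaying (lamCoeff 1 (current c 1 V y z) j) := by
  have hc : ∀ f, IsConst f → TimeAddDecaying f := by
    rintro _ ⟨k, rfl⟩
    exact timeAddDecaying_const k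
  obtain ⟨h1, h2⟩ := h.allL resolventClass_decaying (fun _ h => h.timeAddDecaying) hc hq
  exact allL_current rngClass_timeAddDecaying (hc _ ⟨1, rfl⟩) c (one_mul 1) hV h1 h2 _

/-- For `j ≥ 1` every term contains a potential or a coefficient of positive index. For `j = 0` this
fails in Cases II and III, where the coefficient is `1`. -/
theorem IsExpansionZero.rho_decaying (h : IsExpansionZero c q y z) (hq : q.All Decaying) {j : ℤ}
    (hj : 1 ≤ j) : Decaying (lamCoeff 1 (rho c 1 q y z) j) := by
  have hb := h.1.coeff_fst
  have hb' := h.1.coeff_snd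
  have hd := h.coeff_class resolventClass_decaying hq hj
  rw [lamCoeff_rho_one_eq]
  cases c
  · exact (hq.2.2.1.mul_bdd (hb _)).add (hq.2.1.mul_bdd (hb' _))
  · exact (hq.1.mul_bdd (hb _)).add hd.2
  · exact hd.1.add (hq.2.2.2.mul_bdd (hb' _))

theorem IsExpansionZero.isConserved (hq : q.All Bdd) (hV : V.All Bdd) (hflow : IsFlow q V)
    (h : IsExpansionZero c q y z) (j : ℤ) :
    IsConserved q V (lamCoeff 1 (rho c 1 q y z) j) (lamCoeff 1 (current c 1 V y z) j) :=
  isConserved_of_local_law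
    (allL_rho rngClass_bdd bdd_one c 1 hq h.1.coeff_fst h.1.coeff_snd _).smooth
    (allL_current rngClass_bdd bdd_one c (one_mul 1) hV h.1.coeff_fst h.1.coeff_snd _).smooth
    (h.local_law hq hV hflow j) fun _ _ hqL hVL => h.current_periodic hq hV hqL hVL j

theorem IsExpansionZero.isConservedDecaying (hq : q.All Bdd) (hV : V.All Bdd)
    (hflow : IsFlow q V) (h : IsExpansionZero c q y z) {j : ℤ} (hj : 1 ≤ j) :
    IsConservedDecaying q V (lamCoeff 1 (rho c 1 q y z) j) :=
  (h.isConserved hq hV hflow j).decaying (fun hq => h.rho_decaying hq hj)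
    (fun hq hV => h.current_timeAddDecaying hq hV j) fun i j k => (hV i j k).smooth

end Zero

theorem IsExpansionInfty.isConserved {c : Chart} {q : Potential Fn} {V : LaxMatrix}
    {y z : Fn⸨X⸩} (hn : Nondegenerate c q) (hq : q.All Smooth) (hV : V.All Smooth)
    (hflow : IsFlow q V) (h : IsExpansionInfty c q y z) (j : ℤ) :
    IsConserved q V (lamCoeff (-1) (rho c (-1) q y z) j)
      (lamCoeff (-1) (current c (-1) V y z) j) := by
  have hs : (-1 : ℤ) * -1 = 1 := by norm_num
  refine isConserved_of_local_law
    (allL_rho rngClass_smooth smooth_one c (-1) hq h.1.coeff_fst h.1.coeff_snd _)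
    (allL_current rngClass_smooth smooth_one c hs hV h.1.coeff_fst h.1.coeff_snd _)
    (h.local_law hn hq hV hflow j) fun L _ hqL hVL => ?_
  have hc := fun j => h.coeff_class (fieldClass_periodic L) hn (hq.and hqL) j
  exact (allL_current (fieldClass_periodic L).toRngClass (fieldClass_periodic L).one c hs
    (fun i j k => ⟨hV i j k, hVL i j k⟩) (fun j => (hc j).1) (fun j => (hc j).2) _).2

/-! ### Explicit densities -/

/-- If `u` is bounded and `u - u_xx` belongs to a resolvent class, then so does `u`. -/
theorem ResolventClass.of_sub_dX_dX {P : Fn → Prop} (hP : ResolventClass P) {u : Fn} (hu : Bdd u)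
    (h : P (u - dX (dX u))) : P u := by
  -- The operator `1 - ∂²` factors as `(1 - ∂)(1 + ∂)`. Inverting the two factors inside `P` gives a
  -- bounded `w` with `w - w_xx = u - u_xx`, and a bounded solution of `f_xx = f` vanishes.
  obtain ⟨s, hs, hs'⟩ := hP.exists_solution (κ := 1) one_ne_zero (hP.neg h)
  obtain ⟨w, hw, hw'⟩ := hP.exists_solution (κ := -1) (by norm_num) hs
  have hwb := hP.bdd hw
  have hsb := hP.bdd hs
  have e1 : dX w = s - w := by
    rw [hw']
    simp [sub_eq_neg_add]
  have e2 : dX (dX w) = w - (u - dX (dX u)) := by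
    rw [e1, dX_sub hsb.smooth hwb.smooth, e1, hs']
    simp only [one_smul]
    ring
  have := (bdd_eq_zero_of_system (hu.sub hwb) (hu.sub hwb).dX (sub_self _) (by
    rw [dX_sub hu.smooth hwb.smooth, dX_sub hu.smooth.dX hwb.smooth.dX, e2]
    ring)).1
  rw [sub_eq_zero.1 this]
  exact hw

theorem integral_dX_eq_zero {h : Fn} (hh : Decaying h) (t : ℝ) : ∫ x, dX h x t = 0 :=
  integral_eq_zero_of_hasDerivAt_of_integrable (fun x => hh.smooth.hasDerivAt_dX x t)
    (hh.dX.integrable t) (hh.integrable t)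

theorem isEquivalent_of_eq {q : Potential Fn} {ρ ρ' h : Fn} (heq : ρ = ρ' + dX h) (hh : Smooth h)
    (hρ' : Smooth ρ') (hp : ∀ L, q.All (PeriodicX L) → PeriodicX L h)
    (hd : q.All Decaying → Decaying h) (hd' : q.All Decaying → Decaying ρ') :
    IsEquivalent q ρ ρ' h where
  eq := heq
  periodic L _ hq t := by
    have e : ∫ x in (0 : ℝ)..L, ρ x t = (∫ x in (0 : ℝ)..L, ρ' x t)
        + ∫ x in (0 : ℝ)..L, dX h x t := by
      rw [heq]
      exact intervalIntegral.integral_add ((hρ'.continuous_fst t).intervalIntegrable _ _)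
        ((hh.dX.continuous_fst t).intervalIntegrable _ _)
    have e' := hp L hq 0 t
    rw [zero_add] at e'
    rw [e, intervalIntegral_dX hh, e', sub_self, add_zero]
  line hq t := by
    have e : ∫ x, ρ x t = (∫ x, ρ' x t) + ∫ x, dX h x t := by
      rw [heq]
      exact integral_add ((hd' hq).integrable t) ((hd hq).dX.integrable t)
    rw [e, integral_dX_eq_zero (hd hq), add_zero]

/-- Removing `h_x` from the density changes the flux by `h_t`, because the mixed derivatives of `h`
agree. -/
theorem IsConserved.of_eq {q : Potential Fn} {V : LaxMatrix} {ρ ρ' J h : Fn}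
    (hc : IsConserved q V ρ J) (heq : ρ = ρ' + dX h) (hh : Smooth h) (hρ' : Smooth ρ')
    (hJ : ∀ L, q.All (PeriodicX L) → V.All (PeriodicX L) → PeriodicX L J)
    (hp : ∀ L, q.All (PeriodicX L) → PeriodicX L h) :
    IsConserved q V ρ' (J - dT h) := by
  refine isConserved_of_local_law hρ' (hc.smooth_flux.sub hh.dT) ?_ fun L _ hq hV x t => ?_
  · have h1 := hc.local_law
    rw [heq, dT_add hρ' hh.dX] at h1
    rw [dX_sub hc.smooth_flux hh.dT, dX_dT hh, ← h1]
    ring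
  · exact congrArg₂ (· - ·) (hJ L hq hV x t) (dT_periodic (hp L hq) x t)

namespace Primitives

variable {p : Primitives}

theorem all_of_potential {P : Fn → Prop} (hP : ResolventClass P) (hp : p.All Bdd)
    (hq : p.potential.All P) : p.All P :=
  ⟨hP.of_sub_dX_dX hp.1 hq.1, hP.of_sub_dX_dX hp.2.1 hq.2.1, hP.of_sub_dX_dX hp.2.2.1 hq.2.2.1,
    hP.of_sub_dX_dX hp.2.2.2 hq.2.2.2⟩

theorem all_fg {P : Fn → Prop} (hP : RngClass P) (hX : ∀ {f}, P f → P (dX f)) (hp : p.All P) :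
    P p.f1 ∧ P p.f2 ∧ P p.g1 ∧ P p.g2 :=
  ⟨hP.sub hp.2.1 (hX hp.2.2.1), hP.add hp.1 (hX hp.2.2.2), hP.add hp.2.2.2 (hX hp.1),
    hP.sub hp.2.2.1 (hX hp.2.1)⟩

theorem all_potential {P : Fn → Prop} (hP : RngClass P) (hX : ∀ {f}, P f → P (dX f))
    (hp : p.All P) : p.potential.All P :=
  ⟨hP.sub hp.1 (hX (hX hp.1)), hP.sub hp.2.1 (hX (hX hp.2.1)), hP.sub hp.2.2.1 (hX (hX hp.2.2.1)),
    hP.sub hp.2.2.2 (hX (hX hp.2.2.2))⟩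

theorem all_P {P : Fn → Prop} (hP : RngClass P) (hX : ∀ {f}, P f → P (dX f)) (hp : p.All P) :
    P p.P := by
  obtain ⟨-, h2, h3, -⟩ := all_fg hP hX hp
  have hq := all_potential hP hX hp
  exact hP.add (hP.mul hq.2.2.1 h3) (hP.mul hq.2.1 h2)

theorem all_rho3 {P : Fn → Prop} (hP : RngClass P) (hX : ∀ {f}, P f → P (dX f)) (hp : p.All P) :
    P p.rho3 := by
  obtain ⟨h1, h2, h3, h4⟩ := all_fg hP hX hp
  exact hP.mul (all_P hP hX hp) (hP.add (hP.mul h1 h3) (hP.mul h2 h4))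

theorem all_exact3 {P : Fn → Prop} (hP : RngClass P) (hX : ∀ {f}, P f → P (dX f)) (hp : p.All P)
    {a b : Fn} (ha : P a) (hb : P b) : P (p.exact3 a b) := by
  obtain ⟨-, h2, h3, -⟩ := all_fg hP hX hp
  have hPP := all_P hP hX hp
  exact hP.add (hP.add (hP.sub (hP.add (hP.sub (hP.mul hp.2.2.1 (hX ha))
    (hP.mul (hX hp.2.2.1) ha)) (hP.mul hp.2.1 (hX hb))) (hP.mul (hX hp.2.1) hb))
    (hP.mul (hP.mul hp.2.2.1 h3) hPP)) (hP.mul (hP.mul hp.2.1 h2) hPP)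

/-- These first-order relations for `fᵢ, gᵢ` remove all second derivatives of the primitives. They
give the first coefficients of the expansions and drive the zero-curvature computation. -/
theorem dX_f1 (hp : p.All Smooth) : dX p.f1 = p.potential.n1 - p.g2 := by
  simp only [f1, g2, potential, dX_sub hp.2.1 hp.2.2.1.dX]
  ring

theorem dX_f2 (hp : p.All Smooth) : dX p.f2 = p.g1 - p.potential.n2 := by
  simp only [f2, g1, potential, dX_add hp.1 hp.2.2.2.dX]
  ring

theorem dX_g1 (hp : p.All Smooth) : dX p.g1 = p.f2 - p.potential.m1 := by
  simp only [f2, g1, potential, dX_add hp.2.2.2 hp.1.dX]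
  ring

theorem dX_g2 (hp : p.All Smooth) : dX p.g2 = p.potential.m2 - p.f1 := by
  simp only [f1, g2, potential, dX_sub hp.2.2.1 hp.2.1.dX]
  ring

/-- Move `1 - ∂²` from `v₁` and `u₂` onto `a` and `b` by parts. The equations give `a - a_xx = f₂P +
(g₁P)_x` and `b - b_xx = g₁P + (f₂P)_x`. A further integration by parts leaves `P` times `f₂(v₁ -
u₂ₓ) + g₁(u₂ - v₁ₓ) = f₂g₂ + f₁g₁`. -/
theorem rho3_add_dX_exact3 (hp : p.All Smooth) {a b : Fn} (ha : Smooth a) (hb : Smooth b)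
    (h1 : dX a = b - p.g1 * p.P) (h2 : dX b = a - p.f2 * p.P) :
    p.potential.n1 * a + p.potential.m2 * b = p.rho3 + dX (p.exact3 a b) := by
  obtain ⟨-, hf2, hg1, -⟩ := all_fg rngClass_smooth Smooth.dX hp
  have hP := all_P rngClass_smooth Smooth.dX hp
  have e1 := congrArg dX h1
  have e2 := congrArg dX h2
  obtain ⟨hu1, hu2, hv1, hv2⟩ := hp
  rw [dX_sub hb (hg1.mul hP)] at e1
  rw [dX_sub ha (hf2.mul hP)] at e2
  have e3 : p.exact3 a b = p.v1 * dX a - dX p.v1 * a + p.u2 * dX b - dX p.u2 * b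
    + p.v1 * (p.g1 * p.P) + p.u2 * (p.f2 * p.P) := by
    simp only [exact3]
    ring
  have s1 := hv1.mul ha.dX
  have s2 := hv1.dX.mul ha
  have s3 := hu2.mul hb.dX
  have s4 := hu2.dX.mul hb
  have s5 := hv1.mul (hg1.mul hP)
  have s6 := hu2.mul (hf2.mul hP)
  rw [e3, dX_add ((((s1.sub s2).add s3).sub s4).add s5) s6, dX_add (((s1.sub s2).add s3).sub s4) s5,
    dX_sub ((s1.sub s2).add s3) s4, dX_add (s1.sub s2) s3, dX_sub s1 s2, dX_mul hv1 ha.dX,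
    dX_mul hv1.dX ha, dX_mul hu2 hb.dX, dX_mul hu2.dX hb, dX_mul hv1 (hg1.mul hP),
    dX_mul hu2 (hf2.mul hP), e1, e2, h1, h2]
  simp only [rho3, potential, f1, g2]
  ring

end Primitives

/-! ### The first coefficients of the expansion in non-negative powers. -/

theorem coeff_lam_C (f : Fn) (j : ℤ) :
    (lam 1 * HahnSeries.C f : Fn⸨X⸩).coeff j = if j = 1 then f else 0 := by
  rw [lam, HahnSeries.C_apply, HahnSeries.single_mul_single, add_zero, one_mul,
    HahnSeries.coeff_single]
  congr

section Coefficients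

variable {q : Potential Fn} {y z : Fn⸨X⸩}

theorem IsExpansionZero.vanishBelow_rho {c : Chart} (h : IsExpansionZero c q y z) :
    VanishBelow 0 (rho c 1 q y z) := by
  obtain ⟨Y, Z, rfl, rfl⟩ := h.1.exists_ps
  intro j hj
  rw [rho_one, coeff_toLS, if_pos hj]

theorem VanishBelow.succ {f : Fn⸨X⸩} {k : ℤ} (h : VanishBelow k f) (h0 : f.coeff k = 0) :
    VanishBelow (k + 1) f := by
  intro j hj
  rcases (show j < k ∨ j = k by omega) with h' | rfl
  exacts [h j h', h0]

theorem IsFormalSolution.dX_coeff_fst {c : Chart} {s : ℤ} {P : Fn → Prop}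
    (h : IsFormalSolution c s P q y z) (j : ℤ) :
    dX (y.coeff j) = (riccatiFst c (lam s) (series q) y z).coeff j :=
  congrArg (fun f => f.coeff j) h.eq_fst

theorem IsFormalSolution.dX_coeff_snd {c : Chart} {s : ℤ} {P : Fn → Prop}
    (h : IsFormalSolution c s P q y z) (j : ℤ) :
    dX (z.coeff j) = (riccatiSnd c (lam s) (series q) y z).coeff j :=
  congrArg (fun f => f.coeff j) h.eq_snd

/-- The coordinates start at order `1` and `ρ` at order `2`, so the nonlinear terms first appear at
order `3` and there consist of a single product. At order `2` the system is homogeneous, hence has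
only the zero solution. -/
theorem IsExpansionZero.coeffs_I (hq : q.All Bdd) (h : IsExpansionZero .I q y z) :
    y.coeff 0 = 0 ∧ z.coeff 0 = 0 ∧ y.coeff 2 = 0 ∧ z.coeff 2 = 0 ∧
      dX (y.coeff 1) = q.m1 + z.coeff 1 ∧ dX (z.coeff 1) = y.coeff 1 + q.n2 ∧
      dX (y.coeff 3) = z.coeff 3 - y.coeff 1 * (q.n1 * y.coeff 1 + q.m2 * z.coeff 1) ∧
      dX (z.coeff 3) = y.coeff 3 - z.coeff 1 * (q.n1 * y.coeff 1 + q.m2 * z.coeff 1) := by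
  obtain ⟨hy0, hz0⟩ : y.coeff 0 = 0 ∧ z.coeff 0 = 0 := h.coeff_zero hq
  have hy : VanishBelow 1 y := VanishBelow.succ (k := 0) h.1.neg_fst hy0
  have hz : VanishBelow 1 z := VanishBelow.succ (k := 0) h.1.neg_snd hz0
  have hρ' : ∀ j, (rho .I 1 q y z).coeff j
      = q.n1 * y.coeff (j - 1) + q.m2 * z.coeff (j - 1) := fun j => by
    have := lamCoeff_rho_one_eq .I q y z j
    rwa [lamCoeff, one_mul] at this
  have hρ : VanishBelow 2 (rho .I 1 q y z) := fun j hj => by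
    rw [hρ', hy _ (by omega), hz _ (by omega), mul_zero, mul_zero, add_zero]
  have e1 : ∀ j, dX (y.coeff j) = (if j = 1 then q.m1 else 0) + z.coeff j
      - (y * rho .I 1 q y z).coeff j := fun j => by
    rw [h.1.dX_coeff_fst, riccatiFst, HahnSeries.coeff_sub, HahnSeries.coeff_add, series,
      Potential.map, coeff_lam_C]
    rfl
  have e2 : ∀ j, dX (z.coeff j) = y.coeff j + (if j = 1 then q.n2 else 0)
      - (z * rho .I 1 q y z).coeff j := fun j => by
    rw [h.1.dX_coeff_snd, riccatiSnd, HahnSeries.coeff_sub, HahnSeries.coeff_add, series,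
      Potential.map, coeff_lam_C]
    rfl
  have hyρ := hy.mul hρ
  have hzρ := hz.mul hρ
  have hyρ3 : (y * rho .I 1 q y z).coeff 3 = _ := hy.coeff_mul hρ
  have hzρ3 : (z * rho .I 1 q y z).coeff 3 = _ := hz.coeff_mul hρ
  have hρ2 : (rho .I 1 q y z).coeff 2 = q.n1 * y.coeff 1 + q.m2 * z.coeff 1 := hρ' 2
  obtain ⟨hy2, hz2⟩ := bdd_eq_zero_of_system (h.1.coeff_fst 2) (h.1.coeff_snd 2)
    (by rw [e1, hyρ 2 (by norm_num)]; simp) (by rw [e2, hzρ 2 (by norm_num)]; simp)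
  refine ⟨hy0, hz0, hy2, hz2, ?_, ?_, ?_, ?_⟩
  · rw [e1, hyρ 1 (by norm_num)]; simp
  · rw [e2, hzρ 1 (by norm_num)]; simp
  · rw [e1, hyρ3, hρ2]; simp
  · rw [e2, hzρ3, hρ2]; simp

theorem IsExpansionZero.coeffs_II (hq : q.All Bdd) (h : IsExpansionZero .II q y z) :
    dX (y.coeff 1) = q.n1 + q.m2 - y.coeff 1 ∧
      dX (z.coeff 2) = (q.n2 - q.m1) * y.coeff 1 - 2 * z.coeff 2 := by
  obtain ⟨hy0, hz0⟩ : y.coeff 0 = 0 ∧ z.coeff 0 = 1 := h.coeff_zero hq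
  have hρ0 : (rho .II 1 q y z).coeff 0 = 1 := h.2
  have hy : VanishBelow 1 y := VanishBelow.succ (k := 0) h.1.neg_fst hy0
  have hρ' : ∀ j, (rho .II 1 q y z).coeff j = q.m1 * y.coeff (j - 1) + z.coeff j := fun j => by
    have := lamCoeff_rho_one_eq .II q y z j
    rwa [lamCoeff, one_mul] at this
  have hρ := h.vanishBelow_rho
  have hone : ∀ j : ℤ, (1 : Fn⸨X⸩).coeff j = if j = 0 then 1 else 0 := fun j => by
    rw [HahnSeries.coeff_one]
    congr
  have e1 : ∀ j, dX (y.coeff j) = (if j = 1 then q.n1 else 0) + q.m2 * z.coeff (j - 1)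
      - (y * rho .II 1 q y z).coeff j := fun j => by
    rw [h.1.dX_coeff_fst, riccatiFst, HahnSeries.coeff_sub, HahnSeries.coeff_add, series,
      Potential.map, coeff_lam_C, coeff_lam_C_mul]
    rfl
  -- Writing `τρ̄ = ρ̄ + (τ - 1)ρ̄` exposes a factor `τ - 1` without constant term, so the product
  -- has a single term at its lowest order. First `τ₁` satisfies `u_x = -2u` and vanishes; then `τ -
  -- 1` begins at order `2`.
  have e2 : ∀ j, dX (z.coeff j) = (1 : Fn⸨X⸩).coeff j + q.n2 * y.coeff (j - 1)
      - (rho .II 1 q y z).coeff j - ((z - 1) * rho .II 1 q y z).coeff j := fun j => by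
    rw [h.1.dX_coeff_snd, riccatiSnd, HahnSeries.coeff_sub, HahnSeries.coeff_add, series,
      Potential.map, coeff_lam_C_mul, sub_mul, one_mul, HahnSeries.coeff_sub, sub_sub,
      add_sub_cancel]
    rfl
  have hw : VanishBelow 1 (z - 1) := fun j hj => by
    rw [HahnSeries.coeff_sub, hone]
    rcases (show j < 0 ∨ j = 0 by omega) with h' | rfl
    · rw [if_neg h'.ne, h.1.neg_snd j h', sub_zero]
    · rw [if_pos rfl, hz0, sub_self]
  have hw' : ∀ j > 0, (z - 1).coeff j = z.coeff j := fun j hj => by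
    rw [HahnSeries.coeff_sub, hone, if_neg hj.ne', sub_zero]
  have p1 : (y * rho .II 1 q y z).coeff 1 = _ := hy.coeff_mul hρ
  have p2 : ((z - 1) * rho .II 1 q y z).coeff 1 = _ := hw.coeff_mul hρ
  have ρ1 : (rho .II 1 q y z).coeff 1 = z.coeff 1 := by
    rw [hρ', sub_self, hy0, mul_zero, zero_add]
  have hz1 : z.coeff 1 = 0 := by
    refine eq_zero_of_dX_eq_smul (h.1.coeff_snd 1) (κ := -2) (by norm_num) ?_
    rw [e2, p2, ρ1, hρ0, hw' 1 one_pos, hone, sub_self, hy0]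
    funext x t
    simp
    ring
  have hw2 : VanishBelow 2 (z - 1) := VanishBelow.succ (k := 1) hw (by rw [hw' 1 one_pos, hz1])
  have p3 : ((z - 1) * rho .II 1 q y z).coeff 2 = _ := hw2.coeff_mul hρ
  have ρ2 : (rho .II 1 q y z).coeff 2 = q.m1 * y.coeff 1 + z.coeff 2 := hρ' 2
  constructor
  · rw [e1, p1, hρ0, sub_self, hz0]
    simp
  · rw [e2, p3, ρ2, hρ0, hw' 2 two_pos, hone, if_neg two_ne_zero, show (2 : ℤ) - 1 = 1 from rfl]
    ring

end Coefficients

section ExplicitZero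

variable {p : Primitives} {V : LaxMatrix} {y z : Fn⸨X⸩}

theorem Primitives.all_of_periodic (hp : p.All Bdd) {L : ℝ}
    (hq : p.potential.All (PeriodicX L)) : p.All fun f => Bdd f ∧ PeriodicX L f :=
  all_of_potential (resolventClass_periodic L) hp
    ((all_potential rngClass_bdd Bdd.dX hp).and hq)

theorem Bdd.dX_periodic {L : ℝ} {f : Fn} (hf : Bdd f ∧ PeriodicX L f) :
    Bdd (FourCH.dX f) ∧ PeriodicX L (FourCH.dX f) := ⟨hf.1.dX, FourCH.dX_periodic hf.2⟩

/-- By the relations for `g₁ₓ` and `f₂ₓ`, the pair `(-g₁, -f₂)` is a bounded solution of the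
equations at order `1`, and two bounded solutions coincide. -/
theorem IsExpansionZero.leading_I (hp : p.All Bdd) (h : IsExpansionZero .I p.potential y z) :
    y.coeff 1 = -p.g1 ∧ z.coeff 1 = -p.f2 := by
  have hps : p.All Smooth := ⟨hp.1.smooth, hp.2.1.smooth, hp.2.2.1.smooth, hp.2.2.2.smooth⟩
  obtain ⟨-, hf2, hg1, -⟩ := Primitives.all_fg rngClass_bdd Bdd.dX hp
  obtain ⟨-, -, -, -, e1, e2, -, -⟩ :=
    h.coeffs_I (Primitives.all_potential rngClass_bdd Bdd.dX hp)
  have hy := h.1.coeff_fst 1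
  have hz := h.1.coeff_snd 1
  obtain ⟨r1, r2⟩ := bdd_eq_zero_of_system (hy.add hg1) (hz.add hf2)
    (by
      rw [dX_add hy.smooth hg1.smooth, e1, Primitives.dX_g1 hps]
      ring)
    (by
      rw [dX_add hz.smooth hf2.smooth, e2, Primitives.dX_f2 hps]
      ring)
  exact ⟨eq_neg_of_add_eq_zero_left r1, eq_neg_of_add_eq_zero_left r2⟩

theorem IsExpansionZero.rho3_eq (hp : p.All Bdd) (h : IsExpansionZero .I p.potential y z) :
    p.potential.n1 * y.coeff 3 + p.potential.m2 * z.coeff 3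
      = p.rho3 + dX (p.exact3 (y.coeff 3) (z.coeff 3)) := by
  have hps : p.All Smooth := ⟨hp.1.smooth, hp.2.1.smooth, hp.2.2.1.smooth, hp.2.2.2.smooth⟩
  obtain ⟨h1, h2⟩ := h.leading_I hp
  obtain ⟨-, -, -, -, -, -, e3, e4⟩ :=
    h.coeffs_I (Primitives.all_potential rngClass_bdd Bdd.dX hp)
  refine Primitives.rho3_add_dX_exact3 hps (h.1.coeff_fst 3).smooth (h.1.coeff_snd 3).smooth ?_ ?_
  · rw [e3, h1, h2, Primitives.P]
    ring
  · rw [e4, h1, h2, Primitives.P]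
    ring

theorem IsExpansionZero.explicit_I (hp : p.All Bdd) (hV : V.All Bdd)
    (hflow : IsFlow p.potential V) (h : IsExpansionZero .I p.potential y z) :
    y.coeff 0 = 0 ∧ z.coeff 0 = 0 ∧ y.coeff 1 = -p.g1 ∧ z.coeff 1 = -p.f2 ∧
      y.coeff 2 = 0 ∧ z.coeff 2 = 0 ∧
      lamCoeff 1 (rho .I 1 p.potential y z) 2 = p.rho1 ∧
      lamCoeff 1 (rho .I 1 p.potential y z) 4
        = p.potential.n1 * y.coeff 3 + p.potential.m2 * z.coeff 3 ∧
      IsEquivalent p.potential (p.potential.n1 * y.coeff 3 + p.potential.m2 * z.coeff 3) p.rho3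
        (p.exact3 (y.coeff 3) (z.coeff 3)) ∧
      IsConserved p.potential V p.rho3
        (lamCoeff 1 (current .I 1 V y z) 4 - dT (p.exact3 (y.coeff 3) (z.coeff 3))) ∧
      IsConservedDecaying p.potential V p.rho3 := by
  have hq := Primitives.all_potential rngClass_bdd Bdd.dX hp
  obtain ⟨h1, h2⟩ := h.leading_I hp
  obtain ⟨e1, e2, e3, e4, -⟩ := h.coeffs_I hq
  have hr2 : lamCoeff 1 (rho .I 1 p.potential y z) 2 = _ := lamCoeff_rho_one_eq _ _ _ _ _
  have hr4 : lamCoeff 1 (rho .I 1 p.potential y z) 4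
      = p.potential.n1 * y.coeff 3 + p.potential.m2 * z.coeff 3 := lamCoeff_rho_one_eq _ _ _ _ _
  have hρ := (Primitives.all_rho3 rngClass_bdd Bdd.dX hp).smooth
  have hh := Primitives.all_exact3 rngClass_bdd Bdd.dX hp (h.1.coeff_fst 3) (h.1.coeff_snd 3)
  have hhp : ∀ L, p.potential.All (PeriodicX L) →
      PeriodicX L (p.exact3 (y.coeff 3) (z.coeff 3)) := fun L hqL => by
    have hc := h.coeff_class (resolventClass_periodic L) (hq.and hqL) (j := 3) (by norm_num)
    exact (Primitives.all_exact3 (resolventClass_periodic L).rngClass Bdd.dX_periodic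
      (Primitives.all_of_periodic hp hqL) hc.1 hc.2).2
  have hhd : p.potential.All Decaying → Decaying (p.exact3 (y.coeff 3) (z.coeff 3)) := fun hqd => by
    have hc := h.coeff_class resolventClass_decaying hqd (j := 3) (by norm_num)
    exact Primitives.all_exact3 resolventClass_decaying.rngClass Decaying.dX
      (Primitives.all_of_potential resolventClass_decaying hp hqd) hc.1 hc.2
  have hρd : p.potential.All Decaying → Decaying p.rho3 := fun hqd =>
    Primitives.all_rho3 resolventClass_decaying.rngClass Decaying.dX
      (Primitives.all_of_potential resolventClass_decaying hp hqd)
  have hcons := (hr4 ▸ h.isConserved hq hV hflow 4).of_eq (h.rho3_eq hp) hh.smooth hρ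
    (fun L hqL hVL => h.current_periodic hq hV hqL hVL 4) hhp
  refine ⟨e1, e2, h1, h2, e3, e4, ?_, hr4,
    isEquivalent_of_eq (h.rho3_eq hp) hh.smooth hρ hhp hhd hρd, hcons,
    hcons.decaying hρd (fun hqd hVd => rngClass_timeAddDecaying.sub
      (h.current_timeAddDecaying hqd hVd 4) (hhd hqd).dT.timeAddDecaying)
      fun i j k => (hV i j k).smooth⟩
  rw [hr2, show (2 : ℤ) - 1 = 1 from rfl, h1, h2, Primitives.rho1, Primitives.P]
  ring

theorem Primitives.all_rhoBar2 {P : Fn → Prop} (hP : ResolventClass P)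
    (hX : ∀ {f}, P f → P (dX f)) (hp : p.All P) : P p.rhoBar2 := by
  obtain ⟨h1, -, -, h4⟩ := all_fg hP.rngClass hX hp
  have hq := all_potential hP.rngClass hX hp
  exact hP.smul _ (hP.mul (hP.add hq.1 hq.2.2.2) (hP.add h1 h4))

theorem IsExpansionZero.leading_II (hp : p.All Bdd) (h : IsExpansionZero .II p.potential y z) :
    y.coeff 1 = p.f1 + p.g2 := by
  have hps : p.All Smooth := ⟨hp.1.smooth, hp.2.1.smooth, hp.2.2.1.smooth, hp.2.2.2.smooth⟩
  obtain ⟨hf1, -, -, hg2⟩ := Primitives.all_fg rngClass_bdd Bdd.dX hp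
  obtain ⟨e1, -⟩ := h.coeffs_II (Primitives.all_potential rngClass_bdd Bdd.dX hp)
  have hy := h.1.coeff_fst 1
  refine sub_eq_zero.1 (eq_zero_of_dX_eq_smul (hy.sub (hf1.add hg2)) (κ := -1) (by norm_num) ?_)
  rw [dX_sub hy.smooth (hf1.add hg2).smooth, dX_add hf1.smooth hg2.smooth, e1,
    Primitives.dX_f1 hps, Primitives.dX_g2 hps, neg_smul, one_smul]
  ring

theorem dX_smul {f : Fn} (hf : Smooth f) (k : ℝ) : dX (k • f) = k • dX f :=
  dX_eq_of_hasDerivAt fun x t => (hf.hasDerivAt_dX x t).const_mul k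

/-- The coefficient is `m₁σ₁ + τ₂`, and the equation `τ₂ₓ = (n₂ - m₁)σ₁ - 2τ₂` gives `τ₂ = (n₂ -
m₁)σ₁/2 - τ₂ₓ/2`. Here `σ₁ = f₁ + g₂`. -/
theorem IsExpansionZero.rhoBar2_eq (hp : p.All Bdd) (h : IsExpansionZero .II p.potential y z) :
    lamCoeff 1 (rho .II 1 p.potential y z) 2
      = p.rhoBar2 + dX (fun x t => -(1 / 2) * z.coeff 2 x t) := by
  obtain ⟨-, e2⟩ := h.coeffs_II (Primitives.all_potential rngClass_bdd Bdd.dX hp)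
  have hr : lamCoeff 1 (rho .II 1 p.potential y z) 2 = _ := lamCoeff_rho_one_eq _ _ _ _ _
  have e3 : dX (fun x t => -(1 / 2) * z.coeff 2 x t) = (-(1 / 2) : ℝ) • dX (z.coeff 2) :=
    dX_smul (h.1.coeff_snd 2).smooth _
  rw [hr, e3, e2, show (2 : ℤ) - 1 = 1 from rfl, h.leading_II hp]
  funext x t
  simp only [Primitives.rhoBar2, Pi.add_apply, Pi.mul_apply, Pi.smul_apply, Pi.sub_apply,
    smul_eq_mul, Pi.ofNat_apply]
  ring

theorem IsExpansionZero.explicit_II (hp : p.All Bdd) (hV : V.All Bdd)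
    (hflow : IsFlow p.potential V) (h : IsExpansionZero .II p.potential y z) :
    IsEquivalent p.potential (lamCoeff 1 (rho .II 1 p.potential y z) 2) p.rhoBar2
        (fun x t => -(1 / 2) * z.coeff 2 x t) ∧
      IsConserved p.potential V p.rhoBar2
        (lamCoeff 1 (current .II 1 V y z) 2 - dT (fun x t => -(1 / 2) * z.coeff 2 x t)) ∧
      IsConservedDecaying p.potential V p.rhoBar2 := by
  have hq := Primitives.all_potential rngClass_bdd Bdd.dX hp
  have hρ := (Primitives.all_rhoBar2 resolventClass_bdd Bdd.dX hp).smooth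
  have hh : Bdd (fun x t => -(1 / 2) * z.coeff 2 x t) := (h.1.coeff_snd 2).smul (-(1 / 2))
  have hhp : ∀ L, p.potential.All (PeriodicX L) →
      PeriodicX L (fun x t => -(1 / 2) * z.coeff 2 x t) := fun L hqL x t => by
    have hc := h.coeff_class (resolventClass_periodic L) (hq.and hqL) (j := 2) (by norm_num)
    exact congrArg (-(1 / 2) * ·) (hc.2.2 x t)
  have hhd : p.potential.All Decaying → Decaying (fun x t => -(1 / 2) * z.coeff 2 x t) :=
    fun hqd => (h.coeff_class resolventClass_decaying hqd (j := 2) (by norm_num)).2.smul (-(1 / 2))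
  have hρd : p.potential.All Decaying → Decaying p.rhoBar2 := fun hqd =>
    Primitives.all_rhoBar2 resolventClass_decaying Decaying.dX
      (Primitives.all_of_potential resolventClass_decaying hp hqd)
  have hcons := (h.isConserved hq hV hflow 2).of_eq (h.rhoBar2_eq hp) hh.smooth hρ
    (fun L hqL hVL => h.current_periodic hq hV hqL hVL 2) hhp
  exact ⟨isEquivalent_of_eq (h.rhoBar2_eq hp) hh.smooth hρ hhp hhd hρd, hcons,
    hcons.decaying hρd (fun hqd hVd => rngClass_timeAddDecaying.sub
      (h.current_timeAddDecaying hqd hVd 2) (hhd hqd).dT.timeAddDecaying)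
      fun i j k => (hV i j k).smooth⟩

end ExplicitZero

/-! ### The coefficient of `λ⁰` in the expansion in non-positive powers -/

section SubleadingInfty

variable {c : Chart} {q : Potential Fn}

theorem coeff_zero_C_add_X_mul' (f : Fn) (S : PowerSeries Fn) :
    PowerSeries.coeff 0 (PowerSeries.C f + PowerSeries.X * S) = f := by
  simp

theorem subleading_equations (hn : Nondegenerate c q) (hq : q.All Smooth) {Y Z : PowerSeries Fn}
    (hY : AllC Smooth Y) (hZ : AllC Smooth Z) (h : IsPSSolution c PowerSeries.X 1 q Y Z)
    (h0 : PowerSeries.coeff 0 (psRho c PowerSeries.X 1 q Y Z) = rho0 q) :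
    ∃ S T : Fn,
      (linInfty₁ c q S T = match (generalizing := false) c with
        | .I => baseInfty₂ .I q - dX (baseInfty₁ .I q)
        | .II => dX (baseInfty₁ .II q) + baseInfty₁ .II q * baseInfty₂ .II q
        | .III => dX (baseInfty₁ .III q) - 1 + baseInfty₁ .III q * baseInfty₁ .III q) ∧
      (linInfty₂ c q S T = match (generalizing := false) c with
        | .I => baseInfty₁ .I q - dX (baseInfty₂ .I q)
        | .II => dX (baseInfty₂ .II q) - 1 + baseInfty₂ .II q * baseInfty₂ .II q
        | .III => dX (baseInfty₂ .III q) + baseInfty₂ .III q * baseInfty₁ .III q) ∧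
      (PowerSeries.coeff 1 (psRho c PowerSeries.X 1 q Y Z) = match (generalizing := false) c with
        | .I => q.n1 * S + q.m2 * T
        | .II => q.m1 * S + baseInfty₂ .II q
        | .III => baseInfty₁ .III q + q.n2 * T) := by
  obtain ⟨hY0, hZ0⟩ := coeff_zero_of_isPSSolution_infty hn h h0
  have eY := eq_C_add_X_mul_psTail Y
  have eZ := eq_C_add_X_mul_psTail Z
  rw [hY0] at eY
  rw [hZ0] at eZ
  rw [eY, eZ] at h
  have h1 := (isPSSolution_infty_iff hq hn hY.psTail hZ.psTail).1 h 0
  refine ⟨_, _, h1.1.trans ?_, h1.2.trans ?_, ?_⟩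
  · cases c <;> exact coeff_zero_C_add_X_mul' _ _
  · cases c <;> exact coeff_zero_C_add_X_mul' _ _
  · rw [eY, eZ]
    have hs : ∀ (f : Fn) (S : PowerSeries Fn),
        PowerSeries.coeff 1 (PowerSeries.C f + PowerSeries.X * S) = PowerSeries.coeff 0 S := by
      intro f S
      rw [map_add, PowerSeries.coeff_succ_X_mul, PowerSeries.coeff_C, if_neg one_ne_zero, zero_add]
    have hx : ∀ S : PowerSeries Fn, PowerSeries.coeff 1 (PowerSeries.X * S)
        = PowerSeries.coeff 0 S := fun S => PowerSeries.coeff_succ_X_mul 0 S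
    cases c <;> simp only [psRho, hDensity, Potential.map, one_mul, map_add,
      PowerSeries.coeff_C_mul, hx] <;> simp [PowerSeries.coeff_C, psTail]

theorem Nondegenerate.dX_rho0 (hn : Nondegenerate c q) (hq : q.All Smooth) :
    2 * rho0 q * dX (rho0 q) = dX q.m1 * q.n1 + q.m1 * dX q.n1 + (dX q.m2 * q.n2 + q.m2 * dX q.n2) := by
  have hr := fieldClass_smooth.rho0 hn hq
  have h := congrArg dX hn.rho0_mul_self
  rw [dX_mul hr hr, dX_add (hq.1.mul hq.2.2.1) (hq.2.1.mul hq.2.2.2), dX_mul hq.1 hq.2.2.1,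
    dX_mul hq.2.1 hq.2.2.2] at h
  linear_combination h

/-- Contract the equations for the subleading coefficients with `(n₁, m₂)`: this isolates `n₁S +
m₂T`, the quantity sought. The derivatives of the leading coefficients are eliminated by
differentiating the relations that define them. -/
theorem coeff_one_psRho_I (hn : Nondegenerate .I q) (hq : q.All Smooth) {Y Z : PowerSeries Fn}
    (hY : AllC Smooth Y) (hZ : AllC Smooth Z) (h : IsPSSolution .I PowerSeries.X 1 q Y Z)
    (h0 : PowerSeries.coeff 0 (psRho .I PowerSeries.X 1 q Y Z) = rho0 q) :
    PowerSeries.coeff 1 (psRho .I PowerSeries.X 1 q Y Z) = rhoM1 q := by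
  obtain ⟨S, T, E1, E2, hρ⟩ := subleading_equations hn hq hY hZ h h0
  have hr := fieldClass_smooth.rho0 hn hq
  obtain ⟨ha, hb⟩ := fieldClass_smooth.baseInfty hn hq
  obtain ⟨h1, h2, h3⟩ := hn.leadingRelations
  have hP := hn.rho0_mul_self
  have d1 := congrArg dX h1
  have d2 := congrArg dX h2
  have d3 := hn.dX_rho0 hq
  rw [dX_mul ha hr] at d1
  rw [dX_mul hb hr] at d2
  simp only [linInfty₁, linInfty₂] at E1 E2
  rw [hρ]
  have key : (q.n1 * S + q.m2 * T) * (4 * (q.m1 * q.n1 + q.m2 * q.n2)) =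
      2 * q.m1 * q.m2 + 2 * q.n1 * q.n2 + q.m1 * dX q.n1 - dX q.m1 * q.n1
      + dX q.m2 * q.n2 - q.m2 * dX q.n2 := by
    linear_combination (-4 * (q.n1 * S + q.m2 * T)) * hP
      + 2 * rho0 q * (q.n1 * E1 + q.m2 * E2 - (q.n1 * S + q.m2 * T) * h3)
      - 2 * q.n1 * h2 - 2 * q.m2 * h1 + 2 * q.n1 * d1 + 2 * q.m2 * d2 + 2 * dX (rho0 q) * h3 + d3
  funext x t
  have hk := congrFun (congrFun key x) t
  exact (eq_div_iff (mul_ne_zero four_ne_zero (hn.1 x t).ne')).2 hk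

/-- The system is triangular: the second equation gives `T`, then the first gives `S`. Square roots
disappear because they enter only through their square and the derivative of this square. -/
theorem coeff_one_psRho_II (hn : Nondegenerate .II q) (hq : q.All Smooth) {Y Z : PowerSeries Fn}
    (hY : AllC Smooth Y) (hZ : AllC Smooth Z) (h : IsPSSolution .II PowerSeries.X 1 q Y Z)
    (h0 : PowerSeries.coeff 0 (psRho .II PowerSeries.X 1 q Y Z) = rho0 q) :
    PowerSeries.coeff 1 (psRho .II PowerSeries.X 1 q Y Z) = rhoBarM1 q := by
  obtain ⟨S, T, E1, E2, hρ⟩ := subleading_equations hn hq hY hZ h h0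
  obtain ⟨ha, hb⟩ := fieldClass_smooth.baseInfty hn hq
  obtain ⟨h1, h2, h3⟩ := hn.leadingRelations
  have hP := hn.rho0_mul_self
  have d1 := congrArg dX h1
  have d2 := congrArg dX h2
  have d3 := hn.dX_rho0 hq
  rw [dX_mul hq.1 ha] at d1
  rw [dX_mul hq.1 hb] at d2
  simp only [linInfty₁, linInfty₂] at E1 E2
  rw [hρ]
  dsimp only
  generalize baseInfty₁ .II q = a at *
  generalize baseInfty₂ .II q = b at *
  generalize hr : rho0 q = r at *
  have key : (q.m1 * S + b) * (4 * q.m1 * (q.m1 * q.n1 + q.m2 * q.n2)) =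
      2 * q.m1 ^ 2 * q.m2 + 2 * q.m1 * q.n1 * q.n2 - dX q.m2 * q.m1 * q.n2
      + 4 * dX q.m1 * q.m2 * q.n2 - 3 * dX q.n2 * q.m1 * q.m2
      + dX q.m1 * q.m1 * q.n1 - dX q.n1 * q.m1 ^ 2 := by
    linear_combination (-4 * q.m1 * (q.m1 * S + b) + 2 * dX q.m1 + 2 * q.m1 * b) * hP
      - 2 * q.m1 ^ 2 * r * E1 - 2 * q.m1 ^ 2 * q.m2 * E2 + 2 * q.m1 * q.m2 * d2
      + (-2 * q.m2 * dX q.m1 + 2 * q.m2 * (q.n2 + q.m1 * b)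
        - 2 * (q.m1 * q.n1 + q.m2 * q.n2)) * h2
      - 2 * q.m1 * r * d1 - q.m1 * d3 + (2 * r * dX q.m1 - 2 * r * q.m1 * b) * h1
  funext x t
  have hk := congrFun (congrFun key x) t
  exact (eq_div_iff (mul_ne_zero (mul_ne_zero four_ne_zero (hn.2 x t)) (hn.1 x t).ne')).2 hk

theorem swap_sum (q : Potential Fn) (x t : ℝ) : q.swap.m1 x t * q.swap.n1 x t
    + q.swap.m2 x t * q.swap.n2 x t = q.m1 x t * q.n1 x t + q.m2 x t * q.n2 x t := by
  simp only [Potential.swap]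
  ring

theorem coeff_one_psRho (hn : Nondegenerate c q) (hq : q.All Smooth) {Y Z : PowerSeries Fn}
    (hY : AllC Smooth Y) (hZ : AllC Smooth Z) (h : IsPSSolution c PowerSeries.X 1 q Y Z)
    (h0 : PowerSeries.coeff 0 (psRho c PowerSeries.X 1 q Y Z) = rho0 q) :
    PowerSeries.coeff 1 (psRho c PowerSeries.X 1 q Y Z) = c.rhoM1 q := by
  cases c
  · exact coeff_one_psRho_I hn hq hY hZ h h0
  · exact coeff_one_psRho_II hn hq hY hZ h h0
  -- Case III follows from Case II by exchanging the outer components of `Φ`, which leaves `m₁n₁ +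
  -- m₂n₂` unchanged.
  · have hr : rho0 q.swap = rho0 q := by
      funext x t
      rw [rho0, rho0, swap_sum]
    rw [psRho_swap] at h0 ⊢
    refine (coeff_one_psRho_II (q := q.swap) ⟨fun x t => ?_, hn.2⟩ hq.swap hZ hY
      (isPSSolution_swap.1 h) (h0.trans hr.symm)).trans ?_
    · rw [swap_sum]
      exact hn.1 x t
    · simp only [rhoBarM1, Chart.rhoM1, rhoHatM1, Potential.swap]
      congr 1 <;> ring

theorem IsExpansionInfty.lamCoeff_rho_zero (hn : Nondegenerate c q) (hq : q.All Smooth)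
    {y z : Fn⸨X⸩} (h : IsExpansionInfty c q y z) :
    lamCoeff (-1) (rho c (-1) q y z) 0 = c.rhoM1 q := by
  obtain ⟨Y, Z, rfl, rfl⟩ := h.1.exists_ps
  obtain ⟨⟨hY, hZ, hYZ⟩, h0⟩ := isExpansionInfty_iff.1 h
  exact (lamCoeff_rho_neg_one c q Y Z 1).trans (coeff_one_psRho hn hq hY hZ hYZ h0)

end SubleadingInfty

/-! ### Infinitely many independent conserved quantities -/

/-- Distinct characters of the multiplicative monoid of positive reals are linearly independent
(Dedekind); evaluation at `2` tells the powers apart. -/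
theorem linearIndependent_zpow :
    LinearIndependent ℝ fun (j : ℤ) (ε : {ε : ℝ // 0 < ε}) => (ε : ℝ) ^ j := by
  let χ : ℤ → ({ε : ℝ // 0 < ε} →* ℝ) := fun j =>
    { toFun := fun ε => (ε : ℝ) ^ j
      map_one' := by simp
      map_mul' := fun a b => by simp [mul_zpow] }
  have hχ : Function.Injective χ := fun i j h => by
    have h2 := DFunLike.congr_fun h ⟨2, two_pos⟩
    exact zpow_right_injective₀ two_pos (by norm_num) h2
  exact (linearIndependent_monoidHom {ε : ℝ // 0 < ε} ℝ).comp χ hχ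

theorem PowerSeries.exists_polynomial {ψ : PowerSeries ℝ}
    (h : {n | PowerSeries.coeff n ψ ≠ 0}.Finite) : ∃ p : Polynomial ℝ, (p : PowerSeries ℝ) = ψ := by
  obtain ⟨N, hN⟩ := h.bddAbove
  refine ⟨PowerSeries.trunc (N + 1) ψ, PowerSeries.ext fun n => ?_⟩
  rw [Polynomial.coeff_coe, PowerSeries.coeff_trunc]
  split_ifs with hn
  · rfl
  · by_contra hne
    exact hn (Nat.lt_succ_of_le (hN (Ne.symm hne)))

/-- On the family of constant potentials scaled by `ε`, the functional attached to the exponent `d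
n` is `ε ^ d n` times a fixed number. A linear relation becomes one between powers of `ε`, so it is
trivial on the exponents with nonzero number, and there are infinitely many of these unless `ψ` is a
polynomial. -/
theorem infinitelyManyIndependent_of_scaling {c : Chart} {s : ℤ}
    {E : Potential Fn → Fn⸨X⸩ → Fn⸨X⸩ → Prop} {ψ : PowerSeries ℝ} {d : ℕ → ℤ}
    (hd : Function.Injective d) (h : ∀ ε : ℝ, 0 < ε → ∃ q y z, q.All Smooth ∧
      q.All (PeriodicX 1) ∧ E q y z ∧
      ∀ n x t, lamCoeff s (rho c s q y z) (d n) x t = ε ^ d n * PowerSeries.coeff n ψ)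
    (hψ : ∀ p : Polynomial ℝ, (p : PowerSeries ℝ) ≠ ψ) : InfinitelyManyIndependent c s E := by
  refine ⟨d '' {n | PowerSeries.coeff n ψ ≠ 0}, ?_, fun w hw hsum => ?_⟩
  · refine Set.Infinite.image hd.injOn fun hfin => ?_
    obtain ⟨p, hp⟩ := PowerSeries.exists_polynomial hfin
    exact hψ p hp
  · have hr : ∀ j ∈ w.support, ∃ n, PowerSeries.coeff n ψ ≠ 0 ∧ d n = j := fun j hj => hw hj
    set r : ℤ → ℝ := Function.extend d (fun n => PowerSeries.coeff n ψ) 0 with hrdef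
    have key := linearIndependent_iff'.1 linearIndependent_zpow w.support (fun j => w j * r j) (by
      funext ε
      obtain ⟨q, y, z, hq, hq1, hE, hc⟩ := h ε ε.2
      refine Eq.trans ?_ (hsum q y z hq hq1 hE)
      rw [Finset.sum_apply]
      refine Finset.sum_congr rfl fun j hj => ?_
      obtain ⟨n, -, rfl⟩ := hr j hj
      simp only [hc, Pi.smul_apply, smul_eq_mul, intervalIntegral.integral_const, sub_zero, one_mul,
        hrdef, hd.extend_apply]
      ring)
    ext j
    by_contra hj
    obtain ⟨n, hn, rfl⟩ := hr j (Finsupp.mem_support_iff.2 hj)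
    have := key _ (Finsupp.mem_support_iff.2 hj)
    rw [hrdef, hd.extend_apply] at this
    exact mul_ne_zero hj hn this

/-! ### Expansions for constant potentials and their scaling. -/

section Scaling

variable {A : Type*} [CommRing A]

/-- The characteristic equation of the homogenized matrix `U`, for constant potentials. -/
theorem hDensity_cubic (c : Chart) {e l : A} {q : Potential A} {y z : A}
    (h1 : hFst c e l q y z = 0) (h2 : hSnd c e l q y z = 0) :
    hDensity c e l q y z ^ 3 =
      hDensity c e l q y z * (e ^ 2 + l ^ 2 * (q.m1 * q.n1 + q.m2 * q.n2))
        + e * l ^ 2 * (q.m1 * q.m2 + q.n1 * q.n2) := by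
  cases c
  · have e1 : l * q.m1 + e * z = y * hDensity .I e l q y z := sub_eq_zero.1 h1
    have e2 : e * y + l * q.n2 = z * hDensity .I e l q y z := sub_eq_zero.1 h2
    have e0 : hDensity .I e l q y z = l * q.n1 * y + l * q.m2 * z := rfl
    generalize hDensity .I e l q y z = ρ at *
    -- Cramer's rule: the multipliers are, up to sign, the cofactors of `ρ - U` along the column
    -- `c.den`, in which the eigenvector has entry `1`. The other two cases use the same device.
    linear_combination (ρ ^ 2 - e ^ 2) * e0 - (l * q.n1 * ρ + e * l * q.m2) * e1
      - (l * q.m2 * ρ + e * l * q.n1) * e2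
  · have e1 : l * q.n1 + l * q.m2 * z = y * hDensity .II e l q y z := sub_eq_zero.1 h1
    have e2 : e + l * q.n2 * y = z * hDensity .II e l q y z := sub_eq_zero.1 h2
    have e0 : hDensity .II e l q y z = l * q.m1 * y + e * z := rfl
    generalize hDensity .II e l q y z = ρ at *
    linear_combination (ρ ^ 2 - l ^ 2 * q.m2 * q.n2) * e0
      - (l * q.m1 * ρ + e * l * q.n2) * e1 - (e * ρ + l ^ 2 * q.m1 * q.m2) * e2
  · have e1 : l * q.m1 * z + e = y * hDensity .III e l q y z := sub_eq_zero.1 h1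
    have e2 : l * q.n1 * y + l * q.m2 = z * hDensity .III e l q y z := sub_eq_zero.1 h2
    have e0 : hDensity .III e l q y z = e * y + l * q.n2 * z := rfl
    generalize hDensity .III e l q y z = ρ at *
    linear_combination (ρ ^ 2 - l ^ 2 * q.m1 * q.n1) * e0
      - (e * ρ + l ^ 2 * q.n1 * q.n2) * e1 - (l * q.n2 * ρ + e * l * q.m1) * e2

theorem hFst_mul (c : Chart) (u e l : A) (q : Potential A) (y z : A) :
    hFst c e (l * u) q y z = hFst c e l (q.map (u * ·)) y z := by
  cases c <;> simp only [hFst, hDensity, Potential.map] <;> ring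

theorem hSnd_mul (c : Chart) (u e l : A) (q : Potential A) (y z : A) :
    hSnd c e (l * u) q y z = hSnd c e l (q.map (u * ·)) y z := by
  cases c <;> simp only [hSnd, hDensity, Potential.map] <;> ring

theorem hDensity_mul (c : Chart) (u e l : A) (q : Potential A) (y z : A) :
    hDensity c e (l * u) q y z = hDensity c e l (q.map (u * ·)) y z := by
  cases c <;> simp only [hDensity, Potential.map] <;> ring

theorem mul_hFst (c : Chart) (u e l : A) (q : Potential A) (y z : A) :
    u * hFst c e l q y z = hFst c (e * u) (l * u) q y z := by
  cases c <;> simp only [hFst, hDensity] <;> ring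

theorem mul_hSnd (c : Chart) (u e l : A) (q : Potential A) (y z : A) :
    u * hSnd c e l q y z = hSnd c (e * u) (l * u) q y z := by
  cases c <;> simp only [hSnd, hDensity] <;> ring

theorem mul_hDensity (c : Chart) (u e l : A) (q : Potential A) (y z : A) :
    u * hDensity c e l q y z = hDensity c (e * u) (l * u) q y z := by
  cases c <;> simp only [hDensity] <;> ring

end Scaling

/-- Constants, as functions of `(x, t)`. -/
def constFn : ℝ →+* Fn := algebraMap ℝ Fn

/-- Evaluation at the origin. -/
def evalOrigin : Fn →+* ℝ := (Pi.evalRingHom (fun _ => ℝ) 0).comp (Pi.evalRingHom (fun _ => ℝ → ℝ) 0)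

theorem constFn_apply (k x t : ℝ) : constFn k x t = k := rfl

theorem isConst_constFn (k : ℝ) : IsConst (constFn k) := ⟨k, rfl⟩

theorem evalOrigin_constFn (k : ℝ) : evalOrigin (constFn k) = k := rfl

theorem IsConst.constFn_evalOrigin {f : Fn} (hf : IsConst f) : constFn (evalOrigin f) = f := by
  obtain ⟨k, rfl⟩ := hf
  rfl

theorem IsConst.dX_eq_zero {f : Fn} (hf : IsConst f) : dX f = 0 := by
  obtain ⟨k, rfl⟩ := hf
  exact dX_const k

theorem dXs_eq_zero {Y : PowerSeries Fn} (hY : AllC IsConst Y) : dXs Y = 0 :=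
  PowerSeries.ext fun n => by
    rw [coeff_dXs, (hY n).dX_eq_zero, map_zero]

/-- Constant potentials. -/
def constPotential (k : Potential ℝ) : Potential Fn := k.map constFn

theorem constPotential_isConst (k : Potential ℝ) : (constPotential k).All IsConst :=
  ⟨isConst_constFn _, isConst_constFn _, isConst_constFn _, isConst_constFn _⟩

theorem IsPSSolution.evalOrigin {c : Chart} {e l : PowerSeries Fn} {k : Potential ℝ}
    {Y Z : PowerSeries Fn} (hY : AllC IsConst Y) (hZ : AllC IsConst Z)
    (h : IsPSSolution c e l (constPotential k) Y Z) :
    hFst c (PowerSeries.map evalOrigin e) (PowerSeries.map evalOrigin l) (k.map PowerSeries.C)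
        (PowerSeries.map evalOrigin Y) (PowerSeries.map evalOrigin Z) = 0 ∧
      hSnd c (PowerSeries.map evalOrigin e) (PowerSeries.map evalOrigin l) (k.map PowerSeries.C)
        (PowerSeries.map evalOrigin Y) (PowerSeries.map evalOrigin Z) = 0 := by
  obtain ⟨h1, h2⟩ := h
  have hk : ((constPotential k).map PowerSeries.C).map (PowerSeries.map FourCH.evalOrigin)
      = k.map PowerSeries.C := by
    simp only [constPotential, Potential.map, PowerSeries.map_C, evalOrigin_constFn]
  rw [dXs_eq_zero hY, mul_zero] at h1
  rw [dXs_eq_zero hZ, mul_zero] at h2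
  constructor
  · rw [← hk, ← map_hFst, ← h1, map_zero]
  · rw [← hk, ← map_hSnd, ← h2, map_zero]

/-- The substitution `X ↦ u X`, followed by the embedding of the constants. -/
def scaleConst (u : ℝ) : PowerSeries ℝ →+* PowerSeries Fn :=
  (PowerSeries.map constFn).comp (PowerSeries.rescale u)

theorem coeff_scaleConst (u : ℝ) (n : ℕ) (ψ : PowerSeries ℝ) :
    PowerSeries.coeff n (scaleConst u ψ) = constFn (u ^ n * PowerSeries.coeff n ψ) := by
  simp [scaleConst, PowerSeries.coeff_rescale]

theorem scaleConst_C (u k : ℝ) : scaleConst u (PowerSeries.C k) = PowerSeries.C (constFn k) := by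
  ext1 n
  rw [coeff_scaleConst, PowerSeries.coeff_C, PowerSeries.coeff_C]
  split_ifs with h
  · simp [h]
  · simp

theorem scaleConst_X (u : ℝ) :
    scaleConst u PowerSeries.X = PowerSeries.X * PowerSeries.C (constFn u) := by
  simp [scaleConst, mul_comm]

theorem allC_scaleConst (u : ℝ) (ψ : PowerSeries ℝ) : AllC IsConst (scaleConst u ψ) := fun n => by
  rw [coeff_scaleConst]
  exact isConst_constFn _

theorem map_scaleConst (u : ℝ) (k : Potential ℝ) :
    (k.map PowerSeries.C).map (scaleConst u) = (constPotential k).map PowerSeries.C := by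
  simp only [constPotential, Potential.map, scaleConst_C]

theorem map_constPotential (ε : ℝ) (k : Potential ℝ) :
    ((constPotential k).map PowerSeries.C).map (PowerSeries.C (constFn ε) * ·)
      = (constPotential (k.map (ε * ·))).map PowerSeries.C := by
  simp only [constPotential, Potential.map, map_mul]

theorem IsConst.bdd {f : Fn} (hf : IsConst f) : Bdd f := (hf.bdd_and_periodic 0).1

/-- In `U` the potentials occur only multiplied by `λ`, so the expansion for `εk` arises from that
for `k` by the substitution `λ ↦ ελ`. Coefficients of a constant expansion are reduced to real
numbers by evaluation at the origin, which makes the derivative terms disappear and leaves the cubic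
over `ℝ`. -/
theorem exists_scaling_zero (c : Chart) (k : Potential ℝ) : ∃ ψ : PowerSeries ℝ,
    ψ ^ 3 = ψ * (1 + PowerSeries.X ^ 2 * PowerSeries.C (k.m1 * k.n1 + k.m2 * k.n2))
      + PowerSeries.X ^ 2 * PowerSeries.C (k.m1 * k.m2 + k.n1 * k.n2) ∧
    ∀ ε : ℝ, ∃ y z, IsExpansionZero c (constPotential (k.map (ε * ·))) y z ∧
      ∀ n : ℕ, lamCoeff 1 (rho c 1 (constPotential (k.map (ε * ·))) y z) n
        = constFn (ε ^ n * PowerSeries.coeff n ψ) := by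
  obtain ⟨S, T, hS, hT, h⟩ := exists_expansionZero resolventClass_isConst c (constPotential_isConst k)
  have hr := resolventClass_isConst.rngClass
  have hY := hr.allC_add (hr.allC_C c.isConst_base.1) (hr.allC_X_mul hS)
  have hZ := hr.allC_add (hr.allC_C c.isConst_base.2) (hr.allC_X_mul hT)
  generalize PowerSeries.C c.base₁ + PowerSeries.X * S = Y at *
  generalize PowerSeries.C c.base₂ + PowerSeries.X * T = Z at *
  obtain ⟨⟨-, -, hYZ⟩, h0⟩ := isExpansionZero_iff.1 h
  obtain ⟨h1, h2⟩ := hYZ.evalOrigin hY hZ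
  have h3 := congrArg evalOrigin h0
  rw [← PowerSeries.coeff_map, psRho, map_hDensity] at h3
  have hk : ((constPotential k).map PowerSeries.C).map (PowerSeries.map evalOrigin)
      = k.map PowerSeries.C := by
    simp only [constPotential, Potential.map, PowerSeries.map_C, evalOrigin_constFn]
  rw [hk] at h3
  rw [map_one, PowerSeries.map_X] at h1 h2 h3
  generalize PowerSeries.map evalOrigin Y = y at *
  generalize PowerSeries.map evalOrigin Z = z at *
  have hcub := hDensity_cubic c h1 h2
  refine ⟨hDensity c 1 PowerSeries.X (k.map PowerSeries.C) y z, ?_, fun ε => ?_⟩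
  · simpa only [Potential.map, one_pow, one_mul, map_add, map_mul] using hcub
  have e1 := congrArg (scaleConst ε) h1
  have e2 := congrArg (scaleConst ε) h2
  have e3 : psRho c 1 PowerSeries.X (constPotential (k.map (ε * ·))) (scaleConst ε y)
      (scaleConst ε z) = scaleConst ε (hDensity c 1 PowerSeries.X (k.map PowerSeries.C) y z) := by
    rw [map_hDensity, map_one, scaleConst_X, map_scaleConst, hDensity_mul, map_constPotential,
      psRho]
  rw [map_hFst, map_one, scaleConst_X, map_scaleConst, hFst_mul, map_constPotential,
    map_zero] at e1
  rw [map_hSnd, map_one, scaleConst_X, map_scaleConst, hSnd_mul, map_constPotential,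
    map_zero] at e2
  refine ⟨toLS (scaleConst ε y), toLS (scaleConst ε z), isExpansionZero_iff.2 ⟨⟨?_, ?_, ?_, ?_⟩, ?_⟩,
    fun n => ?_⟩
  · exact (allC_scaleConst ε y).mono fun _ h => h.bdd
  · exact (allC_scaleConst ε z).mono fun _ h => h.bdd
  · rw [dXs_eq_zero (allC_scaleConst ε y), mul_zero, e1]
  · rw [dXs_eq_zero (allC_scaleConst ε z), mul_zero, e2]
  · rw [e3, coeff_scaleConst, pow_zero, one_mul, h3, IsConst.constFn_evalOrigin]
    cases c
    exacts [⟨0, rfl⟩, ⟨1, rfl⟩, ⟨1, rfl⟩]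
  · rw [lamCoeff_rho_one, e3, coeff_scaleConst]

theorem nondegenerate_constPotential (c : Chart) {k : Potential ℝ}
    (hk : 0 < k.m1 * k.n1 + k.m2 * k.n2) (h1 : k.m1 ≠ 0) (h2 : k.n2 ≠ 0) :
    Nondegenerate c (constPotential k) :=
  ⟨fun _ _ => hk, by
    cases c
    exacts [trivial, fun _ _ => h1, fun _ _ => h2]⟩

/-- Here `λ ↦ ελ` means `X ↦ ε⁻¹X`, and the power series is `λ⁻¹ρ`, which brings in the prefactor
`ε`; hence the exponent `1 - n`. Positivity of `ε` keeps the chosen branch of the square root. -/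
theorem exists_scaling_infty (c : Chart) {k : Potential ℝ} (hk : 0 < k.m1 * k.n1 + k.m2 * k.n2)
    (hm : k.m1 ≠ 0) (hn : k.n2 ≠ 0) : ∃ ψ : PowerSeries ℝ,
    ψ ^ 3 = ψ * (PowerSeries.X ^ 2 + PowerSeries.C (k.m1 * k.n1 + k.m2 * k.n2))
      + PowerSeries.X * PowerSeries.C (k.m1 * k.m2 + k.n1 * k.n2) ∧
    PowerSeries.coeff 0 ψ = √(k.m1 * k.n1 + k.m2 * k.n2) ∧
    ∀ ε : ℝ, 0 < ε → Nondegenerate c (constPotential (k.map (ε * ·))) ∧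
      ∃ y z, IsExpansionInfty c (constPotential (k.map (ε * ·))) y z ∧
      ∀ n : ℕ, lamCoeff (-1) (rho c (-1) (constPotential (k.map (ε * ·))) y z) (1 - n)
        = constFn (ε ^ (1 - n : ℤ) * PowerSeries.coeff n ψ) := by
  have hkk : ((constPotential k).map PowerSeries.C).map (PowerSeries.map evalOrigin)
      = k.map PowerSeries.C := by
    simp only [constPotential, Potential.map, PowerSeries.map_C, evalOrigin_constFn]
  obtain ⟨Y, Z, hY, hZ, hYZ, h0⟩ := exists_psSolution_infty fieldClass_isConst
    (nondegenerate_constPotential c hk hm hn) (constPotential_isConst k)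
  obtain ⟨h1, h2⟩ := hYZ.evalOrigin hY hZ
  have h3 := congrArg evalOrigin h0
  rw [← PowerSeries.coeff_map, psRho, map_hDensity, hkk] at h3
  rw [map_one, PowerSeries.map_X] at h1 h2 h3
  generalize PowerSeries.map evalOrigin Y = y at *
  generalize PowerSeries.map evalOrigin Z = z at *
  have hcub := hDensity_cubic c h1 h2
  refine ⟨hDensity c PowerSeries.X 1 (k.map PowerSeries.C) y z, ?_, h3, fun ε hε => ⟨?_, ?_⟩⟩
  · simpa only [Potential.map, one_pow, one_mul, mul_one, map_add, map_mul] using hcub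
  · refine nondegenerate_constPotential c ?_ (mul_ne_zero hε.ne' hm) (mul_ne_zero hε.ne' hn)
    have : 0 < ε ^ 2 * (k.m1 * k.n1 + k.m2 * k.n2) := by positivity
    simp only [Potential.map]
    linarith
  have hX : PowerSeries.X * PowerSeries.C (constFn ε⁻¹) * PowerSeries.C (constFn ε)
      = PowerSeries.X := by
    rw [mul_assoc, ← map_mul, ← map_mul, inv_mul_cancel₀ hε.ne', map_one, map_one, mul_one]
  have e1 := congrArg (fun f => PowerSeries.C (constFn ε) * scaleConst ε⁻¹ f) h1
  have e2 := congrArg (fun f => PowerSeries.C (constFn ε) * scaleConst ε⁻¹ f) h2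
  have e3 : psRho c PowerSeries.X 1 (constPotential (k.map (ε * ·))) (scaleConst ε⁻¹ y)
      (scaleConst ε⁻¹ z) = PowerSeries.C (constFn ε) *
        scaleConst ε⁻¹ (hDensity c PowerSeries.X 1 (k.map PowerSeries.C) y z) := by
    rw [map_hDensity, map_one, scaleConst_X, map_scaleConst, mul_hDensity, hX, hDensity_mul,
      map_constPotential, psRho]
  simp only [map_zero, mul_zero] at e1 e2
  rw [map_hFst, map_one, scaleConst_X, map_scaleConst, mul_hFst, hX, hFst_mul,
    map_constPotential] at e1
  rw [map_hSnd, map_one, scaleConst_X, map_scaleConst, mul_hSnd, hX, hSnd_mul,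
    map_constPotential] at e2
  have e4 : ∀ n : ℕ, PowerSeries.coeff n (psRho c PowerSeries.X 1 (constPotential (k.map (ε * ·)))
      (scaleConst ε⁻¹ y) (scaleConst ε⁻¹ z)) = constFn (ε ^ (1 - n : ℤ) *
        PowerSeries.coeff n (hDensity c PowerSeries.X 1 (k.map PowerSeries.C) y z)) := by
    intro n
    rw [e3, PowerSeries.coeff_C_mul, coeff_scaleConst, ← map_mul, zpow_sub₀ hε.ne', zpow_one,
      zpow_natCast, inv_pow, div_eq_mul_inv, mul_assoc]
  refine ⟨toLS (scaleConst ε⁻¹ y), toLS (scaleConst ε⁻¹ z),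
    isExpansionInfty_iff.2 ⟨⟨?_, ?_, ?_, ?_⟩, ?_⟩, fun n => ?_⟩
  · exact (allC_scaleConst _ y).mono fun _ h => h.bdd.smooth
  · exact (allC_scaleConst _ z).mono fun _ h => h.bdd.smooth
  · rw [dXs_eq_zero (allC_scaleConst _ y), mul_zero, e1]
  · rw [dXs_eq_zero (allC_scaleConst _ z), mul_zero, e2]
  · rw [e4, h3]
    funext x t
    simp only [constFn_apply, rho0, constPotential, Potential.map, Nat.cast_zero, sub_zero,
      zpow_one]
    change ε * √(k.m1 * k.n1 + k.m2 * k.n2) = _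
    rw [show ε * k.m1 * (ε * k.n1) + ε * k.m2 * (ε * k.n2)
      = ε ^ 2 * (k.m1 * k.n1 + k.m2 * k.n2) by ring, Real.sqrt_mul (sq_nonneg ε),
      Real.sqrt_sq hε.le]
  · rw [lamCoeff_rho_neg_one, e4]

/-! ### The roots of the two cubics are not polynomials. -/

theorem cube_ne_self_add_sq (p : Polynomial ℝ) : p ^ 3 ≠ p + Polynomial.X ^ 2 := by
  intro h
  -- If `d` is the degree, then `3d ≤ max(d, 2)`, so `d = 0`; the values at `0` and `1` then
  -- contradict each other.
  have h1 : p.natDegree = 0 := by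
    have hd := congrArg Polynomial.natDegree h
    have h2 := Polynomial.natDegree_add_le p (Polynomial.X ^ 2)
    rw [Polynomial.natDegree_pow] at hd
    rw [Polynomial.natDegree_X_pow] at h2
    omega
  rw [Polynomial.eq_C_of_natDegree_eq_zero h1] at h
  have e0 := congrArg (Polynomial.eval 0) h
  have e1 := congrArg (Polynomial.eval 1) h
  simp at e0 e1
  linarith

/-- Comparing degrees leaves `p = bX + a`. The cubic does have the polynomial root `-X`, so only the
constant term can be controlled: four evaluations give `a(3b² - 1) = 0` and `b(b² - 1) = 0`, which
force `a = 0`. -/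
theorem coeff_zero_of_cube_eq {p : Polynomial ℝ}
    (h : p ^ 3 = p * (Polynomial.X ^ 2 + Polynomial.C 2) + Polynomial.X * Polynomial.C 2) :
    p.coeff 0 = 0 := by
  have h1 : p.natDegree ≤ 1 := by
    have hd := congrArg Polynomial.natDegree h
    have h2 := Polynomial.natDegree_add_le (p * (Polynomial.X ^ 2 + Polynomial.C 2))
      (Polynomial.X * Polynomial.C 2)
    have h3 := Polynomial.natDegree_mul_le (p := p) (q := Polynomial.X ^ 2 + Polynomial.C 2)
    have h4 : (Polynomial.X ^ 2 + Polynomial.C 2 : Polynomial ℝ).natDegree = 2 :=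
      Polynomial.natDegree_X_pow_add_C
    have h5 : (Polynomial.X * Polynomial.C 2 : Polynomial ℝ).natDegree ≤ 1 :=
      Polynomial.natDegree_mul_C_le _ _ |>.trans Polynomial.natDegree_X_le
    rw [Polynomial.natDegree_pow] at hd
    omega
  obtain ⟨b, a, rfl⟩ := Polynomial.exists_eq_X_add_C_of_natDegree_le_one h1
  have e0 := congrArg (Polynomial.eval 0) h
  have e1 := congrArg (Polynomial.eval 1) h
  have e2 := congrArg (Polynomial.eval (-1)) h
  have e3 := congrArg (Polynomial.eval 2) h
  simp at e0 e1 e2 e3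
  have f1 : a * (3 * b ^ 2 - 1) = 0 := by linear_combination e1 / 2 + e2 / 2 - e0
  have f2 : b * (b ^ 2 - 1) = 0 := by linear_combination (e3 - e0) / 6 - (e1 - e0) / 3 - f1 / 3
  have f3 : a = 0 := by
    rcases mul_eq_zero.1 f1 with h | h
    · exact h
    · rcases mul_eq_zero.1 f2 with h' | h'
      · rw [h'] at h
        norm_num at h
      · linarith
  simpa using f3

theorem infinitelyManyIndependent_zero (c : Chart) :
    InfinitelyManyIndependent c 1 (fun q y z => IsExpansionZero c q y z) := by
  -- With these values `m₁n₁ + m₂n₂ = 0` and `m₁m₂ + n₁n₂ = 1`, so the cubic becomes `ψ³ = ψ + X²`.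
  obtain ⟨ψ, hψ, h⟩ := exists_scaling_zero c ⟨1, 1, 0, 0⟩
  refine infinitelyManyIndependent_of_scaling (ψ := ψ) (d := fun n => (n : ℤ)) Nat.cast_injective
    (fun ε _ => ?_) fun p hp => cube_ne_self_add_sq p ?_
  · obtain ⟨y, z, hE, hc⟩ := h ε
    have hq := constPotential_isConst (Potential.map (ε * ·) ⟨1, 1, 0, 0⟩)
    refine ⟨_, y, z, hq.mono fun _ h => h.bdd.smooth, hq.mono fun _ h => (h.bdd_and_periodic 1).2,
      hE, fun n x t => ?_⟩
    rw [hc, constFn_apply, zpow_natCast]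
  · apply Polynomial.coe_injective ℝ
    rw [← hp] at hψ
    simpa using hψ

theorem infinitelyManyIndependent_infty (c : Chart) :
    InfinitelyManyIndependent c (-1)
      (fun q y z => Nondegenerate c q ∧ IsExpansionInfty c q y z) := by
  -- All potentials equal to `1` meets every nondegeneracy condition. The constant term of `ψ` is
  -- then `√2`, which excludes the polynomial roots of the cubic.
  obtain ⟨ψ, hψ, h0, h⟩ := exists_scaling_infty c (k := ⟨1, 1, 1, 1⟩) (by norm_num) one_ne_zero
    one_ne_zero
  refine infinitelyManyIndependent_of_scaling (ψ := ψ) (d := fun n => 1 - (n : ℤ))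
    (fun a b hab => by simpa using hab) (fun ε hε => ?_) fun p hp => ?_
  · obtain ⟨hn, y, z, hE, hc⟩ := h ε hε
    have hq := constPotential_isConst (Potential.map (ε * ·) ⟨1, 1, 1, 1⟩)
    refine ⟨_, y, z, hq.mono fun _ h => h.bdd.smooth, hq.mono fun _ h => (h.bdd_and_periodic 1).2,
      ⟨hn, hE⟩, fun n x t => ?_⟩
    rw [hc, constFn_apply]
  · rw [← hp] at hψ h0
    have h2 : p.coeff 0 = 0 := by
      refine coeff_zero_of_cube_eq (Polynomial.coe_injective ℝ ?_)
      norm_num at hψ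
      simp only [Polynomial.X_mul_C, Polynomial.coe_pow, Polynomial.coe_add, Polynomial.coe_mul,
        Polynomial.coe_X, Polynomial.coe_C]
      rw [hψ, mul_comm PowerSeries.X (PowerSeries.C 2)]
    rw [Polynomial.coeff_coe, h2] at h0
    norm_num at h0
    exact (Real.sqrt_pos.2 two_pos).ne h0

/-! ### Conserved densities for a fixed value of the spectral parameter -/

section LogDerivative

variable {F : ℝ × ℝ → ℂ}

theorem hasDerivAt_fst_of_contDiff {n : ℕ∞} (hF : ContDiff ℝ n F) (hn : n ≠ 0) (x t : ℝ) :
    HasDerivAt (fun x' => F (x', t)) (fderiv ℝ F (x, t) (1, 0)) x :=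
  ((hF.differentiable (by exact_mod_cast hn)).differentiableAt.hasFDerivAt).comp_hasDerivAt
    (f := fun x' => (x', t)) x ((hasDerivAt_id x).prodMk (hasDerivAt_const x t))

theorem hasDerivAt_snd_of_contDiff {n : ℕ∞} (hF : ContDiff ℝ n F) (hn : n ≠ 0) (x t : ℝ) :
    HasDerivAt (fun t' => F (x, t')) (fderiv ℝ F (x, t) (0, 1)) t :=
  ((hF.differentiable (by exact_mod_cast hn)).differentiableAt.hasFDerivAt).comp_hasDerivAt
    (f := fun t' => (x, t')) t ((hasDerivAt_const t x).prodMk (hasDerivAt_id t))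

theorem fderiv_fderiv_apply (hF : ContDiff ℝ 2 F) (z v w : ℝ × ℝ) :
    fderiv ℝ (fun z => fderiv ℝ F z v) z w = fderiv ℝ (fderiv ℝ F) z w v := by
  have hd : DifferentiableAt ℝ (fderiv ℝ F) z :=
    ((hF.fderiv_right (m := 1) (by norm_num)).differentiable one_ne_zero).differentiableAt
  rw [(hd.hasFDerivAt.clm_apply (hasFDerivAt_const v z)).fderiv]
  simp

theorem contDiff_fderiv_apply (hF : ContDiff ℝ 2 F) (v : ℝ × ℝ) :
    ContDiff ℝ 1 (fun z => fderiv ℝ F z v) :=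
  (hF.fderiv_right (m := 1) (by norm_num)).clm_apply contDiff_const

/-- The mixed second derivative of `ln F`. -/
def logMixed (F : ℝ × ℝ → ℂ) (z : ℝ × ℝ) : ℂ :=
  (fderiv ℝ (fderiv ℝ F) z (0, 1) (1, 0) * F z - fderiv ℝ F z (1, 0) * fderiv ℝ F z (0, 1))
    / F z ^ 2

theorem logDeriv_fst (hF : ContDiff ℝ 2 F) (x t : ℝ) :
    logDeriv (fun x' => F (x', t)) x = fderiv ℝ F (x, t) (1, 0) / F (x, t) := by
  rw [logDeriv_apply, (hasDerivAt_fst_of_contDiff (n := 2) hF two_ne_zero x t).deriv]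

theorem logDeriv_snd (hF : ContDiff ℝ 2 F) (x t : ℝ) :
    logDeriv (fun t' => F (x, t')) t = fderiv ℝ F (x, t) (0, 1) / F (x, t) := by
  rw [logDeriv_apply, (hasDerivAt_snd_of_contDiff (n := 2) hF two_ne_zero x t).deriv]

theorem hasDerivAt_logDeriv_fst (hF : ContDiff ℝ 2 F) {x t : ℝ} (h : F (x, t) ≠ 0) :
    HasDerivAt (fun t' => logDeriv (fun x' => F (x', t')) x) (logMixed F (x, t)) t := by
  simp only [logDeriv_fst hF]
  have h1 := hasDerivAt_snd_of_contDiff (n := 1) (contDiff_fderiv_apply hF (1, 0)) one_ne_zero x t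
  rw [fderiv_fderiv_apply hF] at h1
  exact h1.fun_div (hasDerivAt_snd_of_contDiff (n := 2) hF two_ne_zero x t) h

/-- Symmetry of the second derivative makes this the same value as for the opposite order of
differentiation. No branch of the logarithm is needed. -/
theorem hasDerivAt_logDeriv_snd (hF : ContDiff ℝ 2 F) {x t : ℝ} (h : F (x, t) ≠ 0) :
    HasDerivAt (fun x' => logDeriv (fun t' => F (x', t')) t) (logMixed F (x, t)) x := by
  simp only [logDeriv_snd hF]
  have h1 := hasDerivAt_fst_of_contDiff (n := 1) (contDiff_fderiv_apply hF (0, 1)) one_ne_zero x t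
  rw [fderiv_fderiv_apply hF, (hF.contDiffAt.isSymmSndFDerivAt (by simp)).eq] at h1
  rw [logMixed, mul_comm (fderiv ℝ F (x, t) (1, 0))]
  exact h1.fun_div (hasDerivAt_fst_of_contDiff (n := 2) hF two_ne_zero x t) h

theorem continuousOn_logMixed (hF : ContDiff ℝ 2 F) : ContinuousOn (logMixed F) {z | F z ≠ 0} := by
  have h1 : Continuous (fun z => fderiv ℝ (fderiv ℝ F) z (0, 1) (1, 0)) := by
    simp only [← fderiv_fderiv_apply hF]
    exact ((contDiff_fderiv_apply hF (1, 0)).continuous_fderiv one_ne_zero).clm_apply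
      continuous_const
  have h2 := fun v => (contDiff_fderiv_apply hF v).continuous
  exact ((h1.mul hF.continuous).sub ((h2 _).mul (h2 _))).continuousOn.div
    (hF.continuous.pow 2).continuousOn fun z hz => pow_ne_zero 2 hz

theorem hasDerivAt_integral_logDeriv (hF : ContDiff ℝ 2 F) {a b t : ℝ}
    (h : ∀ x ∈ Set.uIcc a b, F (x, t) ≠ 0) :
    HasDerivAt (fun t' => ∫ x in a..b, logDeriv (fun x' => F (x', t')) x)
      (logDeriv (fun t' => F (b, t')) t - logDeriv (fun t' => F (a, t')) t) t := by
  have hc := continuousOn_logMixed hF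
  -- By compactness of the interval, nonvanishing at time `t` persists for nearby times, which is
  -- what differentiation under the integral needs.
  have hev : ∀ᶠ t' in 𝓝 t, ∀ x ∈ Set.uIcc a b, F (x, t') ≠ 0 := by
    refine isCompact_uIcc.eventually_forall_of_forall_eventually fun x hx => ?_
    have : Continuous (fun z : ℝ × ℝ => F (z.2, z.1)) := hF.continuous.comp continuous_swap
    exact this.continuousAt.eventually_ne (h x hx)
  obtain ⟨δ, hδ, hball⟩ := Metric.nhds_basis_closedBall.eventually_iff.1 hev
  have hsub : ∀ x ∈ Set.uIcc a b, ContinuousAt (logMixed F) (x, t) := fun x hx =>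
    hc.continuousAt ((isOpen_ne_fun hF.continuous continuous_const).mem_nhds (h x hx))
  have hint : ∫ x in a..b, logMixed F (x, t)
      = logDeriv (fun t' => F (b, t')) t - logDeriv (fun t' => F (a, t')) t := by
    refine intervalIntegral.integral_eq_sub_of_hasDerivAt
      (f := fun x => logDeriv (fun t' => F (x, t')) t)
      (fun x hx => hasDerivAt_logDeriv_snd hF (h x hx)) ?_
    refine ContinuousOn.intervalIntegrable fun x hx => ?_
    exact ((hsub x hx).comp (f := fun x => (x, t)) (by fun_prop)).continuousWithinAt
  rw [← hint]
  refine hasDerivAt_intervalIntegral (f := fun x t' => logDeriv (fun x' => F (x', t')) x)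
    (f' := fun x t' => logMixed F (x, t')) hδ ?_ ?_ ?_
  · intro s hs
    simp only [logDeriv_fst hF]
    refine ContinuousOn.div ?_ ?_ fun x hx => hball hs x hx
    · exact ((contDiff_fderiv_apply hF (1, 0)).continuous.comp
        (Continuous.prodMk_left s)).continuousOn
    · exact (hF.continuous.comp (Continuous.prodMk_left s)).continuousOn
  · exact hc.mono fun z hz => hball hz.2 z.1 hz.1
  · exact fun x hx s hs => hasDerivAt_logDeriv_fst hF (hball hs x hx)

end LogDerivative

theorem evalAt_single (l : ℂ) (x t : ℝ) (j : ℤ) (f : Fn) :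
    evalAt l x t (.single j f) = (f x t : ℂ) * l ^ j :=
  Finsupp.sum_single_index (by simp)

theorem laxU_map_evalAt (l : ℂ) (x t : ℝ) (q : Potential Fn) :
    (laxU q).map (evalAt l x t) = spectralU l (q.map fun f => (f x t : ℂ)) := by
  have hm : ∀ f : Fn, evalAt l x t (LaurentPolynomial.T 1 * LaurentPolynomial.C f)
      = l * (f x t : ℂ) := fun f => by
    rw [mul_comm, ← LaurentPolynomial.single_eq_C_mul_T, evalAt_single, zpow_one, mul_comm]
  have h0 : evalAt l x t 0 = 0 := Finsupp.sum_zero_index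
  have h1 : evalAt l x t 1 = 1 := (evalAt_single l x t 0 1).trans (by simp)
  ext1 i j
  fin_cases i <;> fin_cases j
  exacts [h0, hm _, h1, hm _, h0, hm _, h1, hm _, h0]

theorem Chart.smul_vec (c : Chart) {v : Fin 3 → ℂ} (h : v c.den ≠ 0) :
    v c.den • c.vec (v c.fst / v c.den) (v c.snd / v c.den) = v := by
  funext i
  cases c <;> simp only [Chart.den] at h <;> fin_cases i <;>
    simp [Chart.vec, Chart.den, Chart.fst, Chart.snd, mul_div_cancel₀, h]

theorem Chart.mulVec_div (c : Chart) {v : Fin 3 → ℂ} (h : v c.den ≠ 0)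
    (M : Matrix (Fin 3) (Fin 3) ℂ) (i : Fin 3) :
    M.mulVec v i / v c.den = M.mulVec (c.vec (v c.fst / v c.den) (v c.snd / v c.den)) i := by
  conv_lhs => rw [← c.smul_vec h, Matrix.mulVec_smul]
  have h' : (v c.den • c.vec (v c.fst / v c.den) (v c.snd / v c.den)) c.den = v c.den :=
    congrFun (c.smul_vec h) _
  rw [h', Pi.smul_apply, smul_eq_mul, mul_div_cancel_left₀ _ h]

/-- Dividing the two linear equations by `φ_den` gives the logarithmic derivatives, and the quotient
rule gives the Riccati-type equations. Equality of the cross derivatives needs only that `Φ` is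
`C²`. -/
theorem conserved_density {q : Potential Fn} {V : LaxMatrix} {l : ℂ} {Φ : ℝ → ℝ → Fin 3 → ℂ}
    (hΦ : ∀ i, ContDiff ℝ 2 (fun z : ℝ × ℝ => Φ z.1 z.2 i))
    (hx : ∀ x t i, HasDerivAt (fun y => Φ y t i)
      (((laxU q).map (evalAt l x t)).mulVec (Φ x t) i) x)
    (ht : ∀ x t i, HasDerivAt (fun s => Φ x s i)
      ((V.map (evalAt l x t)).mulVec (Φ x t) i) t)
    (c : Chart) (x t : ℝ) (h : Φ x t c.den ≠ 0) :
    let qxt : Potential ℂ := q.map (fun f => (f x t : ℂ))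
    let y : ℂ := Φ x t c.fst / Φ x t c.den
    let z : ℂ := Φ x t c.snd / Φ x t c.den
    logDeriv (fun x' => Φ x' t c.den) x = density c l qxt y z ∧
    logDeriv (fun t' => Φ x t' c.den) t = flux c (V.map (evalAt l x t)) y z ∧
    HasDerivAt (fun x' => Φ x' t c.fst / Φ x' t c.den) (riccatiFst c l qxt y z) x ∧
    HasDerivAt (fun x' => Φ x' t c.snd / Φ x' t c.den) (riccatiSnd c l qxt y z) x ∧
    ∃ D : ℂ,
      HasDerivAt (fun t' => logDeriv (fun x' => Φ x' t' c.den) x) D t ∧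
      HasDerivAt (fun x' => logDeriv (fun t' => Φ x' t' c.den) t) D x := by
  intro qxt y z
  have hd : ∀ i, HasDerivAt (fun x' => Φ x' t i / Φ x' t c.den)
      ((spectralU l qxt).mulVec (c.vec y z) i - density c l qxt y z * (Φ x t i / Φ x t c.den)) x := by
    intro i
    have h1 := (hx x t i).fun_div (hx x t c.den) h
    rw [laxU_map_evalAt] at h1
    refine h1.congr_deriv ?_
    rw [density_eq_mulVec, ← c.mulVec_div h, ← c.mulVec_div h]
    field_simp
    ring
  refine ⟨?_, ?_, ?_, ?_, logMixed (fun z : ℝ × ℝ => Φ z.1 z.2 c.den) (x, t),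
    hasDerivAt_logDeriv_fst (hΦ c.den) h, hasDerivAt_logDeriv_snd (hΦ c.den) h⟩
  · rw [logDeriv_apply, (hx x t c.den).deriv, laxU_map_evalAt, c.mulVec_div h, density_eq_mulVec]
  · rw [logDeriv_apply, (ht x t c.den).deriv, c.mulVec_div h, flux_eq_mulVec]
  · rw [riccatiFst_eq_mulVec]
    exact hd c.fst
  · rw [riccatiSnd_eq_mulVec]
    exact hd c.snd

/-! ### The Camassa–Holm type systems as flows of the hierarchy -/

section ZeroCurvature

/-- A purely algebraic form: `T, S` stand for `λ, λ⁻¹`, primes for `t`-derivatives, `kᵢ, lᵢ` for the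
`x`-derivatives of `Γmᵢ, Γnᵢ`, and the derivatives of `fᵢ, gᵢ` are already replaced by their
first-order relations. Every entry cancels modulo `TS = 1` except the four proportional to `T`,
which are the four equations of the system. -/
theorem zeroCurvature_eq {A : Type*} [CommRing A] {T S : A} (hTS : T * S = 1)
    (m₁ m₂ n₁ n₂ f₁ f₂ g₁ g₂ Γ m₁' m₂' n₁' n₂' k₁ k₂ l₁ l₂ : A) :
    !![0, T * m₁', 0; T * n₁', 0, T * m₂'; 0, T * n₂', 0]
      - !![-((n₁ - g₂) * g₁ + f₁ * (f₂ - m₁)), (f₂ - m₁) * S - k₁ * T,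
            -((f₂ - m₁) * g₂ + g₁ * (m₂ - f₁));
          (n₁ - g₂) * S - l₁ * T, (n₁ - g₂) * g₁ + f₁ * (f₂ - m₁)
            + ((g₁ - n₂) * g₂ + f₂ * (m₂ - f₁)), (m₂ - f₁) * S - k₂ * T;
          -((n₁ - g₂) * f₂ + f₁ * (g₁ - n₂)), (g₁ - n₂) * S - l₂ * T,
            -((g₁ - n₂) * g₂ + f₂ * (m₂ - f₁))]
      + (!![0, T * m₁, 1; T * n₁, 0, T * m₂; 1, T * n₂, 0]
          * !![-(f₁ * g₁), g₁ * S - m₁ * Γ * T, -(g₁ * g₂);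
              f₁ * S - n₁ * Γ * T, f₁ * g₁ + f₂ * g₂ - S * S, g₂ * S - m₂ * Γ * T;
              -(f₁ * f₂), f₂ * S - n₂ * Γ * T, -(f₂ * g₂)]
        - !![-(f₁ * g₁), g₁ * S - m₁ * Γ * T, -(g₁ * g₂);
              f₁ * S - n₁ * Γ * T, f₁ * g₁ + f₂ * g₂ - S * S, g₂ * S - m₂ * Γ * T;
              -(f₁ * f₂), f₂ * S - n₂ * Γ * T, -(f₂ * g₂)]
          * !![0, T * m₁, 1; T * n₁, 0, T * m₂; 1, T * n₂, 0]) =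
    !![0, (m₁' + k₁ + n₂ * (g₁ * g₂ - Γ) + m₁ * (f₂ * g₂ + 2 * f₁ * g₁)) * T, 0;
      (n₁' + l₁ - m₂ * (f₁ * f₂ - Γ) - n₁ * (f₂ * g₂ + 2 * f₁ * g₁)) * T, 0,
        (m₂' + k₂ - n₁ * (g₁ * g₂ - Γ) - m₂ * (f₁ * g₁ + 2 * f₂ * g₂)) * T;
      0, (n₂' + l₂ + m₁ * (f₁ * f₂ - Γ) + n₂ * (f₁ * g₁ + 2 * f₂ * g₂)) * T, 0] := by
  ext i j
  fin_cases i <;> fin_cases j <;> simp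
  · linear_combination (m₁ * f₁ - g₁ * n₁) * hTS
  · linear_combination (-S * m₁) * hTS
  · linear_combination (m₁ * g₂ - g₁ * m₂) * hTS
  · linear_combination (S * n₁) * hTS
  · linear_combination (n₁ * g₁ + m₂ * f₂ - f₁ * m₁ - g₂ * n₂) * hTS
  · linear_combination (S * m₂) * hTS
  · linear_combination (n₂ * f₁ - f₂ * n₁) * hTS
  · linear_combination (-S * n₂) * hTS
  · linear_combination (n₂ * g₂ - f₂ * m₂) * hTS

end ZeroCurvature

open LaurentPolynomial

theorem mapCoeff_single (D : ZeroHom Fn Fn) (j : ℤ) (f : Fn) :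
    mapCoeff D (.single j f) = .single j (D f) :=
  congrArg AddMonoidAlgebra.ofCoeff (Finsupp.mapRange_single (hf := map_zero D))

theorem mapCoeff_C_mul_T (D : ZeroHom Fn Fn) (j : ℤ) (f : Fn) :
    mapCoeff D (C f * T j) = C (D f) * T j := by
  rw [← single_eq_C_mul_T, ← single_eq_C_mul_T, mapCoeff_single]

theorem mapCoeff_C (D : ZeroHom Fn Fn) (f : Fn) : mapCoeff D (C f) = C (D f) :=
  mapCoeff_single D 0 f

theorem mapCoeff_T_mul_C (D : ZeroHom Fn Fn) (j : ℤ) (f : Fn) :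
    mapCoeff D (T j * C f) = T j * C (D f) := by
  rw [mul_comm, mapCoeff_C_mul_T, mul_comm]

theorem mapCoeff_dX_sub {p p' : Fn[T;T⁻¹]} (hp : ∀ k, Smooth (p.coeff k))
    (hp' : ∀ k, Smooth (p'.coeff k)) : mapCoeff dX (p - p') = mapCoeff dX p - mapCoeff dX p' := by
  ext1 k
  exact dX_sub (hp k) (hp' k)

theorem smooth_coeff_C_mul_T {f : Fn} (hf : Smooth f) (j k : ℤ) :
    Smooth ((C f * T j).coeff k) := by
  rw [← single_eq_C_mul_T]
  change Smooth (Finsupp.single j f k)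
  rw [Finsupp.single_apply]
  split_ifs
  exacts [hf, smooth_zero]

theorem smooth_coeff_C {f : Fn} (hf : Smooth f) (k : ℤ) : Smooth ((C f).coeff k) := by
  have := smooth_coeff_C_mul_T hf 0 k
  rwa [T_zero, mul_one] at this

theorem C_mul_T_one_eq_zero {f : Fn} : C f * T 1 = 0 ↔ f = 0 := by
  rw [← single_eq_C_mul_T]
  refine ⟨fun h => ?_, fun h => by rw [h]; simp⟩
  have := congrArg (fun p => p.coeff 1) h
  exact (Finsupp.single_eq_same (a := (1 : ℤ)) (b := f)).symm.trans this

theorem cHSystem_iff_isFlow {p : Primitives} {Γ : Fn} (hp : p.All Smooth) (hΓ : Smooth Γ) :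
    CHSystem p Γ ↔ IsFlow p.potential (laxV p Γ) := by
  have hq := Primitives.all_potential rngClass_smooth Smooth.dX hp
  obtain ⟨hf1, hf2, hg1, hg2⟩ := Primitives.all_fg rngClass_smooth Smooth.dX hp
  have hC : ∀ {f : Fn}, Smooth f → ∀ j k : ℤ, Smooth ((C f * T j).coeff k) := fun hf j k =>
    smooth_coeff_C_mul_T hf j k
  have df1 := Primitives.dX_f1 hp
  have df2 := Primitives.dX_f2 hp
  have dg1 := Primitives.dX_g1 hp
  have dg2 := Primitives.dX_g2 hp
  obtain ⟨hm1, hm2, hn1, hn2⟩ := hq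
  have hTS : (T 1 : Fn[T;T⁻¹]) * T (-1) = 1 := by
    rw [← T_add]
    exact T_zero
  have hT2 : (T (-2) : Fn[T;T⁻¹]) = T (-1) * T (-1) := by
    rw [← T_add]
    rfl
  have h0 : ∀ D : ZeroHom Fn Fn, mapCoeff D 0 = 0 := fun D => by
    have := mapCoeff_C D 0
    rwa [map_zero C, map_zero D, map_zero C] at this
  have hone : mapCoeff dT 1 = 0 := by
    have := mapCoeff_C dT 1
    rwa [map_one, dT_one, map_zero] at this
  have hUt : (laxU p.potential).map (mapCoeff dT) =
      !![0, T 1 * C (dT p.potential.m1), 0;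
        T 1 * C (dT p.potential.n1), 0, T 1 * C (dT p.potential.m2);
        0, T 1 * C (dT p.potential.n2), 0] := by
    ext1 i j
    have hm := mapCoeff_T_mul_C dT 1
    fin_cases i <;> fin_cases j
    exacts [h0 _, hm _, hone, hm _, h0 _, hm _, hone, hm _, h0 _]
  have hV : laxV p Γ =
      !![-(C p.f1 * C p.g1), C p.g1 * T (-1) - C p.potential.m1 * C Γ * T 1, -(C p.g1 * C p.g2);
        C p.f1 * T (-1) - C p.potential.n1 * C Γ * T 1,
          C p.f1 * C p.g1 + C p.f2 * C p.g2 - T (-1) * T (-1),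
          C p.g2 * T (-1) - C p.potential.m2 * C Γ * T 1;
        -(C p.f1 * C p.f2), C p.f2 * T (-1) - C p.potential.n2 * C Γ * T 1,
          -(C p.f2 * C p.g2)] := by
    ext1 i j
    fin_cases i <;> fin_cases j <;> simp [laxV, hT2]
  have hVx : (laxV p Γ).map (mapCoeff dX) =
      !![C (dX (-(p.f1 * p.g1))), C (dX p.g1) * T (-1) - C (dX (p.potential.m1 * Γ)) * T 1,
          C (dX (-(p.g1 * p.g2)));
        C (dX p.f1) * T (-1) - C (dX (p.potential.n1 * Γ)) * T 1,
          C (dX (p.f1 * p.g1 + p.f2 * p.g2)),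
          C (dX p.g2) * T (-1) - C (dX (p.potential.m2 * Γ)) * T 1;
        C (dX (-(p.f1 * p.f2))), C (dX p.f2) * T (-1) - C (dX (p.potential.n2 * Γ)) * T 1,
          C (dX (-(p.f2 * p.g2)))] := by
    have hd : ∀ f : Fn, mapCoeff dX (C f - 0) = C (dX f) := fun f => by
      rw [sub_zero, mapCoeff_C]
    have ho : ∀ {f g : Fn} (j : ℤ), Smooth f → Smooth g →
        mapCoeff dX (C f * T j - C g * T 1) = C (dX f) * T j - C (dX g) * T 1 := fun j hf hg => by
      rw [mapCoeff_dX_sub (hC hf j) (hC hg 1), mapCoeff_C_mul_T, mapCoeff_C_mul_T]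
    have hc : mapCoeff dX (C (p.f1 * p.g1 + p.f2 * p.g2) - T (-2) - 0)
        = C (dX (p.f1 * p.g1 + p.f2 * p.g2)) := by
      have e : (T (-2) : Fn[T;T⁻¹]) = C 1 * T (-2) := by rw [map_one, one_mul]
      rw [sub_zero, e, mapCoeff_dX_sub (smooth_coeff_C ((hf1.mul hg1).add (hf2.mul hg2)))
        (hC smooth_one _), mapCoeff_C, mapCoeff_C_mul_T, dX_one, map_zero, zero_mul, sub_zero]
    ext1 i j
    fin_cases i <;> fin_cases j
    exacts [hd _, ho _ hg1 (hm1.mul hΓ), hd _, ho _ hf1 (hn1.mul hΓ), hc, ho _ hg2 (hm2.mul hΓ),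
      hd _, ho _ hf2 (hn2.mul hΓ), hd _]
  have key := zeroCurvature_eq hTS (C p.potential.m1) (C p.potential.m2) (C p.potential.n1)
    (C p.potential.n2) (C p.f1) (C p.f2) (C p.g1) (C p.g2) (C Γ) (C (dT p.potential.m1))
    (C (dT p.potential.m2)) (C (dT p.potential.n1)) (C (dT p.potential.n2))
    (C (dX (p.potential.m1 * Γ))) (C (dX (p.potential.m2 * Γ))) (C (dX (p.potential.n1 * Γ)))
    (C (dX (p.potential.n2 * Γ)))
  -- The function only fixes the intended left side: after `U_t`, `V`, `V_x` and the derivatives of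
  -- `fᵢ, gᵢ` are rewritten, it agrees with the algebraic identity up to the definition of `U`.
  have hZ := (fun h : ((laxU p.potential).map (mapCoeff dT) - (laxV p Γ).map (mapCoeff dX)
      + (laxU p.potential * laxV p Γ - laxV p Γ * laxU p.potential) = _) => h.trans key) (by
    rw [hUt, hVx, hV, dX_neg, dX_neg, dX_neg, dX_neg, dX_add (hf1.mul hg1) (hf2.mul hg2),
      dX_mul hf1 hg1, dX_mul hg1 hg2, dX_mul hf1 hf2, dX_mul hf2 hg2, df1, df2, dg1, dg2]
    simp only [map_neg, map_add, map_mul, map_sub]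
    rfl)
  have h2 : (2 : Fn[T;T⁻¹]) = C 2 := (map_ofNat C 2).symm
  simp only [h2, ← map_mul, ← map_sub, ← map_add] at hZ
  rw [IsFlow, hZ, CHSystem]
  simp only [mul_comm Γ]
  constructor
  · rintro ⟨e1, e2, e3, e4⟩
    rw [e1, e2, e3, e4]
    ext1 i j
    fin_cases i <;> fin_cases j <;> simp
  · intro h
    have h' := fun i j => congrFun (congrFun h i) j
    exact ⟨C_mul_T_one_eq_zero.1 (h' 0 1), C_mul_T_one_eq_zero.1 (h' 1 2),
      C_mul_T_one_eq_zero.1 (h' 1 0), C_mul_T_one_eq_zero.1 (h' 2 1)⟩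

end

end FourCH

open FourCH in
theorem mainTheorem2 :
    -- every flow of the hierarchy
    (∀ (q : Potential Fn) (V : LaxMatrix), q.All Smooth → V.All Smooth → IsFlow q V →
      -- `(ln φᵢ)_x` is a conserved density, for every value of the spectral parameter
      (∀ (l : ℂ), l ≠ 0 → ∀ (Φ : ℝ → ℝ → Fin 3 → ℂ),
        (∀ i, ContDiff ℝ 2 (fun z : ℝ × ℝ => Φ z.1 z.2 i)) →
        (∀ x t i, HasDerivAt (fun y => Φ y t i)
          (((laxU q).map (evalAt l x t)).mulVec (Φ x t) i) x) →
        (∀ x t i, HasDerivAt (fun s => Φ x s i)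
          ((V.map (evalAt l x t)).mulVec (Φ x t) i) t) →
        ∀ c : Chart,
          (∀ x t, Φ x t c.den ≠ 0 →
            let qxt : Potential ℂ := q.map (fun f => (f x t : ℂ))
            let y : ℂ := Φ x t c.fst / Φ x t c.den
            let z : ℂ := Φ x t c.snd / Φ x t c.den
            logDeriv (fun x' => Φ x' t c.den) x = density c l qxt y z ∧
            logDeriv (fun t' => Φ x t' c.den) t = flux c (V.map (evalAt l x t)) y z ∧
            HasDerivAt (fun x' => Φ x' t c.fst / Φ x' t c.den) (riccatiFst c l qxt y z) x ∧
            HasDerivAt (fun x' => Φ x' t c.snd / Φ x' t c.den) (riccatiSnd c l qxt y z) x ∧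
            ∃ D : ℂ,
              HasDerivAt (fun t' => logDeriv (fun x' => Φ x' t' c.den) x) D t ∧
              HasDerivAt (fun x' => logDeriv (fun t' => Φ x' t' c.den) t) D x) ∧
          (∀ x₀ x₁ t, (∀ x ∈ Set.uIcc x₀ x₁, Φ x t c.den ≠ 0) →
            HasDerivAt (fun t' => ∫ x in x₀..x₁, logDeriv (fun x' => Φ x' t' c.den) x)
              (logDeriv (fun t' => Φ x₁ t' c.den) t - logDeriv (fun t' => Φ x₀ t' c.den) t) t)) ∧
      -- expansions in non-negative powers of `λ`
      (q.All Bdd → V.All Bdd →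
        (∀ c : Chart,
          (∃! yz : LaurentSeries Fn × LaurentSeries Fn, IsExpansionZero c q yz.1 yz.2) ∧
          ∀ y z, IsExpansionZero c q y z →
            (∀ j, IsConserved q V (lamCoeff 1 (rho c 1 q y z) j)
              (lamCoeff 1 (current c 1 V y z) j)) ∧
            (∀ j ≥ 1, IsConservedDecaying q V (lamCoeff 1 (rho c 1 q y z) j))) ∧
        ∀ p : Primitives, p.All Bdd → p.potential = q →
          (∀ a b, IsExpansionZero .I q a b →
            a.coeff 0 = 0 ∧ b.coeff 0 = 0 ∧ a.coeff 1 = -p.g1 ∧ b.coeff 1 = -p.f2 ∧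
            a.coeff 2 = 0 ∧ b.coeff 2 = 0 ∧
            lamCoeff 1 (rho .I 1 q a b) 2 = p.rho1 ∧
            lamCoeff 1 (rho .I 1 q a b) 4 = q.n1 * a.coeff 3 + q.m2 * b.coeff 3 ∧
            IsEquivalent q (q.n1 * a.coeff 3 + q.m2 * b.coeff 3) p.rho3
              (p.exact3 (a.coeff 3) (b.coeff 3)) ∧
            IsConserved q V p.rho3
              (lamCoeff 1 (current .I 1 V a b) 4 - dT (p.exact3 (a.coeff 3) (b.coeff 3))) ∧
            IsConservedDecaying q V p.rho3) ∧
          (∀ σ τ, IsExpansionZero .II q σ τ →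
            IsEquivalent q (lamCoeff 1 (rho .II 1 q σ τ) 2) p.rhoBar2
              (fun x t => -(1 / 2) * τ.coeff 2 x t) ∧
            IsConserved q V p.rhoBar2
              (lamCoeff 1 (current .II 1 V σ τ) 2
                - dT (fun x t => -(1 / 2) * τ.coeff 2 x t)) ∧
            IsConservedDecaying q V p.rhoBar2)) ∧
      -- expansions in non-positive powers of `λ`
      (∀ c : Chart, Nondegenerate c q →
        (∃! yz : LaurentSeries Fn × LaurentSeries Fn, IsExpansionInfty c q yz.1 yz.2) ∧
        ∀ y z, IsExpansionInfty c q y z →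
          (∀ j, IsConserved q V (lamCoeff (-1) (rho c (-1) q y z) j)
            (lamCoeff (-1) (current c (-1) V y z) j)) ∧
          lamCoeff (-1) (rho c (-1) q y z) 1 = rho0 q ∧
          lamCoeff (-1) (rho c (-1) q y z) 0 = c.rhoM1 q)) ∧
    -- each of the sequences contains infinitely many independent conserved quantities
    (∀ c : Chart,
      InfinitelyManyIndependent c 1 (fun q y z => IsExpansionZero c q y z) ∧
      InfinitelyManyIndependent c (-1)
        (fun q y z => Nondegenerate c q ∧ IsExpansionInfty c q y z)) ∧
    -- the four-component Camassa–Holm type systems are flows of the hierarchy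
    (∀ (p : Primitives) (Γ : Fn), p.All Smooth → Smooth Γ →
      (CHSystem p Γ ↔ IsFlow p.potential (laxV p Γ))) := by
  refine ⟨fun q V hq hV hflow => ⟨fun l _ Φ hΦ hx ht c => ⟨?_, ?_⟩, fun hqb hVb => ⟨fun c => ⟨?_, ?_⟩, ?_⟩,
    fun c hn => ⟨?_, ?_⟩⟩, fun c => ⟨?_, ?_⟩, fun p Γ hp hΓ => cHSystem_iff_isFlow hp hΓ⟩
  · exact fun x t h => conserved_density hΦ hx ht c x t h
  · exact fun x₀ x₁ t h => hasDerivAt_integral_logDeriv (hΦ c.den) h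
  · exact existsUnique_expansionZero c hqb
  · exact fun y z h => ⟨fun j => h.isConserved hqb hVb hflow j,
      fun j hj => h.isConservedDecaying hqb hVb hflow hj⟩
  · rintro p hp rfl
    exact ⟨fun a b h => h.explicit_I hp hVb hflow, fun σ τ h => h.explicit_II hp hVb hflow⟩
  · exact existsUnique_expansionInfty hq hn
  · exact fun y z h => ⟨fun j => h.isConserved hn hq hV hflow j, h.2, h.lamCoeff_rho_zero hn hq⟩
  · exact infinitelyManyIndependent_zero c
  · exact infinitelyManyIndependent_infty c
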